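/- Let $S$ be a complete separable metric space, let $h_1,h_2,\dots$ be bounded continuous functions on $S$ with $0\le h_k\le 1$ and $\bigcup_k\{x: h_k(x)>0\}=S$. Let $\mathcal M_{\{h_k\}}(S)$ be the set of Borel measures $\nu$ on $S$ with $\int_S h_k\,d\nu<\infty$ for all $k$, with the topology in which $\nu_n\to\nu$ iff $\int_S f h_k\,d\nu_n\to\int_S f h_k\,d\nu$ for all $k$ and all bounded continuous $f$ on $S$. Let $\mathcal M_{\{h_k\}}(S\times[0,\infty))$ be the set of Borel measures $\mu$ on $S\times[0,\infty)$ with $\int_{S\times[0,K]}h_k(x)\,\mu(dx\times du)<\infty$ for all $k$ and $K>0$, with the topology in which $\mu_n\to\mu$ iff $\int f h_k\,d\mu_n\to\int f h_k\,d\mu$ for all $k$ and all bounded continuous $f$ on $S\times[0,\infty)$ whose support is contained in $S\times[0,K]$ for some $K>0$. Let $\Rightarrow$ denote convergence in distribution of random elements of these spaces. For each $n$ let $r_n>0$, let $\xi^n$ be a point process on $S\times[0,r_n]$ (a random counting measure with values in $\mathcal M_{\{h_k\}}(S\times[0,\infty))$ that almost surely has no mass outside $S\times[0,r_n]$), and define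 $$\Xi^n(dx)=\frac1{r_n}\,\xi^n(dx\times[0,r_n]).$$ Suppose that for every Borel measurable $f:S\times[0,\infty)\to[0,\infty)$, $$E\Big[e^{-\int f(x,u)\,\xi^n(dx\times du)}\Big]=E\Big[e^{-\int F^n_f(x)\,\Xi^n(dx)}\Big],\qquad F^n_f(x)=-r_n\log\frac1{r_n}\int_0^{r_n}e^{-f(x,u)}\,du,$$ that is, the $[0,r_n]$ components of the points are independent, uniformly distributed on $[0,r_n]$, and independent of $\Xi^n$. Assume $r_n\to\infty$. Then: (i) $\xi^n\Rightarrow\xi$ in $\mathcal M_{\{h_k\}}(S\times[0,\infty))$ for some $\xi$ if and only if $\Xi^n\Rightarrow\Xi$ in $\mathcal M_{\{h_k\}}(S)$ for some $\Xi$; (ii) if $\xi^n\Rightarrow\xi$ and $\Xi^n\Rightarrow\Xi$, then $\xi$ is conditionally Poisson with Cox measure $\Xi\times\Lambda$, where $\Lambda$ is Lebesgue measure on $[0,\infty)$; that is, the law of $\xi$ is the mixture, over the law of $\Xi$, of the laws of Poisson random measures with mean measure $\Xi\times\Lambda$; (iii) if $\xi$ is conditionally Poisson with Cox measure $\Xi\times\Lambda$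 in this sense, then $\xi^n\Rightarrow\xi$ if and only if $\Xi^n\Rightarrow\Xi$. -/

import Mathlib

open MeasureTheory ProbabilityTheory Filter Topology
open scoped NNReal ENNReal BoundedContinuousFunction

noncomputable section

/-- Lebesgue measure on the half-line `[0, ∞)`. -/
def halfLineLebesgue : Measure ℝ≥0 :=
  ((volume : Measure ℝ).restrict (Set.Ici 0)).map Real.toNNReal

/-- `exp (-x)` for `x ∈ [0, ∞]`, with `exp (-∞) = 0`. -/
def expNeg (x : ℝ≥0∞) : ℝ :=
  if x = ∞ then 0 else Real.exp (-x.toReal)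

/-- A counting measure: it takes values in `{0, 1, 2, …, ∞}` on measurable sets. -/
def IsCountingMeasure {E : Type*} [MeasurableSpace E] (μ : Measure E) : Prop :=
  ∀ A : Set E, MeasurableSet A → ∃ m : ℕ∞, μ A = (m : ℝ≥0∞)

section Spaces

variable {S : Type*} [TopologicalSpace S] [MeasurableSpace S]

/-- The space `M_{h_k}(S)` of Borel measures `ν` on `S` with `∫ h_k dν < ∞` for all `k`. -/
def LocationMeasures (h : ℕ → S →ᵇ ℝ) : Type _ :=
  {ν : Measure S // ∀ k, ∫⁻ x, ENNReal.ofReal (h k x) ∂ν < ∞}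

/-- The space `M_{h_k}(S × [0, ∞))` of Borel measures `μ` on `S × [0, ∞)` with
`∫_{S × [0, K]} h_k dμ < ∞` for all `k` and `K`. -/
def LevelMeasures (h : ℕ → S →ᵇ ℝ) : Type _ :=
  {μ : Measure (S × ℝ≥0) //
    ∀ (k : ℕ) (K : ℝ≥0), ∫⁻ z in {z : S × ℝ≥0 | z.2 ≤ K}, ENNReal.ofReal (h k z.1) ∂μ < ∞}

/-- The coarsest topology making `ν ↦ ∫ f h_k dν` continuous for all bounded continuous `f` and
all `k`. -/
instance LocationMeasures.instTopologicalSpace (h : ℕ → S →ᵇ ℝ) :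
    TopologicalSpace (LocationMeasures h) :=
  ⨅ (k : ℕ) (f : S →ᵇ ℝ),
    TopologicalSpace.induced (fun ν : LocationMeasures h => ∫ x, f x * h k x ∂ν.1) inferInstance

/-- The coarsest topology making `μ ↦ ∫ f h_k dμ` continuous for all `k` and all bounded
continuous `f` on `S × [0, ∞)` supported in some `S × [0, K]`. -/
instance LevelMeasures.instTopologicalSpace (h : ℕ → S →ᵇ ℝ) :
    TopologicalSpace (LevelMeasures h) :=
  ⨅ (k : ℕ) (f : {f : (S × ℝ≥0) →ᵇ ℝ // ∃ K : ℝ≥0, ∀ x u, K < u → f (x, u) = 0}),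
    TopologicalSpace.induced (fun μ : LevelMeasures h => ∫ z, f.1 z * h k z.1 ∂μ.1) inferInstance

instance LocationMeasures.instMeasurableSpace (h : ℕ → S →ᵇ ℝ) :
    MeasurableSpace (LocationMeasures h) := borel _

instance LocationMeasures.instBorelSpace (h : ℕ → S →ᵇ ℝ) :
    BorelSpace (LocationMeasures h) := ⟨rfl⟩

instance LevelMeasures.instMeasurableSpace (h : ℕ → S →ᵇ ℝ) :
    MeasurableSpace (LevelMeasures h) := borel _

instance LevelMeasures.instBorelSpace (h : ℕ → S →ᵇ ℝ) :
    BorelSpace (LevelMeasures h) := ⟨rfl⟩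

/-- The measure `A ↦ r⁻¹ μ(A × [0, r])` on `S` (it is `0` for the irrelevant value `r = 0`). -/
def LevelMeasures.normalizedMarginal [BorelSpace S] {h : ℕ → S →ᵇ ℝ} (r : ℝ≥0)
    (μ : LevelMeasures h) : LocationMeasures h :=
  ⟨r⁻¹ • (μ.1.restrict {z : S × ℝ≥0 | z.2 ≤ r}).map Prod.fst, fun k => by
    have hm : Measurable fun x => ENNReal.ofReal (h k x) :=
      ENNReal.measurable_ofReal.comp (h k).continuous.measurable
    rw [lintegral_smul_measure, lintegral_map hm measurable_fst]
    exact ENNReal.mul_lt_top ENNReal.coe_lt_top (μ.2 k r)⟩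

/-- `F_f^r(x) = -r log (r⁻¹ ∫_0^r exp (-f(x, u)) du)`. -/
def levelTransform (r : ℝ≥0) (f : S × ℝ≥0 → ℝ) (x : S) : ℝ :=
  -(r : ℝ) * Real.log ((r : ℝ)⁻¹ * ∫ u in Set.Iic r, Real.exp (-f (x, u)) ∂halfLineLebesgue)

/-- `ρ` is the law of a Poisson random measure on `S × [0, ∞)` with mean measure `m`. -/
structure IsPoissonLaw {h : ℕ → S →ᵇ ℝ} (ρ : Measure (LevelMeasures h))
    (m : Measure (S × ℝ≥0)) : Prop where
  isProbabilityMeasure : IsProbabilityMeasure ρ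
  counting : ∀ᵐ μ ∂ρ, IsCountingMeasure μ.1
  poisson : ∀ A : Set (S × ℝ≥0), MeasurableSet A → m A < ∞ →
    ρ.map (fun μ => μ.1 A) = (poissonMeasure (m A).toNNReal).map (fun j : ℕ => (j : ℝ≥0∞))
  indep : ∀ A : ℕ → Set (S × ℝ≥0), (∀ i, MeasurableSet (A i)) →
    Pairwise (fun i j => Disjoint (A i) (A j)) → iIndepFun (fun i μ => μ.1 (A i)) ρ

/-- A random measure on `S × [0, ∞)` with law `Q` is conditionally Poisson with Cox measure
`Ξ × Λ`, where `Ξ` has law `P` and `Λ` is Lebesgue measure: there is a conditional distribution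
`κ` given `Ξ` under which it is Poisson with mean measure `Ξ × Λ`, and mixing `κ` over the law of
`Ξ` gives `Q`. -/
def IsConditionallyPoisson {h : ℕ → S →ᵇ ℝ} (Q : Measure (LevelMeasures h))
    (P : Measure (LocationMeasures h)) : Prop :=
  ∃ κ : Kernel (LocationMeasures h) (LevelMeasures h), IsMarkovKernel κ ∧
    (∀ᵐ ν ∂P, IsPoissonLaw (κ ν) (ν.1.prod halfLineLebesgue)) ∧ Q = P.bind κ

end Spaces

end

set_option linter.unusedSectionVars false

/-! ### The function `expNeg` -/

section ExpNeg

lemma expNeg_eq_toReal_exp (x : ℝ≥0∞) : expNeg x = (EReal.exp (-(x : EReal))).toReal := by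
  unfold expNeg
  induction x with
  | top => simp
  | coe x =>
    have : (-(((x : ℝ≥0) : ℝ≥0∞) : EReal)) = ((-(x : ℝ) : ℝ) : EReal) := by
      rw [EReal.coe_neg]; rfl
    rw [this, EReal.exp_coe]
    simp [Real.exp_nonneg]

lemma expNeg_zero : expNeg 0 = 1 := by simp [expNeg]

lemma expNeg_top : expNeg ∞ = 0 := by simp [expNeg]

lemma expNeg_ofReal {t : ℝ} (ht : 0 ≤ t) : expNeg (ENNReal.ofReal t) = Real.exp (-t) := by
  simp [expNeg, ENNReal.toReal_ofReal ht]

lemma expNeg_of_ne_top {x : ℝ≥0∞} (hx : x ≠ ∞) : expNeg x = Real.exp (-x.toReal) := by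
  simp [expNeg, hx]

lemma expNeg_nonneg (x : ℝ≥0∞) : 0 ≤ expNeg x := by
  unfold expNeg; split_ifs <;> positivity

lemma expNeg_le_one (x : ℝ≥0∞) : expNeg x ≤ 1 := by
  unfold expNeg; split_ifs
  · exact zero_le_one
  · simp

lemma expNeg_add (x y : ℝ≥0∞) : expNeg (x + y) = expNeg x * expNeg y := by
  by_cases hx : x = ∞
  · simp [hx, expNeg_top]
  by_cases hy : y = ∞
  · simp [hy, expNeg_top]
  rw [expNeg_of_ne_top hx, expNeg_of_ne_top hy, expNeg_of_ne_top (by simp [hx, hy]),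
    ENNReal.toReal_add hx hy, neg_add, Real.exp_add]

lemma expNeg_antitone : Antitone expNeg := by
  intro x y hxy
  by_cases hy : y = ∞
  · simpa [hy, expNeg_top] using expNeg_nonneg x
  have hx : x ≠ ∞ := ne_top_of_le_ne_top hy hxy
  rw [expNeg_of_ne_top hx, expNeg_of_ne_top hy, Real.exp_le_exp, neg_le_neg_iff]
  exact ENNReal.toReal_mono hy hxy

lemma expNeg_injective : Function.Injective expNeg := by
  intro x y h
  by_cases hx : x = ∞ <;> by_cases hy : y = ∞
  · rw [hx, hy]
  · rw [hx, expNeg_top, expNeg_of_ne_top hy] at h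
    exact absurd h.symm (Real.exp_ne_zero _)
  · rw [hy, expNeg_top, expNeg_of_ne_top hx] at h
    exact absurd h (Real.exp_ne_zero _)
  · rw [expNeg_of_ne_top hx, expNeg_of_ne_top hy, Real.exp_eq_exp, neg_inj] at h
    exact (ENNReal.toReal_eq_toReal_iff' hx hy).1 h

lemma continuous_expNeg : Continuous expNeg := by
  have h : expNeg = fun x : ℝ≥0∞ => (EReal.exp (-(x : EReal))).toReal :=
    funext expNeg_eq_toReal_exp
  rw [h]
  have h1 : Continuous fun x : ℝ≥0∞ => EReal.exp (-(x : EReal)) :=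
    _root_.ENNReal.continuous_exp.comp (continuous_neg.comp continuous_coe_ennreal_ereal)
  refine continuous_iff_continuousAt.2 fun x => ?_
  refine (ENNReal.continuousAt_toReal ?_).comp h1.continuousAt
  refine ne_top_of_le_ne_top ENNReal.one_ne_top ?_
  rw [← EReal.exp_zero]
  exact EReal.exp_monotone (EReal.neg_le_zero.2 (EReal.coe_ennreal_nonneg x))

lemma measurable_expNeg : Measurable expNeg := continuous_expNeg.measurable

lemma norm_expNeg_le_one (x : ℝ≥0∞) : ‖expNeg x‖ ≤ 1 := by
  rw [Real.norm_of_nonneg (expNeg_nonneg x)]; exact expNeg_le_one x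

lemma integrable_expNeg {Ω : Type*} [MeasurableSpace Ω] {P : Measure Ω} [IsFiniteMeasure P]
    {X : Ω → ℝ≥0∞} (hX : AEMeasurable X P) : Integrable (fun ω => expNeg (X ω)) P :=
  .of_bound (measurable_expNeg.comp_aemeasurable hX).aestronglyMeasurable 1
    (.of_forall fun _ => norm_expNeg_le_one _)

lemma expNeg_list_sum (l : List ℝ≥0∞) : expNeg l.sum = (l.map expNeg).prod := by
  induction l with
  | nil => simp [expNeg_zero]
  | cons a l ih => simp [expNeg_add, ih]

lemma expNeg_sum {ι : Type*} (s : Finset ι) (x : ι → ℝ≥0∞) :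
    expNeg (∑ i ∈ s, x i) = ∏ i ∈ s, expNeg (x i) := by
  classical
  induction s using Finset.induction_on with
  | empty => simp [expNeg_zero]
  | insert a s ha ih => rw [Finset.sum_insert ha, Finset.prod_insert ha, expNeg_add, ih]

/-- If `b` exceeds `a` by at most the factor `1 + ε`, then `exp (-a)` and `exp (-b)` differ by at
most `ε`. -/
lemma expNeg_sub_expNeg_le {a b : ℝ≥0∞} {ε : ℝ} (hε : 0 ≤ ε)
    (hb : b ≤ ENNReal.ofReal (1 + ε) * a) : expNeg a - expNeg b ≤ ε := by
  by_cases ha : a = ∞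
  · rw [ha, expNeg_top]; linarith [expNeg_nonneg b]
  have h1 : expNeg (ENNReal.ofReal (1 + ε) * a) ≤ expNeg b := expNeg_antitone hb
  have hm : ENNReal.ofReal (1 + ε) * a ≠ ∞ := ENNReal.mul_ne_top ENNReal.ofReal_ne_top ha
  rw [expNeg_of_ne_top hm, ENNReal.toReal_mul, ENNReal.toReal_ofReal (by linarith)] at h1
  rw [expNeg_of_ne_top ha]
  set t := a.toReal
  have ht : 0 ≤ t := ENNReal.toReal_nonneg
  have h2 : Real.exp (-((1 + ε) * t)) = Real.exp (-t) * Real.exp (-(ε * t)) := by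
    rw [← Real.exp_add]; ring_nf
  have h3 : 1 - ε * t ≤ Real.exp (-(ε * t)) := by linarith [Real.add_one_le_exp (-(ε * t))]
  have h4 : t * Real.exp (-t) ≤ 1 := by
    have := Real.add_one_le_exp t
    rw [Real.exp_neg, ← div_eq_mul_inv, div_le_one (Real.exp_pos _)]; linarith
  have h5 : 0 < Real.exp (-t) := Real.exp_pos _
  nlinarith [mul_le_mul_of_nonneg_left h4 hε, mul_le_mul_of_nonneg_left h3 h5.le]

lemma abs_expNeg_sub_expNeg_le {a b : ℝ≥0∞} {ε : ℝ} (hε : 0 ≤ ε) (hab : a ≤ b)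
    (hb : b ≤ ENNReal.ofReal (1 + ε) * a) : |expNeg a - expNeg b| ≤ ε := by
  rw [abs_of_nonneg (sub_nonneg.2 (expNeg_antitone hab))]
  exact expNeg_sub_expNeg_le hε hb

end ExpNeg

/-! ### Laplace transforms on products of `[0, ∞]` -/

section Cube

variable {ι : Type*}

/-- The function `x ↦ exp (-∑ x i)`, the sum being over the entries `i` of a list. -/
noncomputable def expMonomial (l : List ι) : C(ι → ℝ≥0∞, ℝ) where
  toFun x := expNeg (l.map x).sum
  continuous_toFun := by
    have h : (fun x : ι → ℝ≥0∞ => expNeg (l.map x).sum)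
        = fun x => (l.map fun i => expNeg (x i)).prod := by
      funext x; rw [expNeg_list_sum, List.map_map]; rfl
    rw [h]
    exact continuous_list_prod l fun i _ => continuous_expNeg.comp (continuous_apply i)

lemma expMonomial_apply (l : List ι) (x : ι → ℝ≥0∞) :
    expMonomial l x = expNeg (l.map x).sum := rfl

lemma expMonomial_append (l l' : List ι) :
    expMonomial (l ++ l') = expMonomial l * expMonomial l' := by
  ext x; simp [expMonomial_apply, expNeg_add]

/-- The span of the exponential monomials is dense in the continuous functions on
`[0, ∞]^ι`. -/
lemma topologicalClosure_span_expMonomial :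
    (Submodule.span ℝ (Set.range (expMonomial (ι := ι)))).topologicalClosure = ⊤ := by
  let A : Subalgebra ℝ C(ι → ℝ≥0∞, ℝ) := Algebra.adjoin ℝ (Set.range (expMonomial (ι := ι)))
  have hA : A.topologicalClosure = ⊤ := by
    apply ContinuousMap.subalgebra_topologicalClosure_eq_top_of_separatesPoints
    intro x y hxy
    obtain ⟨i, hi⟩ := Function.ne_iff.1 hxy
    refine ⟨expMonomial [i], ⟨expMonomial [i], Algebra.subset_adjoin ⟨[i], rfl⟩, rfl⟩, ?_⟩
    simpa [expMonomial_apply] using fun h => hi (expNeg_injective h)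
  have hcl : (Submonoid.closure (Set.range (expMonomial (ι := ι))) : Set C(ι → ℝ≥0∞, ℝ))
      = Set.range (expMonomial (ι := ι)) := by
    apply Set.Subset.antisymm _ Submonoid.subset_closure
    intro f hf
    induction hf using Submonoid.closure_induction with
    | mem f hf => exact hf
    | one => exact ⟨[], by ext x; simp [expMonomial_apply, expNeg_zero]⟩
    | mul f g _ _ hf hg =>
      obtain ⟨l, rfl⟩ := hf
      obtain ⟨l', rfl⟩ := hg
      exact ⟨l ++ l', expMonomial_append l l'⟩
  have h1 : Subalgebra.toSubmodule A = Submodule.span ℝ (Set.range (expMonomial (ι := ι))) := by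
    rw [Algebra.adjoin_eq_span, hcl]
  rw [← h1]
  apply SetLike.coe_injective
  have := congrArg (fun B : Subalgebra ℝ C(ι → ℝ≥0∞, ℝ) => (B : Set C(ι → ℝ≥0∞, ℝ))) hA
  simpa using! this

lemma exists_span_expMonomial_norm_sub_lt (f : C(ι → ℝ≥0∞, ℝ)) {ε : ℝ} (hε : 0 < ε) :
    ∃ p ∈ Submodule.span ℝ (Set.range (expMonomial (ι := ι))), ‖f - p‖ < ε := by
  have hf : f ∈ (Submodule.span ℝ (Set.range (expMonomial (ι := ι)))).topologicalClosure := by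
    rw [topologicalClosure_span_expMonomial]; trivial
  obtain ⟨p, hp, hd⟩ := Metric.mem_closure_iff.1 hf ε hε
  exact ⟨p, hp, by rwa [← dist_eq_norm]⟩

variable [Countable ι]

lemma integrable_continuousMap_cube (P : Measure (ι → ℝ≥0∞)) [IsFiniteMeasure P]
    (f : C(ι → ℝ≥0∞, ℝ)) : Integrable f P :=
  .of_bound f.continuous.measurable.aestronglyMeasurable ‖f‖ (.of_forall f.norm_coe_le_norm)

lemma abs_integral_sub_integral_le_norm_sub (P : Measure (ι → ℝ≥0∞)) [IsProbabilityMeasure P]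
    (f g : C(ι → ℝ≥0∞, ℝ)) : |∫ x, f x ∂P - ∫ x, g x ∂P| ≤ ‖f - g‖ := by
  rw [← integral_sub (integrable_continuousMap_cube P f) (integrable_continuousMap_cube P g),
    ← Real.norm_eq_abs]
  refine (norm_integral_le_of_norm_le_const (.of_forall (f - g).norm_coe_le_norm)).trans ?_
  simp

/-- Convergence of Laplace transforms gives weak convergence of probability measures on
`[0, ∞]^ι`. -/
lemma tendsto_of_tendsto_integral_expMonomial {α : Type*} {L : Filter α}
    {P : α → ProbabilityMeasure (ι → ℝ≥0∞)} {P₀ : ProbabilityMeasure (ι → ℝ≥0∞)}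
    (h : ∀ l : List ι, Tendsto (fun a => ∫ x, expMonomial l x ∂(P a : Measure (ι → ℝ≥0∞))) L
      (𝓝 (∫ x, expMonomial l x ∂(P₀ : Measure (ι → ℝ≥0∞))))) :
    Tendsto P L (𝓝 P₀) := by
  have hspan : ∀ p ∈ Submodule.span ℝ (Set.range (expMonomial (ι := ι))),
      Tendsto (fun a => ∫ x, p x ∂(P a : Measure (ι → ℝ≥0∞))) L
        (𝓝 (∫ x, p x ∂(P₀ : Measure (ι → ℝ≥0∞)))) := by
    intro p hp
    induction hp using Submodule.span_induction with
    | mem p hp => obtain ⟨l, rfl⟩ := hp; exact h l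
    | zero => simpa using tendsto_const_nhds
    | add p q _ _ hp hq =>
      have hadd : ∀ Q : ProbabilityMeasure (ι → ℝ≥0∞), ∫ x, (p + q) x ∂(Q : Measure (ι → ℝ≥0∞))
          = ∫ x, p x ∂(Q : Measure (ι → ℝ≥0∞)) + ∫ x, q x ∂(Q : Measure (ι → ℝ≥0∞)) :=
        fun Q => integral_add (integrable_continuousMap_cube _ p)
          (integrable_continuousMap_cube _ q)
      simp only [hadd]; exact hp.add hq
    | smul c p _ hp =>
      have hsmul : ∀ Q : ProbabilityMeasure (ι → ℝ≥0∞), ∫ x, (c • p) x ∂(Q : Measure (ι → ℝ≥0∞))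
          = c * ∫ x, p x ∂(Q : Measure (ι → ℝ≥0∞)) := fun Q => integral_const_mul c _
      simp only [hsmul]; exact hp.const_mul c
  rw [ProbabilityMeasure.tendsto_iff_forall_integral_tendsto]
  intro f
  rw [Metric.tendsto_nhds]
  intro ε hε
  obtain ⟨p, hp, hfp⟩ := exists_span_expMonomial_norm_sub_lt f.toContinuousMap
    (by positivity : 0 < ε / 3)
  filter_upwards [Metric.tendsto_nhds.1 (hspan p hp) (ε / 3) (by positivity)] with a ha
  have h1 := abs_integral_sub_integral_le_norm_sub (P a : Measure (ι → ℝ≥0∞)) f.toContinuousMap p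
  have h2 := abs_integral_sub_integral_le_norm_sub (P₀ : Measure (ι → ℝ≥0∞)) f.toContinuousMap p
  rw [Real.dist_eq] at ha ⊢
  simp only [BoundedContinuousFunction.coe_toContinuousMap] at h1 h2
  rw [abs_lt] at ha ⊢
  rw [abs_le] at h1 h2
  constructor <;> linarith

/-- A probability measure on `[0, ∞]^ι` is determined by its Laplace transform. -/
lemma measure_cube_ext_of_integral_expMonomial {P Q : Measure (ι → ℝ≥0∞)}
    [IsProbabilityMeasure P] [IsProbabilityMeasure Q]
    (h : ∀ l : List ι, ∫ x, expMonomial l x ∂P = ∫ x, expMonomial l x ∂Q) : P = Q := by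
  let P' : ProbabilityMeasure (ι → ℝ≥0∞) := ⟨P, inferInstance⟩
  let Q' : ProbabilityMeasure (ι → ℝ≥0∞) := ⟨Q, inferInstance⟩
  have ht : Tendsto (fun _ : ℕ => P') atTop (𝓝 Q') :=
    tendsto_of_tendsto_integral_expMonomial fun l => by
      change Tendsto (fun _ => ∫ x, expMonomial l x ∂P) _ (𝓝 (∫ x, expMonomial l x ∂Q))
      rw [h l]; exact tendsto_const_nhds
  have := tendsto_nhds_unique tendsto_const_nhds ht
  exact congrArg (fun R : ProbabilityMeasure (ι → ℝ≥0∞) => (R : Measure (ι → ℝ≥0∞))) this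

/-- A family of probability measures on `[0, ∞]^ι` is measurable if its Laplace transforms are. -/
lemma measurable_of_measurable_integral_expMonomial {α : Type*} [MeasurableSpace α]
    {P : α → Measure (ι → ℝ≥0∞)} [∀ a, IsProbabilityMeasure (P a)]
    (h : ∀ l : List ι, Measurable fun a => ∫ x, expMonomial l x ∂(P a)) : Measurable P := by
  have hspan : ∀ p ∈ Submodule.span ℝ (Set.range (expMonomial (ι := ι))),
      Measurable fun a => ∫ x, p x ∂(P a) := by
    intro p hp
    induction hp using Submodule.span_induction with
    | mem p hp => obtain ⟨l, rfl⟩ := hp; exact h l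
    | zero => simp
    | add p q _ _ hp hq =>
      have hadd : ∀ a, ∫ x, (p + q) x ∂(P a) = ∫ x, p x ∂(P a) + ∫ x, q x ∂(P a) :=
        fun a => integral_add (integrable_continuousMap_cube _ p)
          (integrable_continuousMap_cube _ q)
      simp only [hadd]; exact hp.add hq
    | smul c p _ hp =>
      have hsmul : ∀ a, ∫ x, (c • p) x ∂(P a) = c * ∫ x, p x ∂(P a) :=
        fun a => integral_const_mul c _
      simp only [hsmul]; exact hp.const_mul c
  have hcont : ∀ f : C(ι → ℝ≥0∞, ℝ), Measurable fun a => ∫ x, f x ∂(P a) := by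
    intro f
    choose p hp hfp using fun n : ℕ => exists_span_expMonomial_norm_sub_lt f
      (Nat.one_div_pos_of_nat (α := ℝ) (n := n))
    refine measurable_of_tendsto_metrizable (fun n => hspan (p n) (hp n)) ?_
    rw [tendsto_pi_nhds]
    intro a
    rw [tendsto_iff_dist_tendsto_zero]
    refine squeeze_zero (fun _ => dist_nonneg) (fun n => ?_) tendsto_one_div_add_atTop_nhds_zero_nat
    rw [dist_comm, Real.dist_eq]
    exact (abs_integral_sub_integral_le_norm_sub (P a) f (p n)).trans (hfp n).le
  refine Measurable.measure_of_isPiSystem_of_isProbabilityMeasure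
    (borel_eq_generateFrom_isClosed (α := ι → ℝ≥0∞) ▸ BorelSpace.measurable_eq)
    isPiSystem_isClosed fun F hF => ?_
  have hlim := fun a => HasOuterApproxClosed.tendsto_lintegral_apprSeq (F := F) hF (P a)
  refine measurable_of_tendsto_metrizable (f := fun n a => ∫⁻ x, hF.apprSeq n x ∂(P a))
    (fun n => ?_) (tendsto_pi_nhds.2 hlim)
  let g : C(ι → ℝ≥0∞, ℝ) := ⟨fun x => (hF.apprSeq n x : ℝ), by fun_prop⟩
  have : (fun a => ∫⁻ x, hF.apprSeq n x ∂(P a)) = fun a => ENNReal.ofReal (∫ x, g x ∂(P a)) := by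
    funext a
    rw [ofReal_integral_eq_lintegral_ofReal (integrable_continuousMap_cube _ g)
      (.of_forall fun x => NNReal.coe_nonneg _)]
    simp [g]
  rw [this]
  exact (hcont g).ennreal_ofReal

end Cube

/-! ### Laws on spaces whose topology is induced from a product of `[0, ∞]` -/

section Inducing

variable {ι M : Type*} [Countable ι] [TopologicalSpace M] [MeasurableSpace M] [BorelSpace M]
  {y : M → ι → ℝ≥0∞}

lemma measurableSpace_eq_comap_of_isInducing (hy : IsInducing y) :
    (inferInstance : MeasurableSpace M) = MeasurableSpace.comap y inferInstance := by
  have h1 : (inferInstance : MeasurableSpace M) = borel M := BorelSpace.measurable_eq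
  have h2 : (inferInstance : MeasurableSpace (ι → ℝ≥0∞)) = borel _ := BorelSpace.measurable_eq
  rw [h1, h2, hy.eq_induced, borel_comap]

lemma measurable_iff_of_isInducing (hy : IsInducing y) {Ω : Type*} [MeasurableSpace Ω]
    {X : Ω → M} : Measurable X ↔ ∀ i, Measurable fun ω => y (X ω) i := by
  have h := measurableSpace_eq_comap_of_isInducing hy
  have h2 : Measurable X ↔ Measurable (y ∘ X) :=
    ⟨hy.continuous.measurable.comp, fun hX A hA => by
      have hA' : MeasurableSet[MeasurableSpace.comap y inferInstance] A := h ▸ hA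
      obtain ⟨B, hB, rfl⟩ := hA'
      exact hX hB⟩
  rw [h2, measurable_pi_iff]; rfl

lemma tendsto_of_isInducing (hy : IsInducing y) {α : Type*} {L : Filter α}
    [L.IsCountablyGenerated] {P : α → ProbabilityMeasure M} {P₀ : ProbabilityMeasure M}
    (h : ∀ l : List ι, Tendsto (fun a => ∫ μ, expNeg (l.map (y μ)).sum ∂(P a : Measure M)) L
      (𝓝 (∫ μ, expNeg (l.map (y μ)).sum ∂(P₀ : Measure M)))) :
    Tendsto P L (𝓝 P₀) := by
  rcases L.eq_or_neBot with rfl | hL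
  · simp
  have hm : Measurable y := hy.continuous.measurable
  have hint : ∀ (R : ProbabilityMeasure M) (l : List ι),
      ∫ x, expMonomial l x ∂((R.map hm.aemeasurable : ProbabilityMeasure _) :
        Measure (ι → ℝ≥0∞)) = ∫ μ, expNeg (l.map (y μ)).sum ∂(R : Measure M) := by
    intro R l
    rw [ProbabilityMeasure.toMeasure_map, integral_map hm.aemeasurable
      (expMonomial l).continuous.measurable.aestronglyMeasurable]
    rfl
  have hX : Tendsto (fun a => (P a).map hm.aemeasurable) L (𝓝 (P₀.map hm.aemeasurable)) := by
    refine tendsto_of_tendsto_integral_expMonomial fun l => ?_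
    simp only [hint]; exact h l
  refine tendsto_of_forall_isOpen_le_liminf' fun G hG => ?_
  obtain ⟨V, hV, rfl⟩ := hy.isOpen_iff.1 hG
  have := ProbabilityMeasure.le_liminf_measure_open_of_tendsto hX hV
  simpa only [ProbabilityMeasure.toMeasure_map, Measure.map_apply hm hV.measurableSet] using this

lemma measure_ext_of_isInducing (hy : IsInducing y) {P Q : Measure M}
    [IsProbabilityMeasure P] [IsProbabilityMeasure Q]
    (h : ∀ l : List ι, ∫ μ, expNeg (l.map (y μ)).sum ∂P = ∫ μ, expNeg (l.map (y μ)).sum ∂Q) :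
    P = Q := by
  have hm : Measurable y := hy.continuous.measurable
  have := Measure.isProbabilityMeasure_map (μ := P) hm.aemeasurable
  have := Measure.isProbabilityMeasure_map (μ := Q) hm.aemeasurable
  have hmap : P.map y = Q.map y := by
    refine measure_cube_ext_of_integral_expMonomial fun l => ?_
    rw [integral_map hm.aemeasurable
      (expMonomial l).continuous.measurable.aestronglyMeasurable, integral_map hm.aemeasurable
      (expMonomial l).continuous.measurable.aestronglyMeasurable]
    exact h l
  ext A hA
  have hA' : MeasurableSet[MeasurableSpace.comap y inferInstance] A :=
    measurableSpace_eq_comap_of_isInducing hy ▸ hA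
  obtain ⟨B, hB, rfl⟩ := hA'
  rw [← Measure.map_apply hm hB, hmap, Measure.map_apply hm hB]

lemma measurable_kernel_of_isInducing (hy : IsInducing y) {α : Type*} [MeasurableSpace α]
    {P : α → Measure M} [∀ a, IsProbabilityMeasure (P a)]
    (h : ∀ l : List ι, Measurable fun a => ∫ μ, expNeg (l.map (y μ)).sum ∂(P a)) :
    Measurable P := by
  have hm : Measurable y := hy.continuous.measurable
  have := fun a => Measure.isProbabilityMeasure_map (μ := P a) hm.aemeasurable
  have hmap : Measurable fun a => (P a).map y := by
    refine measurable_of_measurable_integral_expMonomial fun l => ?_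
    convert h l using 2 with a
    rw [integral_map hm.aemeasurable
      (expMonomial l).continuous.measurable.aestronglyMeasurable]
    rfl
  refine Measure.measurable_of_measurable_coe _ fun A hA => ?_
  have hA' : MeasurableSet[MeasurableSpace.comap y inferInstance] A :=
    measurableSpace_eq_comap_of_isInducing hy ▸ hA
  obtain ⟨B, hB, rfl⟩ := hA'
  have := (Measure.measurable_coe hB).comp hmap
  simpa only [Function.comp_def, Measure.map_apply hm hB] using this

end Inducing

/-! ### Countable approximation of continuous functions from below -/

section Approximation

universe u

variable (E : Type u) [TopologicalSpace E] [SecondCountableTopology E]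
  [TopologicalSpace.MetrizableSpace E]

/-- There is a countable family of continuous functions with values in `[0, 1]`, containing `1`,
such that every continuous function with values in `[0, 1]` is the supremum of a directed
subfamily. -/
lemma exists_countable_approx_from_below :
    ∃ (ι : Type u) (_ : Countable ι) (g : ι → C(E, ℝ≥0)), (∀ i x, g i x ≤ 1) ∧ (∃ i, g i = 1) ∧
      ∀ f : C(E, ℝ≥0), (∀ x, f x ≤ 1) → ∃ s : Set ι,
        Directed (· ≤ ·) (fun i : s => fun x => (g i x : ℝ≥0∞)) ∧
        ∀ x, (f x : ℝ≥0∞) = ⨆ i : s, (g i x : ℝ≥0∞) := by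
  classical
  let := TopologicalSpace.metrizableSpaceMetric E
  let J := Option (TopologicalSpace.countableBasis E × ℕ × ℕ)
  have hJ : Countable J := inferInstance
  let b : J → C(E, ℝ≥0) := fun j => j.elim 1 fun p =>
    ⟨fun x => min 1 (TopologicalSpace.denseSeq ℝ≥0 p.2.1) *
      (1 - thickenedIndicator (Nat.one_div_pos_of_nat (α := ℝ) (n := p.2.2)) (p.1 : Set E)ᶜ x),
      by fun_prop⟩
  have hb1 : ∀ j x, b j x ≤ 1 := by
    rintro (_ | p) x
    · simp [b]
    · exact mul_le_one' (min_le_left _ _) tsub_le_self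
  let g : Finset J → C(E, ℝ≥0) := fun s =>
    ⟨fun x => s.sup fun j => b j x, Continuous.finset_sup_apply fun j _ => (b j).continuous⟩
  refine ⟨Finset J, inferInstance, g, fun s x => Finset.sup_le fun j _ => hb1 j x,
    ⟨{none}, by ext x; simp [g, b]⟩, fun f hf => ?_⟩
  refine ⟨{s | ∀ j ∈ s, ∀ x, b j x ≤ f x}, ?_, fun x => ?_⟩
  · rintro ⟨s, hs⟩ ⟨t, ht⟩
    refine ⟨⟨s ∪ t, fun j hj => (Finset.mem_union.1 hj).elim (hs j) (ht j)⟩, fun x => ?_,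
      fun x => ?_⟩
    · exact ENNReal.coe_le_coe.2 (Finset.sup_mono Finset.subset_union_left)
    · exact ENNReal.coe_le_coe.2 (Finset.sup_mono Finset.subset_union_right)
  · apply le_antisymm
    · refine le_of_forall_lt fun c hc => ?_
      obtain ⟨a, hca, haf⟩ := ENNReal.lt_iff_exists_nnreal_btwn.1 hc
      have haf' : a < f x := ENNReal.coe_lt_coe.1 haf
      obtain ⟨q, hq⟩ := (TopologicalSpace.denseRange_denseSeq ℝ≥0).exists_mem_open
        (isOpen_Ioo (a := a) (b := f x)) (exists_between haf')
      obtain ⟨U, hUB, hxU, hU⟩ := (TopologicalSpace.isBasis_countableBasis E).exists_subset_of_mem_open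
        (show x ∈ f ⁻¹' Set.Ioi (TopologicalSpace.denseSeq ℝ≥0 q) from hq.2)
        (isOpen_Ioi.preimage f.continuous)
      have hUo : IsOpen U := (TopologicalSpace.isBasis_countableBasis E).isOpen hUB
      obtain ⟨ε, hε, hεx⟩ := Metric.exists_real_pos_lt_infEDist_of_notMem_closure
        (x := x) (E := Uᶜ) (by rw [hUo.isClosed_compl.closure_eq]; simpa using hxU)
      obtain ⟨m, hm⟩ := exists_nat_one_div_lt hε
      let j : J := some (⟨U, hUB⟩, q, m)
      have hjx : a ≤ b j x := by
        have h0 : thickenedIndicator (Nat.one_div_pos_of_nat (α := ℝ) (n := m)) Uᶜ x = 0 := by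
          apply thickenedIndicator_zero
          rw [Metric.mem_thickening_iff_infEDist_lt, not_lt]
          exact (ENNReal.ofReal_le_ofReal hm.le).trans hεx.le
        have : b j x = min 1 (TopologicalSpace.denseSeq ℝ≥0 q) := by
          change min 1 (TopologicalSpace.denseSeq ℝ≥0 q) * (1 - thickenedIndicator _ Uᶜ x) = _
          rw [h0]; simp
        rw [this, min_eq_right (hq.2.le.trans (hf x))]
        exact hq.1.le
      have hj : ∀ z, b j z ≤ f z := by
        intro z
        change min 1 (TopologicalSpace.denseSeq ℝ≥0 q) * (1 - thickenedIndicator _ Uᶜ z) ≤ _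
        by_cases hz : z ∈ U
        · refine (mul_le_of_le_one_right' tsub_le_self).trans ((min_le_right _ _).trans ?_)
          exact (hU hz).le
        · rw [thickenedIndicator_one _ _ (by simpa using hz)]; simp
      refine hca.trans_le (le_trans ?_ (le_iSup _ (⟨{j}, by simpa using hj⟩ :
        {s : Finset J | ∀ j ∈ s, ∀ x, b j x ≤ f x})))
      simpa [g] using hjx
    · refine iSup_le fun s => ENNReal.coe_le_coe.2 (Finset.sup_le fun j hj => s.2 j hj x)

end Approximation

/-! ### The spaces `M_{w_k}(E)` -/

section TestClass

variable {E : Type*} [TopologicalSpace E]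

/-- The finite sums of products of a nonnegative bounded continuous function and a weight. -/
def testClass (w : ℕ → E →ᵇ ℝ) : AddSubmonoid (E → ℝ) :=
  AddSubmonoid.closure {F | ∃ (f : E →ᵇ ℝ) (j : ℕ), (∀ x, 0 ≤ f x) ∧ F = fun x => f x * w j x}

variable {w : ℕ → E →ᵇ ℝ}

lemma mul_mem_testClass {f : E →ᵇ ℝ} (hf : ∀ x, 0 ≤ f x) (j : ℕ) :
    (fun x => f x * w j x) ∈ testClass w :=
  AddSubmonoid.subset_closure ⟨f, j, hf, rfl⟩

lemma weight_mem_testClass (j : ℕ) : (fun x => w j x) ∈ testClass w := by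
  simpa using mul_mem_testClass (w := w) (f := 1) (fun _ => zero_le_one) j

lemma continuous_of_mem_testClass {F : E → ℝ} (hF : F ∈ testClass w) : Continuous F := by
  induction hF using AddSubmonoid.closure_induction with
  | mem F hF => obtain ⟨f, j, -, rfl⟩ := hF; exact f.continuous.mul (w j).continuous
  | zero => exact continuous_const
  | add F G _ _ hF hG => exact hF.add hG

lemma mul_mem_testClass_of_mem {F : E → ℝ} (hF : F ∈ testClass w) {g : E →ᵇ ℝ}
    (hg : ∀ x, 0 ≤ g x) : (fun x => g x * F x) ∈ testClass w := by
  induction hF using AddSubmonoid.closure_induction with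
  | mem F hF =>
    obtain ⟨f, j, hf, rfl⟩ := hF
    have := mul_mem_testClass (w := w) (f := g * f) (fun x => mul_nonneg (hg x) (hf x)) j
    simpa [mul_assoc] using this
  | zero =>
    have h : (fun x => g x * (0 : E → ℝ) x) = 0 := by funext x; simp
    rw [h]; exact (testClass w).zero_mem
  | add F G _ _ hF hG =>
    have := (testClass w).add_mem hF hG
    convert this using 1
    funext x; simp [mul_add]

lemma const_mul_mem_testClass {F : E → ℝ} (hF : F ∈ testClass w) {c : ℝ} (hc : 0 ≤ c) :
    (fun x => c * F x) ∈ testClass w :=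
  mul_mem_testClass_of_mem hF (g := BoundedContinuousFunction.const E c) fun _ => hc

lemma exists_bound_of_mem_testClass (w_nonneg : ∀ k x, 0 ≤ w k x) {F : E → ℝ}
    (hF : F ∈ testClass w) : ∃ C : ℝ, 0 ≤ C ∧ ∀ x, 0 ≤ F x ∧ F x ≤ C := by
  induction hF using AddSubmonoid.closure_induction with
  | mem F hF =>
    obtain ⟨f, j, hf, rfl⟩ := hF
    refine ⟨‖f‖ * ‖w j‖, by positivity, fun x => ⟨mul_nonneg (hf x) (w_nonneg j x), ?_⟩⟩
    exact mul_le_mul ((le_abs_self _).trans (f.norm_coe_le_norm x))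
      ((le_abs_self _).trans ((w j).norm_coe_le_norm x)) (w_nonneg j x) (norm_nonneg _)
  | zero => exact ⟨0, le_rfl, fun x => ⟨le_rfl, le_rfl⟩⟩
  | add F G _ _ hF hG =>
    obtain ⟨C, hC, hF⟩ := hF
    obtain ⟨D, hD, hG⟩ := hG
    exact ⟨C + D, by positivity, fun x => ⟨add_nonneg (hF x).1 (hG x).1,
      add_le_add (hF x).2 (hG x).2⟩⟩

lemma nonneg_of_mem_testClass (w_nonneg : ∀ k x, 0 ≤ w k x) {F : E → ℝ}
    (hF : F ∈ testClass w) (x : E) : 0 ≤ F x := by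
  obtain ⟨C, -, h⟩ := exists_bound_of_mem_testClass w_nonneg hF
  exact (h x).1

end TestClass

section LocationMeasures

universe u

variable {E : Type u} [TopologicalSpace E] [MeasurableSpace E] [BorelSpace E] {w : ℕ → E →ᵇ ℝ}

lemma measurable_weight (w : ℕ → E →ᵇ ℝ) (k : ℕ) : Measurable fun x => ENNReal.ofReal (w k x) :=
  (w k).continuous.measurable.ennreal_ofReal

lemma integrable_mul_weight (w_nonneg : ∀ k x, 0 ≤ w k x) (ν : LocationMeasures w) (f : E →ᵇ ℝ)
    (j : ℕ) : Integrable (fun x => f x * w j x) ν.1 := by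
  have h1 : Integrable (fun x => w j x) ν.1 := by
    refine ⟨(w j).continuous.measurable.aestronglyMeasurable, ?_⟩
    rw [hasFiniteIntegral_iff_ofReal (.of_forall (w_nonneg j))]
    exact ν.2 j
  exact h1.bdd_mul (c := ‖f‖) f.continuous.measurable.aestronglyMeasurable
    (.of_forall f.norm_coe_le_norm)

lemma continuous_integral_mul_weight (f : E →ᵇ ℝ) (j : ℕ) :
    Continuous fun ν : LocationMeasures w => ∫ x, f x * w j x ∂ν.1 :=
  continuous_iInf_dom (i := j) (continuous_iInf_dom (i := f) continuous_induced_dom)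

lemma continuous_lintegral_of_mem_testClass (w_nonneg : ∀ k x, 0 ≤ w k x) {F : E → ℝ}
    (hF : F ∈ testClass w) :
    Continuous fun ν : LocationMeasures w => ∫⁻ x, ENNReal.ofReal (F x) ∂ν.1 := by
  induction hF using AddSubmonoid.closure_induction with
  | mem F hF =>
    obtain ⟨f, j, hf, rfl⟩ := hF
    have h : (fun ν : LocationMeasures w => ∫⁻ x, ENNReal.ofReal (f x * w j x) ∂ν.1)
        = fun ν => ENNReal.ofReal (∫ x, f x * w j x ∂ν.1) := by
      funext ν
      rw [ofReal_integral_eq_lintegral_ofReal (integrable_mul_weight w_nonneg ν f j)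
        (.of_forall fun x => mul_nonneg (hf x) (w_nonneg j x))]
    rw [h]
    exact ENNReal.continuous_ofReal.comp (continuous_integral_mul_weight f j)
  | zero => simpa using continuous_const
  | add F G hF' hG' hF hG =>
    have h : (fun ν : LocationMeasures w => ∫⁻ x, ENNReal.ofReal ((F + G) x) ∂ν.1)
        = fun ν => ∫⁻ x, ENNReal.ofReal (F x) ∂ν.1 + ∫⁻ x, ENNReal.ofReal (G x) ∂ν.1 := by
      funext ν
      rw [← lintegral_add_left (continuous_of_mem_testClass hF').measurable.ennreal_ofReal]
      refine lintegral_congr fun x => ?_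
      exact ENNReal.ofReal_add (nonneg_of_mem_testClass w_nonneg hF' x)
        (nonneg_of_mem_testClass w_nonneg hG' x)
    rw [h]
    exact hF.add hG

section Inducing

lemma lowerSemicontinuous_toReal {M : Type*} [TopologicalSpace M] {u : M → ℝ≥0∞}
    (hu : LowerSemicontinuous u) (hfin : ∀ x, u x ≠ ∞) :
    LowerSemicontinuous fun x => (u x).toReal := by
  intro x a ha
  rcases lt_or_ge a 0 with h0 | h0
  · exact .of_forall fun z => h0.trans_le ENNReal.toReal_nonneg
  · filter_upwards [hu x _ ((ENNReal.ofReal_lt_iff_lt_toReal h0 (hfin x)).2 ha)] with z hz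
    exact (ENNReal.ofReal_lt_iff_lt_toReal h0 (hfin z)).1 hz

lemma continuous_toReal_of_lowerSemicontinuous {M : Type*} [TopologicalSpace M]
    {u v c : M → ℝ≥0∞} (hu : LowerSemicontinuous u) (hv : LowerSemicontinuous v)
    (hc : Continuous c) (hfin : ∀ x, c x ≠ ∞) (h : ∀ x, u x + v x = c x) :
    Continuous fun x => (u x).toReal := by
  have hu' : ∀ x, u x ≠ ∞ := fun x => ne_top_of_le_ne_top (hfin x) (h x ▸ le_self_add)
  have hv' : ∀ x, v x ≠ ∞ := fun x => ne_top_of_le_ne_top (hfin x) (h x ▸ le_add_self)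
  have hc' : Continuous fun x => (c x).toReal :=
    continuous_iff_continuousAt.2 fun x =>
      (ENNReal.continuousAt_toReal (hfin x)).comp hc.continuousAt
  rw [continuous_iff_lower_upperSemicontinuous]
  refine ⟨lowerSemicontinuous_toReal hu hu', ?_⟩
  have hsub : (fun x => (u x).toReal) = fun x => (c x).toReal + -(v x).toReal := by
    funext x
    rw [← h x, ENNReal.toReal_add (hu' x) (hv' x)]; ring
  rw [hsub]
  refine hc'.upperSemicontinuous.add ?_
  intro x a ha
  filter_upwards [lowerSemicontinuous_toReal hv hv' x (-a) (by linarith)] with z hz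
  linarith

variable [SecondCountableTopology E] [TopologicalSpace.MetrizableSpace E]

/-- The topology of `M_{w_k}(E)` is induced by countably many functionals `ν ↦ ∫ F dν` with `F`
in the test class. -/
lemma LocationMeasures.exists_isInducing (w_nonneg : ∀ k x, 0 ≤ w k x) :
    ∃ (ι : Type u) (_ : Countable ι) (F : ι → E → ℝ), (∀ i, F i ∈ testClass w) ∧
      IsInducing fun (ν : LocationMeasures w) (i : ι) => ∫⁻ x, ENNReal.ofReal (F i x) ∂ν.1 := by
  obtain ⟨ι, hι, g, hg1, ⟨i₁, hi₁⟩, hg⟩ := exists_countable_approx_from_below E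
  have hgb : ∀ i, ∃ f : E →ᵇ ℝ, ∀ x, f x = g i x := fun i =>
    ⟨.ofNormedAddCommGroup (fun x => (g i x : ℝ)) (by fun_prop) 1 fun x => by
      simpa using! hg1 i x, fun x => rfl⟩
  choose b hb using hgb
  let F : ι × ℕ → E → ℝ := fun p x => b p.1 x * w p.2 x
  have hF : ∀ i, F i ∈ testClass w := fun p =>
    mul_mem_testClass (fun x => by rw [hb]; exact NNReal.coe_nonneg _) p.2
  refine ⟨ι × ℕ, inferInstance, F, hF, ⟨?_⟩⟩
  set y := fun (ν : LocationMeasures w) (i : ι × ℕ) => ∫⁻ x, ENNReal.ofReal (F i x) ∂ν.1 with hy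
  apply le_antisymm
  · rw [← continuous_iff_le_induced]
    exact continuous_pi fun p => continuous_lintegral_of_mem_testClass w_nonneg (hF p)
  · refine le_iInf fun j => le_iInf fun f => ?_
    rw [← continuous_iff_le_induced]
    let : TopologicalSpace (LocationMeasures w) := TopologicalSpace.induced y inferInstance
    have hycont : ∀ p, Continuous fun ν : LocationMeasures w =>
        ∫⁻ x, ENNReal.ofReal (F p x) ∂ν.1 := fun p =>
      (continuous_apply p).comp (continuous_induced_dom (f := y))
    have hFg : ∀ i x, ENNReal.ofReal (F (i, j) x) = g i x * ENNReal.ofReal (w j x) := by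
      intro i x
      simp only [F, hb]
      rw [ENNReal.ofReal_mul (NNReal.coe_nonneg _), ENNReal.ofReal_coe_nnreal]
    have hlsc : ∀ φ : C(E, ℝ≥0), (∀ x, φ x ≤ 1) → LowerSemicontinuous
        fun ν : LocationMeasures w => ∫⁻ x, φ x * ENNReal.ofReal (w j x) ∂ν.1 := by
      intro φ hφ
      obtain ⟨s, hdir, hs⟩ := hg φ hφ
      have h1 : (fun ν : LocationMeasures w => ∫⁻ x, φ x * ENNReal.ofReal (w j x) ∂ν.1)
          = fun ν => ⨆ i : s, ∫⁻ x, ENNReal.ofReal (F (i, j) x) ∂ν.1 := by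
        funext ν
        rw [← lintegral_iSup_directed]
        · refine lintegral_congr fun x => ?_
          rw [hs x, ENNReal.iSup_mul]
          exact iSup_congr fun i => (hFg i x).symm
        · exact fun i => (continuous_of_mem_testClass (hF _)).measurable.ennreal_ofReal.aemeasurable
        · intro i k
          obtain ⟨l, hil, hkl⟩ := hdir i k
          refine ⟨l, fun x => ?_, fun x => ?_⟩
          · change ENNReal.ofReal (F _ x) ≤ ENNReal.ofReal (F _ x)
            rw [hFg, hFg]; exact mul_le_mul_left (hil x) _
          · change ENNReal.ofReal (F _ x) ≤ ENNReal.ofReal (F _ x)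
            rw [hFg, hFg]; exact mul_le_mul_left (hkl x) _
      rw [h1]
      exact lowerSemicontinuous_iSup fun i => (hycont _).lowerSemicontinuous
    have hone : Continuous fun ν : LocationMeasures w => ∫⁻ x, ENNReal.ofReal (w j x) ∂ν.1 := by
      have := hycont (i₁, j)
      simpa only [hFg, hi₁, ContinuousMap.one_apply, ENNReal.coe_one, one_mul] using this
    have hfin : ∀ ν : LocationMeasures w, ∫⁻ x, ENNReal.ofReal (w j x) ∂ν.1 ≠ ∞ :=
      fun ν => (ν.2 j).ne
    set C := ‖f‖ + 1 with hC
    have hCpos : 0 < C := by positivity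
    have hfC : ∀ x, -C ≤ f x ∧ f x ≤ C := fun x =>
      abs_le.1 ((f.norm_coe_le_norm x).trans (by linarith))
    let φ : C(E, ℝ≥0) := ⟨fun x => ((f x + C) / (2 * C)).toNNReal,
      by fun_prop⟩
    have hφr : ∀ x, (φ x : ℝ) = (f x + C) / (2 * C) := fun x =>
      Real.coe_toNNReal _ (div_nonneg (by linarith [(hfC x).1]) (by positivity))
    have hφ1 : ∀ x, φ x ≤ 1 := fun x => by
      rw [← NNReal.coe_le_coe, hφr, NNReal.coe_one, div_le_one (by positivity)]
      linarith [(hfC x).2]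
    let ψ : C(E, ℝ≥0) := ⟨fun x => 1 - φ x, by fun_prop⟩
    have hcont : Continuous fun ν : LocationMeasures w =>
        (∫⁻ x, φ x * ENNReal.ofReal (w j x) ∂ν.1).toReal := by
      refine continuous_toReal_of_lowerSemicontinuous (hlsc φ hφ1)
        (hlsc ψ fun x => tsub_le_self) hone hfin fun ν => ?_
      rw [← lintegral_add_left (by fun_prop)]
      refine lintegral_congr fun x => ?_
      rw [← add_mul, ← ENNReal.coe_add]
      change ((φ x + (1 - φ x) : ℝ≥0) : ℝ≥0∞) * _ = _
      rw [add_tsub_cancel_of_le (hφ1 x), ENNReal.coe_one, one_mul]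
    have hone' : Continuous fun ν : LocationMeasures w =>
        (∫⁻ x, ENNReal.ofReal (w j x) ∂ν.1).toReal :=
      continuous_iff_continuousAt.2 fun ν =>
        ContinuousAt.comp (g := ENNReal.toReal) (ENNReal.continuousAt_toReal (hfin ν))
          hone.continuousAt
    have key : (fun ν : LocationMeasures w => ∫ x, f x * w j x ∂ν.1) = fun ν =>
        2 * C * (∫⁻ x, φ x * ENNReal.ofReal (w j x) ∂ν.1).toReal
          - C * (∫⁻ x, ENNReal.ofReal (w j x) ∂ν.1).toReal := by
      funext ν
      have hw : ∫ x, w j x ∂ν.1 = (∫⁻ x, ENNReal.ofReal (w j x) ∂ν.1).toReal :=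
        integral_eq_lintegral_of_nonneg_ae (.of_forall (w_nonneg j))
          (w j).continuous.measurable.aestronglyMeasurable
      have hwi : Integrable (fun x => w j x) ν.1 := by
        simpa using integrable_mul_weight w_nonneg ν 1 j
      have hφw : ∫ x, (φ x : ℝ) * w j x ∂ν.1
          = (∫⁻ x, φ x * ENNReal.ofReal (w j x) ∂ν.1).toReal := by
        rw [integral_eq_lintegral_of_nonneg_ae
          (.of_forall fun x => mul_nonneg (NNReal.coe_nonneg _) (w_nonneg j x))
          (by fun_prop)]
        congr 1
        refine lintegral_congr fun x => ?_
        rw [ENNReal.ofReal_mul (NNReal.coe_nonneg _), ENNReal.ofReal_coe_nnreal]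
      rw [← hw, ← hφw, ← integral_const_mul, ← integral_const_mul, ← integral_sub]
      · refine integral_congr_ae (.of_forall fun x => ?_)
        simp only [hφr]
        field_simp
        ring
      · refine Integrable.const_mul ?_ _
        exact hwi.bdd_mul (c := 1) (by fun_prop) (.of_forall fun x => by
          simpa using! hφ1 x)
      · exact hwi.const_mul _
    rw [key]
    exact (hcont.const_mul _).sub (hone'.const_mul _)

end Inducing
end LocationMeasures

/-! ### Laplace functionals and convergence in distribution of random measures -/

section TestInducing

universe u

variable {E : Type u} [TopologicalSpace E] [MeasurableSpace E] [BorelSpace E] {w : ℕ → E →ᵇ ℝ}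

/-- The topology of a space `M` of measures on `E` is induced by countably many functionals
`μ ↦ ∫ F dμ` with `F` in the test class. -/
def IsTestInduced (w : ℕ → E →ᵇ ℝ) {M : Type*} [TopologicalSpace M] (toMeas : M → Measure E) :
    Prop :=
  ∃ (ι : Type u) (_ : Countable ι) (F : ι → E → ℝ), (∀ i, F i ∈ testClass w) ∧
    IsInducing fun (μ : M) (i : ι) => ∫⁻ x, ENNReal.ofReal (F i x) ∂(toMeas μ)

lemma list_sum_lintegral_eq (w_nonneg : ∀ k x, 0 ≤ w k x) {ι : Type*} {F : ι → E → ℝ}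
    (hF : ∀ i, F i ∈ testClass w) (ν : Measure E) (l : List ι) :
    (l.map fun i => ∫⁻ x, ENNReal.ofReal (F i x) ∂ν).sum
      = ∫⁻ x, ENNReal.ofReal ((l.map F).sum x) ∂ν := by
  induction l with
  | nil => simp
  | cons i l ih =>
    have hl : (l.map F).sum ∈ testClass w :=
      AddSubmonoid.list_sum_mem _ fun G hG => by
        obtain ⟨j, -, rfl⟩ := List.mem_map.1 hG; exact hF j
    rw [List.map_cons, List.sum_cons, ih, List.map_cons, List.sum_cons,
      ← lintegral_add_left (continuous_of_mem_testClass (hF i)).measurable.ennreal_ofReal]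
    refine lintegral_congr fun x => ?_
    exact (ENNReal.ofReal_add (nonneg_of_mem_testClass w_nonneg (hF i) x)
      (nonneg_of_mem_testClass w_nonneg hl x)).symm

variable {M : Type*} [TopologicalSpace M] [MeasurableSpace M] [BorelSpace M]
  {toMeas : M → Measure E}

lemma IsTestInduced.measurable (hM : IsTestInduced w toMeas) {Ω : Type*} [MeasurableSpace Ω]
    {X : Ω → M} (hX : Measurable fun ω => toMeas (X ω)) : Measurable X := by
  obtain ⟨ι, hι, F, hF, hy⟩ := hM
  refine (measurable_iff_of_isInducing hy).2 fun i => ?_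
  exact (Measure.measurable_lintegral
    (continuous_of_mem_testClass (hF i)).measurable.ennreal_ofReal).comp hX

lemma list_sum_mem_testClass {ι : Type*} {F : ι → E → ℝ} (hF : ∀ i, F i ∈ testClass w)
    (l : List ι) : (l.map F).sum ∈ testClass w :=
  AddSubmonoid.list_sum_mem _ fun G hG => by
    obtain ⟨j, -, rfl⟩ := List.mem_map.1 hG; exact hF j

lemma IsTestInduced.tendsto (hM : IsTestInduced w toMeas) (w_nonneg : ∀ k x, 0 ≤ w k x)
    {α : Type*} {L : Filter α} [L.IsCountablyGenerated] {P : α → ProbabilityMeasure M}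
    {P₀ : ProbabilityMeasure M}
    (h : ∀ F ∈ testClass w, Tendsto
      (fun a => ∫ μ, expNeg (∫⁻ x, ENNReal.ofReal (F x) ∂(toMeas μ)) ∂(P a : Measure M)) L
      (𝓝 (∫ μ, expNeg (∫⁻ x, ENNReal.ofReal (F x) ∂(toMeas μ)) ∂(P₀ : Measure M)))) :
    Tendsto P L (𝓝 P₀) := by
  obtain ⟨ι, hι, F, hF, hy⟩ := hM
  refine tendsto_of_isInducing hy fun l => ?_
  simp only [list_sum_lintegral_eq w_nonneg hF]
  exact h _ (list_sum_mem_testClass hF l)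

lemma IsTestInduced.measure_ext (hM : IsTestInduced w toMeas) (w_nonneg : ∀ k x, 0 ≤ w k x)
    {P Q : Measure M} [IsProbabilityMeasure P] [IsProbabilityMeasure Q]
    (h : ∀ F ∈ testClass w, ∫ μ, expNeg (∫⁻ x, ENNReal.ofReal (F x) ∂(toMeas μ)) ∂P
      = ∫ μ, expNeg (∫⁻ x, ENNReal.ofReal (F x) ∂(toMeas μ)) ∂Q) : P = Q := by
  obtain ⟨ι, hι, F, hF, hy⟩ := hM
  refine measure_ext_of_isInducing hy fun l => ?_
  simp only [list_sum_lintegral_eq w_nonneg hF]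
  exact h _ (list_sum_mem_testClass hF l)

lemma IsTestInduced.measurable_kernel (hM : IsTestInduced w toMeas)
    (w_nonneg : ∀ k x, 0 ≤ w k x) {α : Type*} [MeasurableSpace α] {P : α → Measure M}
    [∀ a, IsProbabilityMeasure (P a)]
    (h : ∀ F ∈ testClass w,
      Measurable fun a => ∫ μ, expNeg (∫⁻ x, ENNReal.ofReal (F x) ∂(toMeas μ)) ∂(P a)) :
    Measurable P := by
  obtain ⟨ι, hι, F, hF, hy⟩ := hM
  refine measurable_kernel_of_isInducing hy fun l => ?_
  simp only [list_sum_lintegral_eq w_nonneg hF]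
  exact h _ (list_sum_mem_testClass hF l)

lemma LocationMeasures.isTestInduced [SecondCountableTopology E]
    [TopologicalSpace.MetrizableSpace E] (w_nonneg : ∀ k x, 0 ≤ w k x) :
    IsTestInduced w fun ν : LocationMeasures w => ν.1 :=
  LocationMeasures.exists_isInducing w_nonneg

end TestInducing

/-! ### Recovering a measure from its weighted versions -/

section Glue

variable {E : Type*} [TopologicalSpace E] [MeasurableSpace E] [BorelSpace E] {w : ℕ → E →ᵇ ℝ}

/-- A measurable partition subordinate to the sets `{w_k > 0}`. -/
def weightPartition (w : ℕ → E →ᵇ ℝ) (k : ℕ) : Set E := disjointed (fun k => {x | 0 < w k x}) k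

lemma measurableSet_weightPartition (w : ℕ → E →ᵇ ℝ) (k : ℕ) :
    MeasurableSet (weightPartition w k) :=
  MeasurableSet.disjointed
    (fun k => measurableSet_lt measurable_const (w k).continuous.measurable) k

lemma iUnion_weightPartition (w_cover : ∀ x, ∃ k, 0 < w k x) :
    ⋃ k, weightPartition w k = Set.univ := by
  unfold weightPartition
  rw [iUnion_disjointed]
  exact Set.eq_univ_of_forall fun x => Set.mem_iUnion.2 (w_cover x)

lemma sum_restrict_weightPartition (w_cover : ∀ x, ∃ k, 0 < w k x) (ν : Measure E) :
    Measure.sum (fun k => ν.restrict (weightPartition w k)) = ν := by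
  have hd : Pairwise (Function.onFun Disjoint (weightPartition w)) := disjoint_disjointed _
  rw [← Measure.restrict_iUnion hd (measurableSet_weightPartition w),
    iUnion_weightPartition w_cover, Measure.restrict_univ]

/-- The density `1 / w_k` on the `k`-th set of the partition. -/
noncomputable def invWeight (w : ℕ → E →ᵇ ℝ) (k : ℕ) : E → ℝ≥0∞ :=
  (weightPartition w k).indicator fun x => (ENNReal.ofReal (w k x))⁻¹

lemma measurable_invWeight (w : ℕ → E →ᵇ ℝ) (k : ℕ) : Measurable (invWeight w k) :=
  (measurable_weight w k).inv.indicator (measurableSet_weightPartition w k)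

lemma withDensity_mul_invWeight (ν : Measure E) (k : ℕ) :
    (ν.withDensity fun x => ENNReal.ofReal (w k x)).withDensity (invWeight w k)
      = ν.restrict (weightPartition w k) := by
  rw [← withDensity_mul ν (measurable_weight w k) (measurable_invWeight w k),
    ← withDensity_indicator_one (measurableSet_weightPartition w k)]
  congr 1
  funext x
  by_cases hx : x ∈ weightPartition w k
  · have h0 : 0 < w k x := disjointed_subset _ k hx
    simp only [Pi.mul_apply, invWeight, Set.indicator_of_mem hx, Pi.one_apply]
    exact ENNReal.mul_inv_cancel (by simpa using h0) ENNReal.ofReal_ne_top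
  · simp [invWeight, Set.indicator_of_notMem hx]

/-- The measure with prescribed weighted versions `μ k`. -/
noncomputable def glueMeasure (w : ℕ → E →ᵇ ℝ) (μ : ℕ → Measure E) : Measure E :=
  Measure.sum fun k => (μ k).withDensity (invWeight w k)

lemma glueMeasure_withDensity (w_cover : ∀ x, ∃ k, 0 < w k x) (ν : Measure E) :
    glueMeasure w (fun k => ν.withDensity fun x => ENNReal.ofReal (w k x)) = ν := by
  unfold glueMeasure
  simp only [withDensity_mul_invWeight]
  exact sum_restrict_weightPartition w_cover ν

lemma withDensity_glueMeasure (w_cover : ∀ x, ∃ k, 0 < w k x) {μ : ℕ → Measure E}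
    (hμ : ∀ j k, (μ k).withDensity (fun x => ENNReal.ofReal (w j x))
      = (μ j).withDensity (fun x => ENNReal.ofReal (w k x))) (j : ℕ) :
    (glueMeasure w μ).withDensity (fun x => ENNReal.ofReal (w j x)) = μ j := by
  unfold glueMeasure
  rw [withDensity_sum]
  have h : ∀ k, ((μ k).withDensity (invWeight w k)).withDensity
      (fun x => ENNReal.ofReal (w j x)) = (μ j).restrict (weightPartition w k) := by
    intro k
    rw [← withDensity_mul_invWeight, ← hμ j k,
      ← withDensity_mul _ (measurable_weight w j) (measurable_invWeight w k),
      ← withDensity_mul _ (measurable_invWeight w k) (measurable_weight w j), mul_comm]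
  simp only [h]
  exact sum_restrict_weightPartition w_cover (μ j)

lemma measurable_withDensity {Ω : Type*} [MeasurableSpace Ω] {X : Ω → Measure E}
    (hX : Measurable X) {f : E → ℝ≥0∞} (hf : Measurable f) :
    Measurable fun ω => (X ω).withDensity f := by
  refine Measure.measurable_of_measurable_coe _ fun A hA => ?_
  have h : (fun ω => (X ω).withDensity f A) = fun ω => ∫⁻ x, A.indicator f x ∂(X ω) := by
    funext ω; rw [withDensity_apply _ hA, lintegral_indicator hA]
  rw [h]
  exact (Measure.measurable_lintegral (hf.indicator hA)).comp hX

lemma measurable_glueMeasure {Ω : Type*} [MeasurableSpace Ω] {X : ℕ → Ω → Measure E}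
    (hX : ∀ k, Measurable (X k)) : Measurable fun ω => glueMeasure w fun k => X k ω := by
  refine Measure.measurable_of_measurable_coe _ fun A hA => ?_
  simp only [glueMeasure, Measure.sum_apply _ hA]
  exact Measurable.tsum fun k =>
    (Measure.measurable_coe hA).comp (measurable_withDensity (hX k) (measurable_invWeight w k))

instance LocationMeasures.isFiniteMeasure_withDensity (ν : LocationMeasures w) (k : ℕ) :
    IsFiniteMeasure (ν.1.withDensity fun x => ENNReal.ofReal (w k x)) :=
  _root_.MeasureTheory.isFiniteMeasure_withDensity (ν.2 k).ne

lemma LocationMeasures.sigmaFinite (w_cover : ∀ x, ∃ k, 0 < w k x) (ν : LocationMeasures w) :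
    SigmaFinite ν.1 := by
  refine ⟨⟨⟨fun n => {x | ENNReal.ofReal (1 / ((n.unpair.2 : ℝ) + 1))
    ≤ ENNReal.ofReal (w n.unpair.1 x)}, fun _ => trivial, fun n => ?_, ?_⟩⟩⟩
  · refine (meas_ge_le_lintegral_div (measurable_weight w _).aemeasurable ?_
      ENNReal.ofReal_ne_top).trans_lt (ENNReal.div_lt_top (ν.2 _).ne ?_)
    all_goals simpa using Nat.cast_add_one_pos _
  · refine Set.eq_univ_of_forall fun x => ?_
    obtain ⟨k, hk⟩ := w_cover x
    obtain ⟨m, hm⟩ := exists_nat_one_div_lt hk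
    exact Set.mem_iUnion.2 ⟨Nat.pair k m, by simpa using ENNReal.ofReal_le_ofReal hm.le⟩

variable [SecondCountableTopology E] [TopologicalSpace.MetrizableSpace E]

lemma LocationMeasures.measurable_withDensity_weight (w_nonneg : ∀ k x, 0 ≤ w k x) (k : ℕ) :
    Measurable fun ν : LocationMeasures w => ν.1.withDensity fun x => ENNReal.ofReal (w k x) := by
  refine Measurable.measure_of_isPiSystem
    (borel_eq_generateFrom_isClosed (α := E) ▸ BorelSpace.measurable_eq)
    isPiSystem_isClosed (fun F hF => ?_) ?_
  · have hlim := fun ν : LocationMeasures w => HasOuterApproxClosed.tendsto_lintegral_apprSeq hF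
      (ν.1.withDensity fun x => ENNReal.ofReal (w k x))
    refine measurable_of_tendsto_metrizable (f := fun n (ν : LocationMeasures w) =>
      ∫⁻ x, hF.apprSeq n x ∂(ν.1.withDensity fun x => ENNReal.ofReal (w k x)))
      (fun n => ?_) (tendsto_pi_nhds.2 hlim)
    let g : E →ᵇ ℝ := .ofNormedAddCommGroup (fun x => (hF.apprSeq n x : ℝ)) (by fun_prop) 1
      fun x => by simpa using HasOuterApproxClosed.apprSeq_apply_le_one hF n x
    have hg : ∀ x, g x = (hF.apprSeq n x : ℝ) := fun x => rfl
    have h : (fun ν : LocationMeasures w => ∫⁻ x, hF.apprSeq n x ∂(ν.1.withDensity fun x =>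
        ENNReal.ofReal (w k x))) = fun ν => ∫⁻ x, ENNReal.ofReal (g x * w k x) ∂ν.1 := by
      funext ν
      rw [lintegral_withDensity_eq_lintegral_mul _ (measurable_weight w k) (by fun_prop)]
      refine lintegral_congr fun x => ?_
      rw [hg, ENNReal.ofReal_mul (NNReal.coe_nonneg _), ENNReal.ofReal_coe_nnreal, mul_comm]
      rfl
    rw [h]
    exact (continuous_lintegral_of_mem_testClass w_nonneg
      (mul_mem_testClass (fun x => NNReal.coe_nonneg _) k)).measurable
  · simp only [withDensity_apply _ MeasurableSet.univ, Measure.restrict_univ]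
    exact (continuous_lintegral_of_mem_testClass w_nonneg (weight_mem_testClass k)).measurable

lemma LocationMeasures.measurable_val (w_nonneg : ∀ k x, 0 ≤ w k x)
    (w_cover : ∀ x, ∃ k, 0 < w k x) : Measurable fun ν : LocationMeasures w => ν.1 := by
  have h := measurable_glueMeasure (w := w)
    (fun k => LocationMeasures.measurable_withDensity_weight w_nonneg k)
  simpa only [glueMeasure_withDensity w_cover] using h

end Glue

/-! ### Measures on `S × [0, ∞)` -/

section LevelMeasures

universe u

variable {S : Type u} [TopologicalSpace S]

/-- A continuous function equal to `1` on `[0, K]` and to `0` on `[K + 1, ∞)`. -/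
noncomputable def levelCutoff (K : ℕ) (u : ℝ≥0) : ℝ≥0 := min 1 ((K : ℝ≥0) + 1 - u)

lemma continuous_levelCutoff (K : ℕ) : Continuous (levelCutoff K) := by
  unfold levelCutoff; fun_prop

lemma levelCutoff_le_one (K : ℕ) (u : ℝ≥0) : levelCutoff K u ≤ 1 := min_le_left _ _

lemma levelCutoff_of_le {K : ℕ} {u : ℝ≥0} (hu : u ≤ K) : levelCutoff K u = 1 := by
  refine min_eq_left (le_tsub_of_add_le_left ?_)
  gcongr

lemma levelCutoff_of_lt {K : ℕ} {u : ℝ≥0} (hu : (K : ℝ≥0) + 1 < u) : levelCutoff K u = 0 := by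
  unfold levelCutoff
  rw [tsub_eq_zero_of_le hu.le]; simp

/-- The weights `h_k(x) χ_K(u)` on `S × [0, ∞)`, enumerated by the pairs `(k, K)`. -/
noncomputable def levelWeights (h : ℕ → S →ᵇ ℝ) (j : ℕ) : (S × ℝ≥0) →ᵇ ℝ :=
  .ofNormedAddCommGroup (fun z => h j.unpair.1 z.1 * levelCutoff j.unpair.2 z.2)
    (((h _).continuous.comp continuous_fst).mul
      (NNReal.continuous_coe.comp ((continuous_levelCutoff _).comp continuous_snd)))
    ‖h j.unpair.1‖ fun z => by
      rw [norm_mul]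
      refine (mul_le_of_le_one_right (norm_nonneg _) ?_).trans ((h _).norm_coe_le_norm _)
      simpa using levelCutoff_le_one _ _

lemma levelWeights_apply (h : ℕ → S →ᵇ ℝ) (j : ℕ) (z : S × ℝ≥0) :
    levelWeights h j z = h j.unpair.1 z.1 * levelCutoff j.unpair.2 z.2 := rfl

variable {h : ℕ → S →ᵇ ℝ}

lemma levelWeights_nonneg (h_nonneg : ∀ k x, 0 ≤ h k x) (j : ℕ) (z : S × ℝ≥0) :
    0 ≤ levelWeights h j z :=
  mul_nonneg (h_nonneg _ _) (NNReal.coe_nonneg _)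

lemma levelWeights_pair {k K : ℕ} {z : S × ℝ≥0} (hz : z.2 ≤ K) :
    levelWeights h (Nat.pair k K) z = h k z.1 := by
  simp [levelWeights_apply, levelCutoff_of_le hz]

lemma levelWeights_cover (h_cover : ∀ x, ∃ k, 0 < h k x) (z : S × ℝ≥0) :
    ∃ j, 0 < levelWeights h j z := by
  obtain ⟨k, hk⟩ := h_cover z.1
  obtain ⟨K, hK⟩ := exists_nat_ge z.2
  exact ⟨Nat.pair k K, by rwa [levelWeights_pair hK]⟩

variable [MeasurableSpace S] [BorelSpace S] [SecondCountableTopology S]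

lemma LevelMeasures.lintegral_levelWeights_lt_top (h_nonneg : ∀ k x, 0 ≤ h k x)
    (μ : LevelMeasures h) (j : ℕ) :
    ∫⁻ z, ENNReal.ofReal (levelWeights h j z) ∂μ.1 < ∞ := by
  refine lt_of_le_of_lt ?_ (μ.2 j.unpair.1 (j.unpair.2 + 1))
  rw [← lintegral_indicator (measurableSet_le measurable_snd measurable_const)]
  refine lintegral_mono fun z => ?_
  by_cases hz : z.2 ≤ (j.unpair.2 : ℝ≥0) + 1
  · rw [Set.indicator_of_mem (by exact hz), levelWeights_apply]
    refine ENNReal.ofReal_le_ofReal (mul_le_of_le_one_right (h_nonneg _ _) ?_)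
    exact_mod_cast levelCutoff_le_one _ _
  · rw [levelWeights_apply, levelCutoff_of_lt (not_le.1 hz)]; simp

/-- A measure in `M_{h_k}(S × [0, ∞))` as an element of `M_w(S × [0, ∞))` for the weights
`w = levelWeights h`. -/
def LevelMeasures.toWeighted (h_nonneg : ∀ k x, 0 ≤ h k x) (μ : LevelMeasures h) :
    LocationMeasures (levelWeights h) :=
  ⟨μ.1, μ.lintegral_levelWeights_lt_top h_nonneg⟩

lemma LevelMeasures.isInducing_toWeighted (h_nonneg : ∀ k x, 0 ≤ h k x) :
    IsInducing (LevelMeasures.toWeighted h_nonneg) := by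
  constructor
  apply le_antisymm
  · rw [← continuous_iff_le_induced]
    refine continuous_iInf_rng.2 fun j => continuous_iInf_rng.2 fun f => continuous_induced_rng.2 ?_
    let g : (S × ℝ≥0) →ᵇ ℝ := f * .ofNormedAddCommGroup
      (fun z : S × ℝ≥0 => (levelCutoff j.unpair.2 z.2 : ℝ))
      (NNReal.continuous_coe.comp ((continuous_levelCutoff _).comp continuous_snd)) 1
      fun z => by simpa using levelCutoff_le_one _ _
    have hg : ∀ z, g z = f z * levelCutoff j.unpair.2 z.2 := fun z => rfl
    have hfun : (fun ν : LocationMeasures (levelWeights h) => ∫ x, f x * levelWeights h j x ∂ν.1)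
        ∘ LevelMeasures.toWeighted h_nonneg
        = fun μ : LevelMeasures h => ∫ z, g z * h j.unpair.1 z.1 ∂μ.1 := by
      funext μ
      refine integral_congr_ae (.of_forall fun z => ?_)
      simp only [hg, levelWeights_apply]; ring
    rw [hfun]
    exact continuous_iInf_dom (i := j.unpair.1) (continuous_iInf_dom
      (i := ⟨g, (j.unpair.2 : ℝ≥0) + 1, fun x u hu => by
        rw [hg, levelCutoff_of_lt hu]; simp⟩) continuous_induced_dom)
  · refine le_iInf fun k => le_iInf fun ⟨f, K, hK⟩ => ?_
    obtain ⟨N, hN⟩ := exists_nat_ge K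
    have hfun : (fun μ : LevelMeasures h => ∫ z, f z * h k z.1 ∂μ.1)
        = (fun ν : LocationMeasures (levelWeights h) =>
            ∫ x, f x * levelWeights h (Nat.pair k N) x ∂ν.1)
          ∘ LevelMeasures.toWeighted h_nonneg := by
      funext μ
      refine integral_congr_ae (.of_forall fun z => ?_)
      change f z * h k z.1 = f z * levelWeights h (Nat.pair k N) z
      by_cases hz : z.2 ≤ K
      · rw [levelWeights_pair (hz.trans hN)]
      · rw [show f z = 0 from hK z.1 z.2 (not_le.1 hz), zero_mul, zero_mul]
    change _ ≤ TopologicalSpace.induced (fun μ : LevelMeasures h => ∫ z, f z * h k z.1 ∂μ.1) _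
    rw [hfun, ← induced_compose]
    apply induced_mono
    rw [← continuous_iff_le_induced]
    exact continuous_integral_mul_weight f (Nat.pair k N)

variable [TopologicalSpace.MetrizableSpace S]

lemma LevelMeasures.isTestInduced (h_nonneg : ∀ k x, 0 ≤ h k x) :
    IsTestInduced (levelWeights h) fun μ : LevelMeasures h => μ.1 := by
  obtain ⟨ι, hι, F, hF, hy⟩ := LocationMeasures.exists_isInducing (levelWeights_nonneg h_nonneg)
  exact ⟨ι, hι, F, hF, hy.comp (LevelMeasures.isInducing_toWeighted h_nonneg)⟩

lemma LevelMeasures.measurable_val (h_nonneg : ∀ k x, 0 ≤ h k x)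
    (h_cover : ∀ x, ∃ k, 0 < h k x) : Measurable fun μ : LevelMeasures h => μ.1 :=
  (LocationMeasures.measurable_val (levelWeights_nonneg h_nonneg)
    (levelWeights_cover h_cover)).comp
      (LevelMeasures.isInducing_toWeighted h_nonneg).continuous.measurable

lemma LevelMeasures.continuous_lintegral (h_nonneg : ∀ k x, 0 ≤ h k x) {F : S × ℝ≥0 → ℝ}
    (hF : F ∈ testClass (levelWeights h)) :
    Continuous fun μ : LevelMeasures h => ∫⁻ z, ENNReal.ofReal (F z) ∂μ.1 :=
  (continuous_lintegral_of_mem_testClass (levelWeights_nonneg h_nonneg) hF).comp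
    (LevelMeasures.isInducing_toWeighted h_nonneg).continuous

end LevelMeasures

/-! ### Lebesgue measure on the half-line -/

section HalfLine

lemma lintegral_halfLineLebesgue {f : ℝ≥0 → ℝ≥0∞} (hf : Measurable f) :
    ∫⁻ u, f u ∂halfLineLebesgue = ∫⁻ t in Set.Ici (0 : ℝ), f t.toNNReal := by
  unfold halfLineLebesgue
  rw [lintegral_map hf measurable_real_toNNReal]

lemma halfLineLebesgue_Iic (K : ℝ≥0) : halfLineLebesgue (Set.Iic K) = K := by
  unfold halfLineLebesgue
  rw [Measure.map_apply measurable_real_toNNReal measurableSet_Iic,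
    Measure.restrict_apply (measurable_real_toNNReal measurableSet_Iic)]
  have : Real.toNNReal ⁻¹' Set.Iic K ∩ Set.Ici 0 = Set.Icc 0 (K : ℝ) := by
    ext t
    simp only [Set.mem_inter_iff, Set.mem_preimage, Set.mem_Iic, Set.mem_Ici, Set.mem_Icc,
      Real.toNNReal_le_iff_le_coe]
    tauto
  rw [this, Real.volume_Icc]; simp

instance : SigmaFinite halfLineLebesgue := by
  refine ⟨⟨⟨fun n => Set.Iic (n : ℝ≥0), fun _ => trivial, fun n => ?_, ?_⟩⟩⟩
  · rw [halfLineLebesgue_Iic]; exact ENNReal.coe_lt_top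
  · refine Set.eq_univ_of_forall fun u => ?_
    obtain ⟨n, hn⟩ := exists_nat_ge u
    exact Set.mem_iUnion.2 ⟨n, hn⟩

lemma integrable_halfLineLebesgue_of_bounded {f : ℝ≥0 → ℝ} (hf : Measurable f) {C : ℝ} {K : ℝ≥0}
    (hC : ∀ u, |f u| ≤ C) (hK : ∀ u, K < u → f u = 0) : Integrable f halfLineLebesgue := by
  have h1 : IntegrableOn f (Set.Iic K) halfLineLebesgue :=
    Measure.integrableOn_of_bounded (by rw [halfLineLebesgue_Iic]; exact ENNReal.coe_ne_top)
      hf.aestronglyMeasurable (.of_forall hC)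
  exact h1.integrable_of_forall_notMem_eq_zero fun u hu => hK u (not_le.1 hu)

/-- A triangular probability density supported in `[0, K + 1]`. -/
noncomputable def triangleDensity (K : ℕ) (u : ℝ≥0) : ℝ≥0 := 2 / (K + 1) * (1 - u / (K + 1))

lemma continuous_triangleDensity (K : ℕ) : Continuous (triangleDensity K) := by
  unfold triangleDensity; fun_prop

lemma triangleDensity_le (K : ℕ) (u : ℝ≥0) : triangleDensity K u ≤ 2 / (K + 1) :=
  mul_le_of_le_one_right' tsub_le_self

lemma triangleDensity_of_lt {K : ℕ} {u : ℝ≥0} (hu : (K : ℝ≥0) + 1 < u) :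
    triangleDensity K u = 0 := by
  unfold triangleDensity
  rw [tsub_eq_zero_of_le ((one_le_div (by positivity)).2 hu.le), mul_zero]

lemma lintegral_triangleDensity (K : ℕ) :
    ∫⁻ u, (triangleDensity K u : ℝ≥0∞) ∂halfLineLebesgue = 1 := by
  rw [lintegral_halfLineLebesgue (continuous_triangleDensity K).measurable.coe_nnreal_ennreal]
  set c : ℝ := (K : ℝ) + 1 with hc
  have hcpos : 0 < c := by positivity
  have h1 : ∫⁻ t in Set.Ici (0 : ℝ), (triangleDensity K t.toNNReal : ℝ≥0∞)
      = ∫⁻ t in Set.Icc (0 : ℝ) c, ENNReal.ofReal (2 / c * (1 - t / c)) := by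
    rw [← lintegral_indicator measurableSet_Ici, ← lintegral_indicator measurableSet_Icc]
    refine lintegral_congr fun t => ?_
    by_cases h0 : 0 ≤ t
    · rw [Set.indicator_of_mem (by exact h0)]
      by_cases htc : t ≤ c
      · rw [Set.indicator_of_mem (by exact ⟨h0, htc⟩), ← ENNReal.ofReal_coe_nnreal]
        congr 1
        have hle : t.toNNReal / ((K : ℝ≥0) + 1) ≤ 1 := by
          rw [div_le_one (by positivity), Real.toNNReal_le_iff_le_coe]
          simpa using htc
        simp [triangleDensity, NNReal.coe_sub hle, h0, hc]
      · rw [Set.indicator_of_notMem (by simp [htc]), triangleDensity_of_lt]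
        · simp
        · rw [Real.lt_toNNReal_iff_coe_lt]; simpa using htc
    · rw [Set.indicator_of_notMem (by simpa using h0), Set.indicator_of_notMem (by simp [h0])]
  rw [h1, ← ofReal_integral_eq_lintegral_ofReal]
  · rw [integral_Icc_eq_integral_Ioc, ← intervalIntegral.integral_of_le hcpos.le]
    have : ∫ t in (0 : ℝ)..c, 2 / c * (1 - t / c) = 1 := by
      rw [intervalIntegral.integral_const_mul, intervalIntegral.integral_sub (by simp)
        (by apply Continuous.intervalIntegrable; fun_prop), intervalIntegral.integral_div]
      simp
      field_simp
      ring
    rw [this, ENNReal.ofReal_one]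
  · apply Continuous.integrableOn_Icc; fun_prop
  · refine (ae_restrict_iff' measurableSet_Icc).2 (.of_forall fun t ht => ?_)
    exact mul_nonneg (by positivity) (sub_nonneg.2 ((div_le_one hcpos).2 ht.2))

end HalfLine

/-! ### Elementary inequalities -/

section Inequalities

lemma le_one_add_mul_one_sub_exp_neg (t : ℝ) : t ≤ (1 + t) * (1 - Real.exp (-t)) := by
  have h1 : (1 + t) * Real.exp (-t) ≤ 1 := by
    rw [Real.exp_neg, ← div_eq_mul_inv, div_le_one (Real.exp_pos _)]
    linarith [Real.add_one_le_exp t]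
  nlinarith

lemma one_sub_exp_neg_le (t : ℝ) : 1 - Real.exp (-t) ≤ t := by
  linarith [Real.add_one_le_exp (-t)]

lemma one_sub_exp_neg_nonneg {t : ℝ} (ht : 0 ≤ t) : 0 ≤ 1 - Real.exp (-t) := by
  rw [sub_nonneg, Real.exp_le_one_iff]; linarith

lemma neg_log_one_sub_bounds {t : ℝ} (h0 : 0 ≤ t) (h1 : t ≤ 1 / 2) :
    t ≤ -Real.log (1 - t) ∧ -Real.log (1 - t) ≤ (1 + 2 * t) * t := by
  have hpos : 0 < 1 - t := by linarith
  refine ⟨by linarith [Real.log_le_sub_one_of_pos hpos], ?_⟩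
  have h2 := Real.one_sub_inv_le_log_of_pos hpos
  have h3 : (1 - t)⁻¹ ≤ 1 + (1 + 2 * t) * t := by
    rw [inv_le_iff_one_le_mul₀ hpos]
    nlinarith [mul_nonneg h0 (by linarith : 0 ≤ 1 - 2 * t), mul_nonneg (mul_nonneg h0 h0)
      (by linarith : 0 ≤ 1 - 2 * t)]
  linarith

/-- The continuous extension of `t ↦ (1 - exp (-t)) / t`. -/
noncomputable def expQuotient (t : ℝ) : ℝ := dslope (fun t : ℝ => 1 - Real.exp (-t)) 0 t

lemma mul_expQuotient (t : ℝ) : t * expQuotient t = 1 - Real.exp (-t) := by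
  have := sub_smul_dslope (fun t : ℝ => 1 - Real.exp (-t)) 0 t
  simpa [expQuotient] using this

lemma continuous_expQuotient : Continuous expQuotient := by
  rw [← continuousOn_univ]
  exact (continuousOn_dslope univ_mem).2 ⟨by fun_prop, by fun_prop⟩

lemma expQuotient_mem {t : ℝ} (ht : 0 ≤ t) : 0 ≤ expQuotient t ∧ expQuotient t ≤ 1 := by
  rcases ht.eq_or_lt with rfl | h
  · have : expQuotient 0 = 1 := by
      unfold expQuotient
      rw [dslope_same]
      have : HasDerivAt (fun t : ℝ => 1 - Real.exp (-t)) (-(Real.exp (-0) * -1)) 0 :=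
        ((hasDerivAt_neg (0 : ℝ)).exp).const_sub 1
      rw [this.deriv]; simp
    rw [this]; simp
  · have h1 := mul_expQuotient t
    have h2 := one_sub_exp_neg_le t
    have h3 := one_sub_exp_neg_nonneg ht
    constructor
    · by_contra hneg
      push Not at hneg
      nlinarith
    · by_contra hgt
      push Not at hgt
      nlinarith

lemma abs_integral_expNeg_sub_le {Ω : Type*} [MeasurableSpace Ω] {P : Measure Ω}
    [IsProbabilityMeasure P] {A B : Ω → ℝ≥0∞} (hA : Measurable A) (hB : Measurable B) {ε : ℝ}
    (hε : 0 ≤ ε) (hAB : ∀ ω, A ω ≤ B ω) (hBA : ∀ ω, B ω ≤ ENNReal.ofReal (1 + ε) * A ω) :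
    |∫ ω, expNeg (A ω) ∂P - ∫ ω, expNeg (B ω) ∂P| ≤ ε := by
  rw [← integral_sub (integrable_expNeg hA.aemeasurable) (integrable_expNeg hB.aemeasurable),
    ← Real.norm_eq_abs]
  refine (norm_integral_le_of_norm_le_const (C := ε) (.of_forall fun ω => ?_)).trans (by simp)
  exact abs_expNeg_sub_expNeg_le hε (hAB ω) (hBA ω)

end Inequalities

/-! ### The limiting exponent of the level transform -/

section LevelExponent

variable {S : Type*}

/-- The function `x ↦ ∫_0^∞ (1 - exp (-f(x, u))) du`. -/
noncomputable def levelExponent (f : S × ℝ≥0 → ℝ) (x : S) : ℝ≥0∞ :=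
  ∫⁻ u, ENNReal.ofReal (1 - Real.exp (-f (x, u))) ∂halfLineLebesgue

lemma measurable_levelExponent [MeasurableSpace S] {f : S × ℝ≥0 → ℝ} (hf : Measurable f) :
    Measurable (levelExponent f) := by
  unfold levelExponent
  refine Measurable.lintegral_prod_right' (f := fun z => ENNReal.ofReal (1 - Real.exp (-f z))) ?_
  fun_prop

variable [MeasurableSpace S] [TopologicalSpace S]

lemma levelTransform_bounds {f : S × ℝ≥0 → ℝ} (hf : Measurable f) (hf0 : ∀ z, 0 ≤ f z)
    {K r : ℝ≥0} (hK : ∀ x u, K < u → f (x, u) = 0) (hr : 0 < r) (hKr : 2 * K ≤ r) (x : S) :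
    levelExponent f x ≤ ENNReal.ofReal (levelTransform r f x) ∧
      ENNReal.ofReal (levelTransform r f x)
        ≤ ENNReal.ofReal (1 + 2 * K / r) * levelExponent f x := by
  have hfx : Measurable fun u => f (x, u) := hf.comp measurable_prodMk_left
  have hKr' : K ≤ r := le_trans (by rw [two_mul]; exact le_self_add) hKr
  have hint : Integrable (fun u => 1 - Real.exp (-f (x, u))) halfLineLebesgue := by
    refine integrable_halfLineLebesgue_of_bounded (C := 1) (K := K) (by fun_prop) (fun u => ?_)
      (fun u hu => by simp [hK x u hu])
    rw [abs_of_nonneg (one_sub_exp_neg_nonneg (hf0 _))]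
    linarith [Real.exp_pos (-f (x, u))]
  set G := ∫ u, (1 - Real.exp (-f (x, u))) ∂halfLineLebesgue with hG
  have hG0 : 0 ≤ G := integral_nonneg fun u => one_sub_exp_neg_nonneg (hf0 _)
  have hexp : levelExponent f x = ENNReal.ofReal G :=
    (ofReal_integral_eq_lintegral_ofReal hint
      (.of_forall fun u => one_sub_exp_neg_nonneg (hf0 _))).symm
  have hGr : ∫ u in Set.Iic r, Real.exp (-f (x, u)) ∂halfLineLebesgue = r - G := by
    have h1 : G = ∫ u in Set.Iic r, (1 - Real.exp (-f (x, u))) ∂halfLineLebesgue := by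
      rw [setIntegral_eq_integral_of_forall_compl_eq_zero]
      intro u hu
      simp [hK x u (hKr'.trans_lt (not_le.1 hu))]
    have hfin : halfLineLebesgue (Set.Iic r) ≠ ∞ := by
      rw [halfLineLebesgue_Iic]; exact ENNReal.coe_ne_top
    have h2 : IntegrableOn (fun _ => (1 : ℝ)) (Set.Iic r) halfLineLebesgue :=
      integrableOn_const hfin
    have h3 : ∫ u in Set.Iic r, Real.exp (-f (x, u)) ∂halfLineLebesgue
        = ∫ u in Set.Iic r, (1 : ℝ) - (1 - Real.exp (-f (x, u))) ∂halfLineLebesgue := by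
      refine integral_congr_ae (.of_forall fun u => ?_)
      simp
    rw [h3, integral_sub h2 hint.integrableOn, ← h1]
    simp [measureReal_def, halfLineLebesgue_Iic]
  have hGK : G ≤ K := by
    have h1 : ENNReal.ofReal G ≤ K := by
      rw [← hexp, levelExponent, ← halfLineLebesgue_Iic, ← lintegral_indicator_one measurableSet_Iic]
      refine lintegral_mono fun u => ?_
      by_cases hu : u ≤ K
      · rw [Set.indicator_of_mem (by exact hu), Pi.one_apply]
        exact ENNReal.ofReal_le_one.2 (by linarith [Real.exp_pos (-f (x, u))])
      · simp [hK x u (not_le.1 hu)]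
    rw [← ENNReal.ofReal_coe_nnreal, ENNReal.ofReal_le_ofReal_iff (NNReal.coe_nonneg _)] at h1
    exact h1
  have hrpos : (0 : ℝ) < r := hr
  have hKr2 : 2 * (K : ℝ) ≤ r := by exact_mod_cast hKr
  have htr : levelTransform r f x = r * -Real.log (1 - G / r) := by
    unfold levelTransform
    rw [hGr]
    have : (r : ℝ)⁻¹ * (r - G) = 1 - G / r := by field_simp
    rw [this]; ring
  have ht0 : 0 ≤ G / r := by positivity
  have ht1 : G / r ≤ 1 / 2 := by rw [div_le_iff₀ hrpos]; linarith
  obtain ⟨hlow, hup⟩ := neg_log_one_sub_bounds ht0 ht1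
  have hGdiv : r * (G / r) = G := by field_simp
  rw [hexp, htr]
  constructor
  · refine ENNReal.ofReal_le_ofReal ?_
    calc G = r * (G / r) := hGdiv.symm
      _ ≤ _ := mul_le_mul_of_nonneg_left hlow hrpos.le
  · rw [← ENNReal.ofReal_mul (by positivity)]
    refine ENNReal.ofReal_le_ofReal ?_
    calc r * -Real.log (1 - G / r) ≤ r * ((1 + 2 * (G / r)) * (G / r)) :=
          mul_le_mul_of_nonneg_left hup hrpos.le
      _ = (1 + 2 * (G / r)) * G := by rw [← hGdiv]; field_simp
      _ ≤ (1 + 2 * K / r) * G := by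
          refine mul_le_mul_of_nonneg_right ?_ hG0
          rw [← mul_div_assoc]; gcongr

end LevelExponent

/-! ### The test classes on `S` and on `S × [0, ∞)` -/

section TestClasses

variable {S : Type*} [TopologicalSpace S] [MeasurableSpace S] [BorelSpace S]
  [SecondCountableTopology S] [TopologicalSpace.MetrizableSpace S] {h : ℕ → S →ᵇ ℝ}

lemma exists_level_bound_of_mem_testClass {F : S × ℝ≥0 → ℝ}
    (hF : F ∈ testClass (levelWeights h)) : ∃ K : ℝ≥0, ∀ x u, K < u → F (x, u) = 0 := by
  induction hF using AddSubmonoid.closure_induction with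
  | mem F hF =>
    obtain ⟨f, j, -, rfl⟩ := hF
    refine ⟨(j.unpair.2 : ℝ≥0) + 1, fun x u hu => ?_⟩
    simp [levelWeights_apply, levelCutoff_of_lt hu]
  | zero => exact ⟨0, fun _ _ _ => rfl⟩
  | add F G _ _ hF hG =>
    obtain ⟨K, hK⟩ := hF
    obtain ⟨L, hL⟩ := hG
    refine ⟨max K L, fun x u hu => ?_⟩
    simp [hK x u ((le_max_left _ _).trans_lt hu), hL x u ((le_max_right _ _).trans_lt hu)]

/-- Integrating out the level maps the test class of `S × [0, ∞)` to that of `S`. -/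
lemma exists_testClass_lintegral_level (h_nonneg : ∀ k x, 0 ≤ h k x) {F : S × ℝ≥0 → ℝ}
    (hF : F ∈ testClass (levelWeights h)) : ∃ G ∈ testClass h, ∀ x,
      ∫⁻ u, ENNReal.ofReal (F (x, u)) ∂halfLineLebesgue = ENNReal.ofReal (G x) := by
  induction hF using AddSubmonoid.closure_induction with
  | mem F hF =>
    obtain ⟨f, j, hf, rfl⟩ := hF
    set K := j.unpair.2
    set k := j.unpair.1
    have hbound : ∀ x u, ‖f (x, u) * levelCutoff K u‖ ≤ ‖f‖ * levelCutoff K u := fun x u => by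
      rw [norm_mul]
      refine mul_le_mul (f.norm_coe_le_norm _) (by simp) (norm_nonneg _) (norm_nonneg _)
    have hcut : Integrable (fun u => (levelCutoff K u : ℝ)) halfLineLebesgue := by
      refine integrable_halfLineLebesgue_of_bounded (C := 1) (K := (K : ℝ≥0) + 1)
        (continuous_levelCutoff K).measurable.coe_nnreal_real (fun u => ?_)
        (fun u hu => by simp [levelCutoff_of_lt hu])
      simpa using levelCutoff_le_one K u
    have hmeas : ∀ x, Measurable fun u => f (x, u) * (levelCutoff K u : ℝ) := fun x =>
      ((f.continuous.measurable.comp measurable_prodMk_left).mul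
        (continuous_levelCutoff K).measurable.coe_nnreal_real)
    have hint : ∀ x, Integrable (fun u => f (x, u) * (levelCutoff K u : ℝ)) halfLineLebesgue :=
      fun x => (hcut.const_mul ‖f‖).mono' (hmeas x).aestronglyMeasurable (.of_forall (hbound x))
    have hcont : Continuous fun x => ∫ u, f (x, u) * levelCutoff K u ∂halfLineLebesgue := by
      refine continuous_of_dominated (bound := fun u => ‖f‖ * levelCutoff K u)
        (fun x => (hmeas x).aestronglyMeasurable) (fun x => .of_forall (hbound x))
        (hcut.const_mul _) (.of_forall fun u => ?_)
      exact (f.continuous.comp (by fun_prop)).mul continuous_const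
    let g : S →ᵇ ℝ := .ofNormedAddCommGroup _ hcont (∫ u, ‖f‖ * levelCutoff K u ∂halfLineLebesgue)
      fun x => norm_integral_le_of_norm_le (hcut.const_mul _) (.of_forall (hbound x))
    have hg : ∀ x, g x = ∫ u, f (x, u) * levelCutoff K u ∂halfLineLebesgue := fun x => rfl
    refine ⟨_, mul_mem_testClass (f := g) (fun x => ?_) k, fun x => ?_⟩
    · rw [hg]; exact integral_nonneg fun u => mul_nonneg (hf _) (NNReal.coe_nonneg _)
    · have hnn : ∀ u, 0 ≤ f (x, u) * (levelCutoff K u : ℝ) := fun u =>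
        mul_nonneg (hf _) (NNReal.coe_nonneg _)
      rw [ENNReal.ofReal_mul (by rw [hg]; exact integral_nonneg hnn), hg,
        ofReal_integral_eq_lintegral_ofReal (hint x) (.of_forall hnn),
        ← lintegral_mul_const _ (hmeas x).ennreal_ofReal]
      refine lintegral_congr fun u => ?_
      rw [← ENNReal.ofReal_mul (hnn u)]
      congr 1
      simp only [levelWeights_apply]
      ring
  | zero => exact ⟨0, (testClass h).zero_mem, fun x => by simp⟩
  | add F F' hF' hF'' ihF ihF' =>
    obtain ⟨G, hG, hFG⟩ := ihF
    obtain ⟨G', hG', hFG'⟩ := ihF'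
    refine ⟨G + G', (testClass h).add_mem hG hG', fun x => ?_⟩
    have hm : Measurable fun u => F (x, u) :=
      (continuous_of_mem_testClass hF').measurable.comp measurable_prodMk_left
    have hw := levelWeights_nonneg h_nonneg
    simp only [Pi.add_apply]
    rw [ENNReal.ofReal_add (nonneg_of_mem_testClass h_nonneg hG x)
      (nonneg_of_mem_testClass h_nonneg hG' x), ← hFG, ← hFG',
      ← lintegral_add_left hm.ennreal_ofReal]
    refine lintegral_congr fun u => ?_
    exact ENNReal.ofReal_add (nonneg_of_mem_testClass hw hF' _) (nonneg_of_mem_testClass hw hF'' _)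

lemma exists_testClass_levelExponent (h_nonneg : ∀ k x, 0 ≤ h k x) {F : S × ℝ≥0 → ℝ}
    (hF : F ∈ testClass (levelWeights h)) :
    ∃ G ∈ testClass h, ∀ x, levelExponent F x = ENNReal.ofReal (G x) := by
  have hF0 := nonneg_of_mem_testClass (levelWeights_nonneg h_nonneg) hF
  let g : (S × ℝ≥0) →ᵇ ℝ := .ofNormedAddCommGroup (fun z => expQuotient (F z))
    (continuous_expQuotient.comp (continuous_of_mem_testClass hF)) 1 fun z => by
      rw [Real.norm_of_nonneg (expQuotient_mem (hF0 z)).1]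
      exact (expQuotient_mem (hF0 z)).2
  obtain ⟨G, hG, hFG⟩ := exists_testClass_lintegral_level h_nonneg
    (mul_mem_testClass_of_mem hF (g := g) fun z => (expQuotient_mem (hF0 z)).1)
  refine ⟨G, hG, fun x => ?_⟩
  rw [← hFG]
  refine lintegral_congr fun u => ?_
  rw [← mul_expQuotient, mul_comm]
  rfl

lemma mul_triangleDensity_mem_testClass {G : S → ℝ} (hG : G ∈ testClass h) (K : ℕ) :
    (fun z : S × ℝ≥0 => G z.1 * triangleDensity K z.2) ∈ testClass (levelWeights h) := by
  induction hG using AddSubmonoid.closure_induction with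
  | mem G hG =>
    obtain ⟨f, j, hf, rfl⟩ := hG
    let g : (S × ℝ≥0) →ᵇ ℝ := .ofNormedAddCommGroup
      (fun z => f z.1 * (triangleDensity K z.2 : ℝ))
      ((f.continuous.comp continuous_fst).mul
        (NNReal.continuous_coe.comp ((continuous_triangleDensity K).comp continuous_snd)))
      (‖f‖ * ((2 / (K + 1) : ℝ≥0) : ℝ)) fun z => by
        rw [norm_mul]
        refine mul_le_mul (f.norm_coe_le_norm _) ?_ (norm_nonneg _) (norm_nonneg _)
        simpa only [Real.norm_eq_abs, NNReal.abs_eq] using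
          NNReal.coe_le_coe.2 (triangleDensity_le K z.2)
    have hg : ∀ z, g z = f z.1 * (triangleDensity K z.2 : ℝ) := fun z => rfl
    have := mul_mem_testClass (w := levelWeights h) (f := g)
      (fun z => mul_nonneg (hf _) (NNReal.coe_nonneg _)) (Nat.pair j (K + 1))
    convert this using 1
    funext z
    rw [hg]
    by_cases hz : z.2 ≤ ((K + 1 : ℕ) : ℝ≥0)
    · rw [levelWeights_pair hz]; ring
    · rw [triangleDensity_of_lt (by simpa using hz)]; simp
  | zero =>
    have h0 : (fun z : S × ℝ≥0 => (0 : S → ℝ) z.1 * (triangleDensity K z.2 : ℝ)) = 0 := by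
      funext z; simp
    rw [h0]; exact (testClass _).zero_mem
  | add G G' _ _ hG hG' =>
    convert (testClass _).add_mem hG hG' using 1
    funext z; simp [add_mul]

lemma lintegral_mul_triangleDensity {c : ℝ} (hc : 0 ≤ c) (K : ℕ) :
    ∫⁻ u, ENNReal.ofReal (c * triangleDensity K u) ∂halfLineLebesgue = ENNReal.ofReal c := by
  simp only [ENNReal.ofReal_mul hc, ENNReal.ofReal_coe_nnreal]
  rw [lintegral_const_mul _ (continuous_triangleDensity K).measurable.coe_nnreal_ennreal,
    lintegral_triangleDensity, mul_one]

lemma levelExponent_mul_triangleDensity_le {G : S → ℝ} (hG0 : ∀ x, 0 ≤ G x) (K : ℕ) (x : S) :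
    levelExponent (fun z : S × ℝ≥0 => G z.1 * triangleDensity K z.2) x ≤ ENNReal.ofReal (G x) := by
  rw [← lintegral_mul_triangleDensity (hG0 x) K]
  exact lintegral_mono fun u => ENNReal.ofReal_le_ofReal (one_sub_exp_neg_le _)

lemma le_levelExponent_mul_triangleDensity {G : S → ℝ} (hG : Measurable G) {C : ℝ}
    (hG0 : ∀ x, 0 ≤ G x) (hGC : ∀ x, G x ≤ C) (K : ℕ) (x : S) :
    ENNReal.ofReal (G x) ≤ ENNReal.ofReal (1 + C * (2 / (K + 1))) *
      levelExponent (fun z : S × ℝ≥0 => G z.1 * triangleDensity K z.2) x := by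
  have hm := (continuous_triangleDensity K).measurable.coe_nnreal_real
  rw [← lintegral_mul_triangleDensity (hG0 x) K, levelExponent,
    ← lintegral_const_mul _ (by fun_prop)]
  refine lintegral_mono fun u => ?_
  have hC : 0 ≤ C := (hG0 x).trans (hGC x)
  rw [← ENNReal.ofReal_mul (by positivity)]
  refine ENNReal.ofReal_le_ofReal ?_
  set t := G x * (triangleDensity K u : ℝ) with ht
  have ht0 : 0 ≤ t := mul_nonneg (hG0 x) (NNReal.coe_nonneg _)
  have htC : t ≤ C * (2 / (K + 1)) := by
    refine mul_le_mul (hGC x) ?_ (NNReal.coe_nonneg _) hC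
    simpa using NNReal.coe_le_coe.2 (triangleDensity_le K u)
  refine (le_one_add_mul_one_sub_exp_neg t).trans ?_
  exact mul_le_mul_of_nonneg_right (by linarith) (one_sub_exp_neg_nonneg ht0)

lemma le_levelExponent_two_mul {G : S → ℝ} (hG0 : ∀ x, 0 ≤ G x) (hG1 : ∀ x, G x ≤ 1) (x : S) :
    ENNReal.ofReal (G x)
      ≤ levelExponent (fun z : S × ℝ≥0 => 2 * G z.1 * triangleDensity 3 z.2) x := by
  rw [← lintegral_mul_triangleDensity (hG0 x) 3]
  refine lintegral_mono fun u => ENNReal.ofReal_le_ofReal ?_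
  have h1 : (triangleDensity 3 u : ℝ) ≤ 1 / 2 := by
    have := NNReal.coe_le_coe.2 (triangleDensity_le 3 u)
    norm_num at this
    linarith
  set t := G x * (triangleDensity 3 u : ℝ) with ht
  have ht0 : 0 ≤ t := mul_nonneg (hG0 x) (NNReal.coe_nonneg _)
  have ht1 : 2 * t ≤ 1 := by
    have : t ≤ 1 * (1 / 2) := mul_le_mul (hG1 x) h1 (NNReal.coe_nonneg _) zero_le_one
    linarith
  have h2 := le_one_add_mul_one_sub_exp_neg (2 * t)
  have h3 := one_sub_exp_neg_nonneg (by linarith : 0 ≤ 2 * t)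
  have h4 : 2 * G x * (triangleDensity 3 u : ℝ) = 2 * t := by rw [ht]; ring
  simp only [h4]
  nlinarith

end TestClasses

/-! ### Counting measures -/

section Counting

variable {E : Type*} [MeasurableSpace E]

lemma exists_enat_eq_tsum {a : ℕ → ℝ≥0∞} (ha : ∀ i, ∃ m : ℕ∞, a i = m) :
    ∃ m : ℕ∞, ∑' i, a i = m := by
  choose m hm using ha
  have hcl : IsClosed (Set.range ENat.toENNReal) := ENat.isClosedEmbedding_toENNReal.isClosed_range
  have hmem : ∑' i, a i ∈ Set.range ENat.toENNReal := by
    refine hcl.mem_of_tendsto (ENNReal.tendsto_nat_tsum a) (.of_forall fun n => ?_)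
    induction n with
    | zero => exact ⟨0, by simp⟩
    | succ n ih =>
      obtain ⟨k, hk⟩ := ih
      exact ⟨k + m n, by rw [Finset.sum_range_succ, ← hk, hm n, ENat.toENNReal_add]⟩
  obtain ⟨k, hk⟩ := hmem
  exact ⟨k, hk.symm⟩

lemma isCountingMeasure_zero : IsCountingMeasure (0 : Measure E) := fun _ _ => ⟨0, by simp⟩

lemma isCountingMeasure_dirac (x : E) : IsCountingMeasure (Measure.dirac x) := by
  intro A hA
  rw [Measure.dirac_apply' _ hA]
  by_cases hx : x ∈ A
  · exact ⟨1, by simp [hx]⟩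
  · exact ⟨0, by simp [hx]⟩

lemma IsCountingMeasure.sum {μ : ℕ → Measure E} (hμ : ∀ i, IsCountingMeasure (μ i)) :
    IsCountingMeasure (Measure.sum μ) := by
  intro A hA
  rw [Measure.sum_apply _ hA]
  exact exists_enat_eq_tsum fun i => hμ i A hA

lemma IsCountingMeasure.add {μ ν : Measure E} (hμ : IsCountingMeasure μ)
    (hν : IsCountingMeasure ν) : IsCountingMeasure (μ + ν) := by
  intro A hA
  obtain ⟨a, ha⟩ := hμ A hA
  obtain ⟨b, hb⟩ := hν A hA
  exact ⟨a + b, by rw [Measure.add_apply, ha, hb, ENat.toENNReal_add]⟩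

/-- Being a counting measure can be checked on a countable algebra, on a partition into sets of
finite measure. -/
lemma isCountingMeasure_of_generateFrom {μ : Measure E} {𝒜 : Set (Set E)}
    (h𝒜 : IsSetAlgebra 𝒜) (hgen : ‹MeasurableSpace E› = MeasurableSpace.generateFrom 𝒜)
    {D : ℕ → Set E} (hDm : ∀ n, MeasurableSet (D n)) (hDd : Pairwise (Function.onFun Disjoint D))
    (hDU : ⋃ n, D n = Set.univ) (hDf : ∀ n, μ (D n) < ∞)
    (h : ∀ n, ∀ A ∈ 𝒜, ∃ m : ℕ∞, μ (A ∩ D n) = m) : IsCountingMeasure μ := by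
  have hall : ∀ n, ∀ A, MeasurableSet A → ∃ m : ℕ∞, μ (A ∩ D n) = m := by
    intro n A hA
    have hpi : IsPiSystem 𝒜 := fun s hs t ht _ => h𝒜.inter_mem hs ht
    induction A, hA using MeasurableSpace.induction_on_inter hgen hpi with
    | empty => exact ⟨0, by simp⟩
    | basic A hA => exact h n A hA
    | compl A hA ih =>
      obtain ⟨a, ha⟩ := ih
      obtain ⟨b, hb⟩ := h n Set.univ (by simpa using h𝒜.compl_mem h𝒜.empty_mem)
      rw [Set.univ_inter] at hb
      refine ⟨b - a, ?_⟩
      have hset : Aᶜ ∩ D n = D n \ (A ∩ D n) := by ext; simp; tauto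
      rw [hset, measure_sdiff Set.inter_subset_right (hA.inter (hDm n)).nullMeasurableSet
        (ne_top_of_le_ne_top (hDf n).ne (measure_mono Set.inter_subset_right)), ha, hb,
        ENat.toENNReal_sub]
    | iUnion A hd hA ih =>
      rw [Set.iUnion_inter, measure_iUnion
        (fun i j hij => (hd hij).mono Set.inter_subset_left Set.inter_subset_left)
        (fun i => (hA i).inter (hDm n))]
      exact exists_enat_eq_tsum ih
  intro A hA
  have hsum : μ A = ∑' n, μ (A ∩ D n) := by
    rw [← measure_iUnion (fun i j hij => (hDd hij).mono Set.inter_subset_right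
      Set.inter_subset_right) (fun n => hA.inter (hDm n)), ← Set.inter_iUnion, hDU, Set.inter_univ]
  rw [hsum]
  exact exists_enat_eq_tsum fun n => hall n A hA

lemma measurableSet_isCountingMeasure [MeasurableSpace.CountablyGenerated E] {M : Type*}
    [MeasurableSpace M] {toMeas : M → Measure E} (hm : Measurable toMeas)
    {D : ℕ → Set E} (hDm : ∀ n, MeasurableSet (D n)) (hDd : Pairwise (Function.onFun Disjoint D))
    (hDU : ⋃ n, D n = Set.univ) (hDf : ∀ μ n, toMeas μ (D n) < ∞) :
    MeasurableSet {μ : M | IsCountingMeasure (toMeas μ)} := by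
  let 𝒜 := generateSetAlgebra (MeasurableSpace.countableGeneratingSet E)
  have h𝒜 : IsSetAlgebra 𝒜 := isSetAlgebra_generateSetAlgebra
  have hcount : 𝒜.Countable :=
    countable_generateSetAlgebra MeasurableSpace.countable_countableGeneratingSet
  have hgen : ‹MeasurableSpace E› = MeasurableSpace.generateFrom 𝒜 := by
    rw [generateFrom_generateSetAlgebra_eq, MeasurableSpace.generateFrom_countableGeneratingSet]
  have h𝒜m : ∀ A ∈ 𝒜, MeasurableSet A := fun A hA => by
    rw [hgen]; exact MeasurableSpace.measurableSet_generateFrom hA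
  have hset : {μ : M | IsCountingMeasure (toMeas μ)}
      = ⋂ n, ⋂ A ∈ 𝒜, {μ | toMeas μ (A ∩ D n) ∈ Set.range ENat.toENNReal} := by
    ext μ
    simp only [Set.mem_ofPred_eq, Set.mem_iInter, Set.mem_range]
    constructor
    · intro hμ n A hA
      obtain ⟨m, hm⟩ := hμ _ ((h𝒜m A hA).inter (hDm n))
      exact ⟨m, hm.symm⟩
    · intro hμ
      refine isCountingMeasure_of_generateFrom h𝒜 hgen hDm hDd hDU (hDf μ) fun n A hA => ?_
      obtain ⟨m, hm⟩ := hμ n A hA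
      exact ⟨m, hm.symm⟩
  rw [hset]
  refine MeasurableSet.iInter fun n => MeasurableSet.biInter hcount fun A hA => ?_
  exact (Measure.measurable_coe ((h𝒜m A hA).inter (hDm n))).comp hm
    (Set.countable_range _).measurableSet

end Counting

/-! ### Construction of Poisson random measures -/

section PoissonConstruction

lemma integral_pow_poissonMeasure (c : ℝ≥0) (a : ℝ) :
    ∫ j, a ^ j ∂(poissonMeasure c) = Real.exp (-(c * (1 - a))) := by
  rw [integral_poissonMeasure]
  have h1 : ∀ n : ℕ, (Real.exp (-c) * (c : ℝ) ^ n / n.factorial) • a ^ n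
      = Real.exp (-c) * ((c * a) ^ n / n.factorial) := fun n => by
    rw [smul_eq_mul, mul_pow]; ring
  simp only [h1]
  rw [tsum_mul_left]
  have h2 : ∑' n : ℕ, ((c : ℝ) * a) ^ n / n.factorial = Real.exp (c * a) := by
    rw [Real.exp_eq_exp_ℝ, NormedSpace.exp_eq_tsum_div]
  rw [h2, ← Real.exp_add]
  ring_nf

lemma expNeg_mul_nat (c : ℝ≥0∞) (j : ℕ) : expNeg (c * j) = expNeg c ^ j := by
  induction j with
  | zero => simp [expNeg_zero]
  | succ j ih => rw [Nat.cast_succ, mul_add, mul_one, expNeg_add, ih, pow_succ]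

/-- The Laplace exponent `∫ (1 - exp (-f)) dm` of a Poisson random measure with mean `m`. -/
noncomputable def poissonExponent {E : Type*} [MeasurableSpace E] (m : Measure E)
    (f : E → ℝ≥0∞) : ℝ≥0∞ :=
  ∫⁻ x, ENNReal.ofReal (1 - expNeg (f x)) ∂m

variable {E : Type*} [MeasurableSpace E]

/-- The counting measure of the first `n` points of a sequence. -/
noncomputable def pointSum (p : ℕ × (ℕ → E)) : Measure E :=
  ∑ i ∈ Finset.range p.1, Measure.dirac (p.2 i)

lemma isCountingMeasure_pointSum (p : ℕ × (ℕ → E)) : IsCountingMeasure (pointSum p) := by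
  obtain ⟨n, x⟩ := p
  unfold pointSum
  induction n with
  | zero => simpa using isCountingMeasure_zero
  | succ n ih => simp only [Finset.sum_range_succ]; exact ih.add (isCountingMeasure_dirac _)

lemma lintegral_pointSum (p : ℕ × (ℕ → E)) {f : E → ℝ≥0∞} (hf : Measurable f) :
    ∫⁻ x, f x ∂(pointSum p) = ∑ i ∈ Finset.range p.1, f (p.2 i) := by
  unfold pointSum
  rw [lintegral_finsetSum_measure]
  exact Finset.sum_congr rfl fun i _ => lintegral_dirac' _ hf

lemma measurable_pointSum : Measurable (pointSum : ℕ × (ℕ → E) → Measure E) := by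
  refine Measure.measurable_of_measurable_coe _ fun A hA => ?_
  have h : ∀ p : ℕ × (ℕ → E), pointSum p A
      = ∑ i ∈ Finset.range p.1, A.indicator (1 : E → ℝ≥0∞) (p.2 i) := fun p => by
    rw [← lintegral_pointSum p (measurable_one.indicator hA), lintegral_indicator_one hA]
  simp only [h]
  refine measurable_from_prod_countable_right fun n => ?_
  change Measurable fun x : ℕ → E => ∑ i ∈ Finset.range n, A.indicator (1 : E → ℝ≥0∞) (x i)
  refine Finset.measurable_fun_sum _ fun i _ => ?_
  exact (Measurable.indicator (f := (1 : E → ℝ≥0∞)) measurable_one hA).comp (measurable_pi_apply i)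

lemma integral_prod_infinitePi {Ω : ℕ → Type*} [∀ i, MeasurableSpace (Ω i)]
    (P : ∀ i, Measure (Ω i)) [∀ i, IsProbabilityMeasure (P i)] {g : ∀ i, Ω i → ℝ}
    (hg : ∀ i, Measurable (g i)) (n : ℕ) :
    ∫ ω, ∏ i ∈ Finset.range n, g i (ω i) ∂(Measure.infinitePi P)
      = ∏ i ∈ Finset.range n, ∫ x, g i x ∂(P i) := by
  have hind : iIndepFun (fun (i : Fin n) (ω : ∀ i, Ω i) => g i (ω i)) (Measure.infinitePi P) :=
    (iIndepFun_infinitePi (P := P) hg).precomp Fin.val_injective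
  have h := hind.integral_fun_prod_eq_prod_integral fun i =>
    ((hg i).comp (measurable_pi_apply _)).aestronglyMeasurable
  simp only [Finset.prod_range]
  rw [h]
  refine Finset.prod_congr rfl fun i _ => ?_
  rw [← Measure.infinitePi_map_eval P i,
    integral_map (measurable_pi_apply _).aemeasurable (hg _).aestronglyMeasurable]

/-- A Poisson random measure with finite mean measure. -/
lemma exists_poisson_of_isFiniteMeasure [Nonempty E] (m : Measure E) [IsFiniteMeasure m] :
    ∃ P : Measure (ℕ × (ℕ → E)), IsProbabilityMeasure P ∧ ∀ f : E → ℝ≥0∞, Measurable f →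
      ∫ p, expNeg (∫⁻ x, f x ∂(pointSum p)) ∂P = expNeg (poissonExponent m f) := by
  by_cases hm : m = 0
  · subst hm
    refine ⟨Measure.dirac (0, fun _ => Classical.arbitrary E), inferInstance, fun f hf => ?_⟩
    rw [integral_dirac', lintegral_pointSum _ hf]
    · simp [poissonExponent, expNeg_zero]
    · exact (measurable_expNeg.comp
        ((Measure.measurable_lintegral hf).comp measurable_pointSum)).stronglyMeasurable
  · have : NeZero m := ⟨hm⟩
    set c : ℝ≥0 := (m Set.univ).toNNReal with hc
    have hcm : (c : ℝ≥0∞) = m Set.univ := ENNReal.coe_toNNReal (measure_ne_top _ _)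
    let m' : Measure E := (m Set.univ)⁻¹ • m
    have hm' : IsProbabilityMeasure m' := isProbabilityMeasureSMul
    refine ⟨(poissonMeasure c).prod (Measure.infinitePi fun _ : ℕ => m'), inferInstance,
      fun f hf => ?_⟩
    have hef : Measurable fun x => expNeg (f x) := measurable_expNeg.comp hf
    have hmeas : Measurable fun p : ℕ × (ℕ → E) => expNeg (∫⁻ x, f x ∂(pointSum p)) :=
      measurable_expNeg.comp ((Measure.measurable_lintegral hf).comp measurable_pointSum)
    rw [integral_prod _ (Integrable.of_bound hmeas.aestronglyMeasurable 1
      (.of_forall fun _ => norm_expNeg_le_one _))]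
    set a := ∫ x, expNeg (f x) ∂m' with ha
    have hinner : ∀ n : ℕ, ∫ x, expNeg (∫⁻ z, f z ∂(pointSum (n, x)))
        ∂(Measure.infinitePi fun _ : ℕ => m') = a ^ n := by
      intro n
      simp only [lintegral_pointSum _ hf, expNeg_sum]
      rw [integral_prod_infinitePi (fun _ : ℕ => m') (g := fun _ x => expNeg (f x)) fun _ => hef]
      simp [ha]
    simp only [hinner]
    rw [integral_pow_poissonMeasure]
    have hint : Integrable (fun x => expNeg (f x)) m := integrable_expNeg hf.aemeasurable
    have h1 : poissonExponent m f = ENNReal.ofReal (c * (1 - a)) := by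
      have hca : (c : ℝ) * a = ∫ x, expNeg (f x) ∂m := by
        rw [ha, integral_smul_measure, ← hcm, smul_eq_mul, ← mul_assoc, ENNReal.toReal_inv,
          ENNReal.coe_toReal, mul_inv_cancel₀, one_mul]
        simp only [hc, ne_eq, NNReal.coe_eq_zero, ENNReal.toNNReal_eq_zero_iff, not_or]
        exact ⟨by simpa using hm, measure_ne_top _ _⟩
      have hcr : (c : ℝ) = ∫ _, (1 : ℝ) ∂m := by
        simp only [integral_const, smul_eq_mul, mul_one, measureReal_def, hc]
        rfl
      have hsub : Integrable (fun x => 1 - expNeg (f x)) m := (integrable_const 1).sub hint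
      rw [mul_sub, mul_one, hca, hcr, ← integral_sub (integrable_const _) hint,
        ofReal_integral_eq_lintegral_ofReal hsub
          (.of_forall fun x => sub_nonneg.2 (expNeg_le_one _))]
      rfl
    have ha1 : a ≤ 1 := by
      have := integral_mono (μ := m') (integrable_expNeg hf.aemeasurable) (integrable_const 1)
        fun x => expNeg_le_one (f x)
      simpa using this
    rw [h1, expNeg_ofReal (mul_nonneg (NNReal.coe_nonneg _) (by linarith))]

/-- The superposition of countably many finite counting measures. -/
noncomputable def pointSuperposition (ω : ℕ → ℕ × (ℕ → E)) : Measure E :=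
  Measure.sum fun i => pointSum (ω i)

lemma measurable_pointSuperposition :
    Measurable (pointSuperposition : (ℕ → ℕ × (ℕ → E)) → Measure E) := by
  refine Measure.measurable_of_measurable_coe _ fun A hA => ?_
  simp only [pointSuperposition, Measure.sum_apply _ hA]
  exact Measurable.tsum fun i =>
    (Measure.measurable_coe hA).comp (measurable_pointSum.comp (measurable_pi_apply i))

lemma isCountingMeasure_pointSuperposition (ω : ℕ → ℕ × (ℕ → E)) :
    IsCountingMeasure (pointSuperposition ω) :=
  IsCountingMeasure.sum fun i => isCountingMeasure_pointSum (ω i)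

/-- A Poisson random measure with s-finite mean measure. -/
lemma exists_poisson [Nonempty E] (m : Measure E) [SFinite m] :
    ∃ P : Measure (ℕ → ℕ × (ℕ → E)), IsProbabilityMeasure P ∧ ∀ f : E → ℝ≥0∞, Measurable f →
      ∫ ω, expNeg (∫⁻ x, f x ∂(pointSuperposition ω)) ∂P = expNeg (poissonExponent m f) := by
  choose P hP hPf using fun i => exists_poisson_of_isFiniteMeasure (sfiniteSeq m i)
  refine ⟨Measure.infinitePi P, inferInstance, fun f hf => ?_⟩
  have hmi : ∀ i, Measurable fun ω : ℕ → ℕ × (ℕ → E) => ∫⁻ x, f x ∂(pointSum (ω i)) := fun i =>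
    (Measure.measurable_lintegral hf).comp (measurable_pointSum.comp (measurable_pi_apply i))
  have hlim1 : Tendsto (fun n : ℕ => ∫ ω, expNeg (∑ i ∈ Finset.range n,
      ∫⁻ x, f x ∂(pointSum (ω i))) ∂(Measure.infinitePi P)) atTop
      (𝓝 (∫ ω, expNeg (∫⁻ x, f x ∂(pointSuperposition ω)) ∂(Measure.infinitePi P))) := by
    refine tendsto_integral_of_dominated_convergence (fun _ => 1) (fun n => ?_)
      (integrable_const _) (fun n => .of_forall fun _ => norm_expNeg_le_one _)
      (.of_forall fun ω => ?_)
    · exact (measurable_expNeg.comp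
        (Finset.measurable_sum _ fun i _ => hmi i)).aestronglyMeasurable
    · rw [pointSuperposition, lintegral_sum_measure]
      exact (continuous_expNeg.tendsto _).comp (ENNReal.tendsto_nat_tsum _)
  have hfin : ∀ n : ℕ, ∫ ω, expNeg (∑ i ∈ Finset.range n,
      ∫⁻ x, f x ∂(pointSum (ω i))) ∂(Measure.infinitePi P)
      = expNeg (∑ i ∈ Finset.range n, poissonExponent (sfiniteSeq m i) f) := by
    intro n
    simp only [expNeg_sum]
    rw [integral_prod_infinitePi P (g := fun _ p => expNeg (∫⁻ x, f x ∂(pointSum p))) fun _ =>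
      measurable_expNeg.comp ((Measure.measurable_lintegral hf).comp measurable_pointSum)]
    exact Finset.prod_congr rfl fun i _ => hPf i f hf
  simp only [hfin] at hlim1
  have hlim2 : Tendsto (fun n : ℕ => expNeg (∑ i ∈ Finset.range n,
      poissonExponent (sfiniteSeq m i) f)) atTop (𝓝 (expNeg (poissonExponent m f))) := by
    have hsum : poissonExponent m f = ∑' i, poissonExponent (sfiniteSeq m i) f := by
      unfold poissonExponent
      rw [← lintegral_sum_measure, sum_sfiniteSeq]
    rw [hsum]
    exact (continuous_expNeg.tendsto _).comp (ENNReal.tendsto_nat_tsum _)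
  exact tendsto_nhds_unique hlim1 hlim2

end PoissonConstruction

/-! ### Laplace functionals of Poisson laws -/

section PoissonLaplace

/-- A probability measure on `[0, ∞]` is determined by its Laplace transform at the naturals. -/
lemma measure_ennreal_ext_of_integral_expNeg {P Q : Measure ℝ≥0∞} [IsProbabilityMeasure P]
    [IsProbabilityMeasure Q]
    (h : ∀ n : ℕ, ∫ x, expNeg (n * x) ∂P = ∫ x, expNeg (n * x) ∂Q) : P = Q := by
  let c : ℝ≥0∞ → Unit → ℝ≥0∞ := fun x _ => x
  have hc : Measurable c := measurable_pi_lambda _ fun _ => measurable_id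
  have := Measure.isProbabilityMeasure_map (μ := P) hc.aemeasurable
  have := Measure.isProbabilityMeasure_map (μ := Q) hc.aemeasurable
  have hmap : P.map c = Q.map c := by
    refine measure_cube_ext_of_integral_expMonomial fun l => ?_
    have hsum : ∀ x : ℝ≥0∞, expMonomial l (c x) = expNeg (l.length * x) := fun x => by
      rw [expMonomial_apply]; simp [c]
    rw [integral_map hc.aemeasurable (expMonomial l).continuous.measurable.aestronglyMeasurable,
      integral_map hc.aemeasurable (expMonomial l).continuous.measurable.aestronglyMeasurable]
    simp only [hsum]
    exact h _
  have he : Measurable fun x : Unit → ℝ≥0∞ => x () := measurable_pi_apply _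
  have hid : (fun x : Unit → ℝ≥0∞ => x ()) ∘ c = id := rfl
  have hP := Measure.map_map (μ := P) he hc
  have hQ := Measure.map_map (μ := Q) he hc
  rw [hid, Measure.map_id] at hP hQ
  rw [← hP, ← hQ, hmap]

lemma expNeg_sum_indicator_of_disjoint {E : Type*} {s : Finset ℕ} {A : ℕ → Set E} (c : ℕ → ℝ≥0∞)
    (hA : Pairwise fun i j => Disjoint (A i) (A j)) (x : E) :
    ENNReal.ofReal (1 - expNeg (∑ i ∈ s, (A i).indicator (fun _ => c i) x))
      = ∑ i ∈ s, (A i).indicator (fun _ => ENNReal.ofReal (1 - expNeg (c i))) x := by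
  by_cases hx : ∃ i ∈ s, x ∈ A i
  · obtain ⟨i, hi, hxi⟩ := hx
    have hne : ∀ j, j ≠ i → x ∉ A j := fun j hj hxj =>
      Set.disjoint_left.1 (hA hj) hxj hxi
    rw [Finset.sum_eq_single_of_mem i hi fun j _ hj => Set.indicator_of_notMem (hne j hj) _,
      Finset.sum_eq_single_of_mem i hi fun j _ hj => Set.indicator_of_notMem (hne j hj) _,
      Set.indicator_of_mem hxi, Set.indicator_of_mem hxi]
  · push Not at hx
    rw [Finset.sum_eq_zero fun i hi => Set.indicator_of_notMem (hx i hi) _,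
      Finset.sum_eq_zero fun i hi => Set.indicator_of_notMem (hx i hi) _]
    simp [expNeg_zero]

variable {S : Type*} [TopologicalSpace S] [MeasurableSpace S] [BorelSpace S]
  [SecondCountableTopology S] [TopologicalSpace.MetrizableSpace S] {h : ℕ → S →ᵇ ℝ}

lemma LevelMeasures.measurable_lintegral (h_nonneg : ∀ k x, 0 ≤ h k x)
    (h_cover : ∀ x, ∃ k, 0 < h k x) {f : S × ℝ≥0 → ℝ≥0∞} (hf : Measurable f) :
    Measurable fun μ : LevelMeasures h => ∫⁻ z, f z ∂μ.1 :=
  (Measure.measurable_lintegral hf).comp (LevelMeasures.measurable_val h_nonneg h_cover)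

lemma LevelMeasures.measurable_apply (h_nonneg : ∀ k x, 0 ≤ h k x)
    (h_cover : ∀ x, ∃ k, 0 < h k x) {A : Set (S × ℝ≥0)} (hA : MeasurableSet A) :
    Measurable fun μ : LevelMeasures h => μ.1 A :=
  (Measure.measurable_coe hA).comp (LevelMeasures.measurable_val h_nonneg h_cover)

lemma IsPoissonLaw.integral_expNeg_mul_apply (h_nonneg : ∀ k x, 0 ≤ h k x)
    (h_cover : ∀ x, ∃ k, 0 < h k x) {ρ : Measure (LevelMeasures h)} {m : Measure (S × ℝ≥0)}
    (hρ : IsPoissonLaw ρ m) {A : Set (S × ℝ≥0)} (hA : MeasurableSet A) {c : ℝ≥0∞}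
    (hc : c = 0 ∨ m A < ∞) :
    ∫ μ, expNeg (c * μ.1 A) ∂ρ = expNeg (ENNReal.ofReal (1 - expNeg c) * m A) := by
  have := hρ.isProbabilityMeasure
  rcases hc with rfl | hmA
  · simp [expNeg_zero]
  · have hm : Measurable fun x : ℝ≥0∞ => expNeg (c * x) :=
      measurable_expNeg.comp (measurable_const.mul measurable_id)
    rw [← integral_map (φ := fun μ : LevelMeasures h => μ.1 A)
      (LevelMeasures.measurable_apply h_nonneg h_cover hA).aemeasurable
      hm.aestronglyMeasurable, hρ.poisson A hA hmA,
      integral_map measurable_from_nat.aemeasurable hm.aestronglyMeasurable]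
    simp only [expNeg_mul_nat]
    rw [integral_pow_poissonMeasure]
    have h1 : ENNReal.ofReal (1 - expNeg c) * m A
        = ENNReal.ofReal ((m A).toNNReal * (1 - expNeg c)) := by
      rw [ENNReal.ofReal_mul (NNReal.coe_nonneg _), ENNReal.ofReal_coe_nnreal,
        ENNReal.coe_toNNReal hmA.ne, mul_comm]
    rw [h1, expNeg_ofReal (mul_nonneg (NNReal.coe_nonneg _)
      (sub_nonneg.2 (expNeg_le_one _)))]

lemma IsPoissonLaw.laplace_simpleFunc (h_nonneg : ∀ k x, 0 ≤ h k x)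
    (h_cover : ∀ x, ∃ k, 0 < h k x) {ρ : Measure (LevelMeasures h)} {m : Measure (S × ℝ≥0)}
    (hρ : IsPoissonLaw ρ m) (g : SimpleFunc (S × ℝ≥0) ℝ≥0∞)
    (hg : ∀ c, c ≠ 0 → m (g ⁻¹' {c}) < ∞) :
    ∫ μ, expNeg (∫⁻ z, g z ∂μ.1) ∂ρ = expNeg (poissonExponent m g) := by
  have := hρ.isProbabilityMeasure
  let e := g.range.equivFin.symm
  let n := g.range.card
  let A : ℕ → Set (S × ℝ≥0) := fun j => if hj : j < n then g ⁻¹' {(e ⟨j, hj⟩ : ℝ≥0∞)} else ∅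
  have hAm : ∀ j, MeasurableSet (A j) := fun j => by
    by_cases hj : j < n
    · simp only [A, hj, dif_pos]; exact g.measurableSet_preimage _
    · simp [A, hj]
  have hAe : ∀ i : Fin n, A i = g ⁻¹' {(e i : ℝ≥0∞)} := fun i => by simp [A]
  have hAd : Pairwise fun i j => Disjoint (A i) (A j) := by
    intro i j hij
    by_cases hi : i < n
    · by_cases hj : j < n
      · simp only [A, hi, hj, dif_pos]
        refine Set.disjoint_left.2 fun z hz hz' => hij ?_
        have : e ⟨i, hi⟩ = e ⟨j, hj⟩ := Subtype.ext (hz.symm.trans hz')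
        simpa using e.injective this
      · simp [A, hj]
    · simp [A, hi]
  have hsum : ∀ μ : Measure (S × ℝ≥0), ∀ φ : ℝ≥0∞ → ℝ≥0∞,
      ∫⁻ z, φ (g z) ∂μ = ∑ i : Fin n, φ (e i) * μ (A i) := by
    intro μ φ
    have h1 : ∫⁻ z, φ (g z) ∂μ = (g.map φ).lintegral μ := by
      rw [← SimpleFunc.lintegral_eq_lintegral]; rfl
    rw [h1, SimpleFunc.map_lintegral, ← Finset.sum_coe_sort, ← e.sum_comp]
    exact Finset.sum_congr rfl fun i _ => by rw [hAe]
  have hind : iIndepFun (fun (i : Fin n) (μ : LevelMeasures h) => expNeg ((e i : ℝ≥0∞) * μ.1 (A i)))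
      ρ :=
    ((hρ.indep A hAm hAd).precomp Fin.val_injective).comp
      (fun i x => expNeg ((e i : ℝ≥0∞) * x))
      fun i => measurable_expNeg.comp (measurable_const.mul measurable_id)
  have hprod := hind.integral_fun_prod_eq_prod_integral fun i =>
    (measurable_expNeg.comp (measurable_const.mul
      (LevelMeasures.measurable_apply h_nonneg h_cover (hAm i)))).aestronglyMeasurable
  have hL : ∀ μ : LevelMeasures h, expNeg (∫⁻ z, g z ∂μ.1)
      = ∏ i : Fin n, expNeg ((e i : ℝ≥0∞) * μ.1 (A i)) := fun μ => by
    rw [← expNeg_sum]; exact congrArg expNeg (hsum μ.1 id)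
  simp only [hL]
  rw [hprod]
  have hR : poissonExponent m g
      = ∑ i : Fin n, ENNReal.ofReal (1 - expNeg (e i)) * m (A i) :=
    hsum m fun c => ENNReal.ofReal (1 - expNeg c)
  rw [hR, expNeg_sum]
  refine Finset.prod_congr rfl fun i _ => ?_
  refine hρ.integral_expNeg_mul_apply h_nonneg h_cover (hAm i) ?_
  by_cases h0 : (e i : ℝ≥0∞) = 0
  · exact .inl h0
  · exact .inr (by rw [hAe]; exact hg _ h0)

/-- The Laplace functional of a Poisson random measure. -/
lemma IsPoissonLaw.laplace (h_nonneg : ∀ k x, 0 ≤ h k x)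
    (h_cover : ∀ x, ∃ k, 0 < h k x) {ρ : Measure (LevelMeasures h)} {m : Measure (S × ℝ≥0)}
    [SigmaFinite m] (hρ : IsPoissonLaw ρ m) {f : S × ℝ≥0 → ℝ≥0∞} (hf : Measurable f) :
    ∫ μ, expNeg (∫⁻ z, f z ∂μ.1) ∂ρ = expNeg (poissonExponent m f) := by
  have := hρ.isProbabilityMeasure
  let B := spanningSets m
  have hBm : ∀ n, MeasurableSet (B n) := measurableSet_spanningSets m
  let g : ℕ → SimpleFunc (S × ℝ≥0) ℝ≥0∞ := fun n => (SimpleFunc.eapprox f n).restrict (B n)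
  have hgapp : ∀ n z, g n z = (B n).indicator (SimpleFunc.eapprox f n) z := fun n z =>
    SimpleFunc.restrict_apply _ (hBm n) z
  have hgmono : ∀ z, Monotone fun n => g n z := by
    intro z i j hij
    simp only [hgapp]
    by_cases hz : z ∈ B i
    · rw [Set.indicator_of_mem hz, Set.indicator_of_mem (monotone_spanningSets m hij hz)]
      exact SimpleFunc.monotone_eapprox f hij z
    · rw [Set.indicator_of_notMem hz]; exact zero_le
  have hglim : ∀ z, Tendsto (fun n => g n z) atTop (𝓝 (f z)) := by
    intro z
    refine (SimpleFunc.tendsto_eapprox hf z).congr' ?_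
    filter_upwards [eventually_ge_atTop (spanningSetsIndex m z)] with n hn
    rw [hgapp, Set.indicator_of_mem (mem_spanningSets_of_index_le m z hn)]
  have hgfin : ∀ n c, c ≠ 0 → m (g n ⁻¹' {c}) < ∞ := by
    intro n c hc
    refine lt_of_le_of_lt (measure_mono fun z hz => ?_) (measure_spanningSets_lt_top m n)
    by_contra hzB
    have h0 : g n z = 0 := by rw [hgapp, Set.indicator_of_notMem hzB]
    exact hc (hz.symm.trans h0)
  have hlimL : Tendsto (fun n => ∫ μ, expNeg (∫⁻ z, g n z ∂μ.1) ∂ρ) atTop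
      (𝓝 (∫ μ, expNeg (∫⁻ z, f z ∂μ.1) ∂ρ)) := by
    refine tendsto_integral_of_dominated_convergence (fun _ => 1) (fun n => ?_)
      (integrable_const _) (fun n => .of_forall fun _ => norm_expNeg_le_one _)
      (.of_forall fun μ => ?_)
    · exact (measurable_expNeg.comp (LevelMeasures.measurable_lintegral h_nonneg h_cover
        (g n).measurable)).aestronglyMeasurable
    · exact (continuous_expNeg.tendsto _).comp (lintegral_tendsto_of_tendsto_of_monotone
        (fun n => (g n).measurable.aemeasurable) (.of_forall hgmono) (.of_forall hglim))
  have hlimR : Tendsto (fun n => expNeg (poissonExponent m (g n))) atTop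
      (𝓝 (expNeg (poissonExponent m f))) := by
    refine (continuous_expNeg.tendsto _).comp (lintegral_tendsto_of_tendsto_of_monotone
      (fun n => ?_) (.of_forall fun z => ?_) (.of_forall fun z => ?_))
    · exact (measurable_const.sub
        (measurable_expNeg.comp (g n).measurable)).ennreal_ofReal.aemeasurable
    · intro i j hij
      exact ENNReal.ofReal_le_ofReal (sub_le_sub_left (expNeg_antitone (hgmono z hij)) _)
    · exact (ENNReal.continuous_ofReal.tendsto _).comp
        (((continuous_expNeg.tendsto _).comp (hglim z)).const_sub 1)
  have heq : ∀ n, ∫ μ, expNeg (∫⁻ z, g n z ∂μ.1) ∂ρ = expNeg (poissonExponent m (g n)) :=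
    fun n => hρ.laplace_simpleFunc h_nonneg h_cover (g n) (hgfin n)
  simp only [heq] at hlimL
  exact tendsto_nhds_unique hlimL hlimR

lemma poissonExponent_sum_indicator {E : Type*} [MeasurableSpace E] (m : Measure E)
    (s : Finset ℕ) {A : ℕ → Set E} (hAm : ∀ i, MeasurableSet (A i))
    (hAd : Pairwise fun i j => Disjoint (A i) (A j)) (c : ℕ → ℝ≥0∞) :
    poissonExponent m (fun x => ∑ i ∈ s, (A i).indicator (fun _ => c i) x)
      = ∑ i ∈ s, ENNReal.ofReal (1 - expNeg (c i)) * m (A i) := by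
  unfold poissonExponent
  simp only [expNeg_sum_indicator_of_disjoint c hAd]
  rw [lintegral_finsetSum _ fun i _ => measurable_const.indicator (hAm i)]
  refine Finset.sum_congr rfl fun i _ => ?_
  rw [lintegral_indicator (hAm i), setLIntegral_const]

lemma poissonExponent_indicator {E : Type*} [MeasurableSpace E] (m : Measure E)
    {A : Set E} (hAm : MeasurableSet A) (c : ℝ≥0∞) :
    poissonExponent m (A.indicator fun _ => c) = ENNReal.ofReal (1 - expNeg c) * m A := by
  unfold poissonExponent
  rw [← setLIntegral_const, ← lintegral_indicator hAm]
  refine lintegral_congr fun x => ?_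
  by_cases hx : x ∈ A <;> simp [hx, expNeg_zero]

/-- A law of counting measures with the Laplace functional of a Poisson random measure is a
Poisson law. -/
lemma isPoissonLaw_of_laplace (h_nonneg : ∀ k x, 0 ≤ h k x)
    (h_cover : ∀ x, ∃ k, 0 < h k x) {ρ : Measure (LevelMeasures h)} [IsProbabilityMeasure ρ]
    {m : Measure (S × ℝ≥0)} (hcount : ∀ᵐ μ ∂ρ, IsCountingMeasure μ.1)
    (hlap : ∀ f : S × ℝ≥0 → ℝ≥0∞, Measurable f →
      ∫ μ, expNeg (∫⁻ z, f z ∂μ.1) ∂ρ = expNeg (poissonExponent m f)) :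
    IsPoissonLaw ρ m := by
  have hmA : ∀ A : Set (S × ℝ≥0), MeasurableSet A → Measurable fun μ : LevelMeasures h => μ.1 A :=
    fun A hA => LevelMeasures.measurable_apply h_nonneg h_cover hA
  have hone : ∀ A : Set (S × ℝ≥0), MeasurableSet A → ∀ c : ℝ≥0∞,
      ∫ μ, expNeg (c * μ.1 A) ∂ρ = expNeg (ENNReal.ofReal (1 - expNeg c) * m A) := by
    intro A hA c
    rw [← poissonExponent_indicator m hA, ← hlap _ (measurable_const.indicator hA)]
    simp only [lintegral_indicator hA, setLIntegral_const]
  refine ⟨inferInstance, hcount, fun A hA hfin => ?_, fun A hAm hAd => ?_⟩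
  · have := Measure.isProbabilityMeasure_map (μ := ρ) (hmA A hA).aemeasurable
    have := Measure.isProbabilityMeasure_map (μ := poissonMeasure (m A).toNNReal)
      (measurable_from_nat (f := fun j : ℕ => (j : ℝ≥0∞))).aemeasurable
    refine measure_ennreal_ext_of_integral_expNeg fun n => ?_
    have hme : Measurable fun x : ℝ≥0∞ => expNeg (n * x) :=
      measurable_expNeg.comp (measurable_const.mul measurable_id)
    rw [integral_map (hmA A hA).aemeasurable hme.aestronglyMeasurable, hone A hA,
      integral_map measurable_from_nat.aemeasurable hme.aestronglyMeasurable]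
    simp only [expNeg_mul_nat]
    rw [integral_pow_poissonMeasure]
    have h1 : ENNReal.ofReal (1 - expNeg n) * m A
        = ENNReal.ofReal ((m A).toNNReal * (1 - expNeg n)) := by
      rw [ENNReal.ofReal_mul (NNReal.coe_nonneg _), ENNReal.ofReal_coe_nnreal,
        ENNReal.coe_toNNReal hfin.ne, mul_comm]
    rw [h1, expNeg_ofReal (mul_nonneg (NNReal.coe_nonneg _) (sub_nonneg.2 (expNeg_le_one _)))]
  · classical
    rw [iIndepFun_iff_map_fun_eq_infinitePi_map fun i => hmA _ (hAm i)]
    have hpi : Measurable fun (μ : LevelMeasures h) (i : ℕ) => μ.1 (A i) :=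
      measurable_pi_lambda _ fun i => hmA _ (hAm i)
    have := Measure.isProbabilityMeasure_map (μ := ρ) hpi.aemeasurable
    have := fun i => Measure.isProbabilityMeasure_map (μ := ρ) (hmA _ (hAm i)).aemeasurable
    refine measure_cube_ext_of_integral_expMonomial fun l => ?_
    have hmono : ∀ x : ℕ → ℝ≥0∞, expMonomial l x
        = ∏ i ∈ Finset.range (l.toFinset.sup id + 1), expNeg ((l.count i : ℝ≥0∞) * x i) := by
      intro x
      rw [expMonomial_apply, Finset.sum_list_map_count, ← expNeg_sum]
      congr 1
      simp only [nsmul_eq_mul]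
      refine Finset.sum_subset (fun i hi => ?_) fun i _ hi => ?_
      · exact Finset.mem_range_succ_iff.2 (Finset.le_sup (f := id) hi)
      · rw [List.count_eq_zero_of_not_mem (by simpa using hi)]; simp
    set N := l.toFinset.sup id + 1
    have hmi : ∀ i, Measurable fun x : ℝ≥0∞ => expNeg ((l.count i : ℝ≥0∞) * x) := fun i =>
      measurable_expNeg.comp (measurable_const.mul measurable_id)
    rw [integral_map hpi.aemeasurable
      (expMonomial l).continuous.measurable.aestronglyMeasurable]
    simp only [hmono]
    rw [integral_prod_infinitePi (fun i => ρ.map fun μ : LevelMeasures h => μ.1 (A i)) hmi N]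
    have hR : ∀ i, ∫ x, expNeg ((l.count i : ℝ≥0∞) * x) ∂(ρ.map fun μ => μ.1 (A i))
        = expNeg (ENNReal.ofReal (1 - expNeg (l.count i)) * m (A i)) := fun i => by
      rw [integral_map (hmA _ (hAm i)).aemeasurable (hmi i).aestronglyMeasurable, hone _ (hAm i)]
    simp only [hR]
    rw [← expNeg_sum, ← poissonExponent_sum_indicator m (Finset.range N) hAm hAd, ← hlap]
    · refine integral_congr_ae (.of_forall fun μ => ?_)
      simp only [← expNeg_sum]
      rw [lintegral_finsetSum _ fun i _ => measurable_const.indicator (hAm i)]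
      simp only [lintegral_indicator (hAm _), setLIntegral_const]
    · exact Finset.measurable_fun_sum _ fun i _ => measurable_const.indicator (hAm i)

end PoissonLaplace

/-! ### Existence of Poisson laws and of the Cox kernel -/

section PoissonKernel

lemma exists_measurable_partition_finite {E : Type*} [TopologicalSpace E] [MeasurableSpace E]
    [BorelSpace E] {w : ℕ → E →ᵇ ℝ} (w_cover : ∀ x, ∃ k, 0 < w k x) :
    ∃ D : ℕ → Set E, (∀ n, MeasurableSet (D n)) ∧ Pairwise (Function.onFun Disjoint D) ∧
      ⋃ n, D n = Set.univ ∧ ∀ (ν : LocationMeasures w) n, ν.1 (D n) < ∞ := by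
  let B : ℕ → Set E := fun n => {x | ENNReal.ofReal (1 / ((n.unpair.2 : ℝ) + 1))
    ≤ ENNReal.ofReal (w n.unpair.1 x)}
  have hBm : ∀ n, MeasurableSet (B n) := fun n =>
    measurableSet_le measurable_const (measurable_weight w _)
  refine ⟨disjointed B, fun n => MeasurableSet.disjointed hBm n, disjoint_disjointed B, ?_,
    fun ν n => ?_⟩
  · rw [iUnion_disjointed]
    refine Set.eq_univ_of_forall fun x => ?_
    obtain ⟨k, hk⟩ := w_cover x
    obtain ⟨m, hm⟩ := exists_nat_one_div_lt hk
    exact Set.mem_iUnion.2 ⟨Nat.pair k m, by simpa [B] using ENNReal.ofReal_le_ofReal hm.le⟩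
  · refine (measure_mono (disjointed_subset B n)).trans_lt ?_
    refine (meas_ge_le_lintegral_div (measurable_weight w _).aemeasurable ?_
      ENNReal.ofReal_ne_top).trans_lt (ENNReal.div_lt_top (ν.2 _).ne ?_)
    all_goals simpa using Nat.cast_add_one_pos _

variable {S : Type*} [TopologicalSpace S] [MeasurableSpace S] [BorelSpace S]
  [SecondCountableTopology S] [TopologicalSpace.MetrizableSpace S] {h : ℕ → S →ᵇ ℝ}

lemma LevelMeasures.measurableSet_isCountingMeasure (h_nonneg : ∀ k x, 0 ≤ h k x)
    (h_cover : ∀ x, ∃ k, 0 < h k x) :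
    MeasurableSet {μ : LevelMeasures h | IsCountingMeasure μ.1} := by
  obtain ⟨D, hDm, hDd, hDU, hDf⟩ :=
    exists_measurable_partition_finite (levelWeights_cover h_cover)
  exact _root_.measurableSet_isCountingMeasure (LevelMeasures.measurable_val h_nonneg h_cover)
    hDm hDd hDU fun μ n => hDf (μ.toWeighted h_nonneg) n

instance : Zero (LevelMeasures h) := ⟨⟨0, fun k K => by simp⟩⟩

lemma LevelMeasures.zero_val : (0 : LevelMeasures h).1 = 0 := rfl

/-- A random variable with the Laplace transform of a Poisson integral with finite mean is almost
surely finite. -/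
lemma ae_lt_top_of_laplace {E Ω : Type*} [MeasurableSpace E] [MeasurableSpace Ω] {P : Measure Ω}
    [IsProbabilityMeasure P] {X : Ω → Measure E} (hX : Measurable X) {m : Measure E}
    (hlap : ∀ f : E → ℝ≥0∞, Measurable f →
      ∫ ω, expNeg (∫⁻ z, f z ∂(X ω)) ∂P = expNeg (poissonExponent m f))
    {f : E → ℝ≥0∞} (hf : Measurable f) (hfin : ∫⁻ z, f z ∂m < ∞) :
    ∀ᵐ ω ∂P, ∫⁻ z, f z ∂(X ω) < ∞ := by
  have hm : Measurable fun ω => ∫⁻ z, f z ∂(X ω) := (Measure.measurable_lintegral hf).comp hX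
  set G : Set Ω := {ω | ∫⁻ z, f z ∂(X ω) < ∞} with hG
  have hGm : MeasurableSet G := measurableSet_lt hm measurable_const
  have hbound : ∀ n : ℕ, expNeg (((n + 1 : ℕ) : ℝ≥0∞)⁻¹ * ∫⁻ z, f z ∂m) ≤ P.real G := by
    intro n
    set t : ℝ≥0∞ := ((n + 1 : ℕ) : ℝ≥0∞)⁻¹ with ht
    have ht0 : t ≠ 0 := by simp [ht]
    have h1 : poissonExponent m (fun z => t * f z) ≤ t * ∫⁻ z, f z ∂m := by
      rw [← lintegral_const_mul _ hf]
      refine lintegral_mono fun z => ?_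
      by_cases hz : t * f z = ∞
      · simp [hz]
      · rw [expNeg_of_ne_top hz]
        refine (ENNReal.ofReal_le_ofReal (one_sub_exp_neg_le _)).trans ?_
        rw [ENNReal.ofReal_toReal hz]
    refine (expNeg_antitone h1).trans ?_
    rw [← hlap _ (hf.const_mul t), ← integral_indicator_one hGm]
    refine integral_mono (integrable_expNeg ((Measure.measurable_lintegral
      (hf.const_mul t)).comp hX).aemeasurable) ((integrable_const 1).indicator hGm) fun ω => ?_
    by_cases hω : ω ∈ G
    · rw [Set.indicator_of_mem hω]; exact expNeg_le_one _
    · have htop : ∫⁻ z, f z ∂(X ω) = ∞ := by simpa [hG] using hω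
      rw [Set.indicator_of_notMem hω]
      simp only [lintegral_const_mul t hf, htop, ENNReal.mul_top ht0, expNeg_top, le_refl]
  have hlim : Tendsto (fun n : ℕ => expNeg (((n + 1 : ℕ) : ℝ≥0∞)⁻¹ * ∫⁻ z, f z ∂m)) atTop
      (𝓝 1) := by
    rw [← expNeg_zero]
    refine (continuous_expNeg.tendsto _).comp ?_
    have h0 : Tendsto (fun n : ℕ => ((n + 1 : ℕ) : ℝ≥0∞)⁻¹) atTop (𝓝 0) :=
      ENNReal.tendsto_inv_nat_nhds_zero.comp (tendsto_add_atTop_nat 1)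
    simpa using ENNReal.Tendsto.mul_const h0 (.inr hfin.ne)
  have h1 : 1 ≤ P.real G := le_of_tendsto' hlim hbound
  have h2 : P G = 1 := by
    have h3 : P.real G = 1 := le_antisymm measureReal_le_one h1
    rw [← ENNReal.toReal_eq_one_iff]; exact h3
  exact (prob_compl_eq_zero_iff hGm).2 h2

/-- Existence of the law of a Poisson random measure in `M_{h_k}(S × [0, ∞))`. -/
lemma exists_poissonLaw (h_nonneg : ∀ k x, 0 ≤ h k x) (h_cover : ∀ x, ∃ k, 0 < h k x)
    (m : Measure (S × ℝ≥0)) [SFinite m] (hm : ∀ (k : ℕ) (K : ℝ≥0),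
      ∫⁻ z in {z : S × ℝ≥0 | z.2 ≤ K}, ENNReal.ofReal (h k z.1) ∂m < ∞) :
    ∃ ρ : Measure (LevelMeasures h), IsProbabilityMeasure ρ ∧
      (∀ᵐ μ ∂ρ, IsCountingMeasure μ.1) ∧ ∀ f : S × ℝ≥0 → ℝ≥0∞, Measurable f →
        ∫ μ, expNeg (∫⁻ z, f z ∂μ.1) ∂ρ = expNeg (poissonExponent m f) := by
  classical
  rcases isEmpty_or_nonempty (S × ℝ≥0) with hE | hE
  · refine ⟨Measure.dirac 0, inferInstance, .of_forall fun μ => ?_, fun f hf => ?_⟩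
    · rw [Measure.eq_zero_of_isEmpty μ.1]; exact isCountingMeasure_zero
    · have hme : Measurable fun μ : LevelMeasures h => expNeg (∫⁻ z, f z ∂μ.1) :=
        measurable_expNeg.comp (LevelMeasures.measurable_lintegral h_nonneg h_cover hf)
      rw [integral_dirac' _ _ hme.stronglyMeasurable, Measure.eq_zero_of_isEmpty m]
      simp [poissonExponent, LevelMeasures.zero_val]
  obtain ⟨P, hP, hlap⟩ := exists_poisson m
  have hX := measurable_pointSuperposition (E := S × ℝ≥0)
  let W : ℕ → ℕ → S × ℝ≥0 → ℝ≥0∞ := fun k K =>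
    {z : S × ℝ≥0 | z.2 ≤ (K : ℝ≥0)}.indicator fun z => ENNReal.ofReal (h k z.1)
  have hset : ∀ K : ℝ≥0, MeasurableSet {z : S × ℝ≥0 | z.2 ≤ K} := fun K =>
    measurableSet_le measurable_snd measurable_const
  have hWm : ∀ k K, Measurable (W k K) := fun k K =>
    ((measurable_weight h k).comp measurable_fst).indicator (hset K)
  let G : Set (ℕ → ℕ × (ℕ → S × ℝ≥0)) :=
    {ω | ∀ k K, ∫⁻ z, W k K z ∂(pointSuperposition ω) < ∞}
  have hGm : MeasurableSet G := by
    have : G = ⋂ k, ⋂ K, {ω | ∫⁻ z, W k K z ∂(pointSuperposition ω) < ∞} := by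
      ext ω; simp [G]
    rw [this]
    exact MeasurableSet.iInter fun k => MeasurableSet.iInter fun K => measurableSet_lt
      ((Measure.measurable_lintegral (hWm k K)).comp hX) measurable_const
  have hGae : ∀ᵐ ω ∂P, ω ∈ G := by
    refine ae_all_iff.2 fun k => ae_all_iff.2 fun K => ?_
    refine ae_lt_top_of_laplace hX hlap (hWm k K) ?_
    simp only [W]
    rw [lintegral_indicator (hset K)]
    exact hm k K
  have hGmem : ∀ ω ∈ G, ∀ (k : ℕ) (K : ℝ≥0), ∫⁻ z in {z : S × ℝ≥0 | z.2 ≤ K},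
      ENNReal.ofReal (h k z.1) ∂(pointSuperposition ω) < ∞ := by
    intro ω hω k K
    obtain ⟨N, hN⟩ := exists_nat_ge K
    refine lt_of_le_of_lt ?_ (hω k N)
    simp only [W]
    rw [lintegral_indicator (hset N)]
    exact lintegral_mono_set fun z hz => le_trans hz hN
  let Z : (ℕ → ℕ × (ℕ → S × ℝ≥0)) → LevelMeasures h := fun ω =>
    if hω : ω ∈ G then ⟨pointSuperposition ω, hGmem ω hω⟩ else 0
  have hZval : ∀ ω, (Z ω).1 = if ω ∈ G then pointSuperposition ω else 0 := by
    intro ω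
    by_cases hω : ω ∈ G
    · have : Z ω = ⟨pointSuperposition ω, hGmem ω hω⟩ := dif_pos hω
      rw [this, if_pos hω]
    · have : Z ω = 0 := dif_neg hω
      rw [this, if_neg hω, LevelMeasures.zero_val]
  have hZm : Measurable Z := by
    refine (LevelMeasures.isTestInduced h_nonneg).measurable ?_
    simp only [hZval]
    exact Measurable.ite hGm hX measurable_const
  refine ⟨P.map Z, Measure.isProbabilityMeasure_map hZm.aemeasurable, ?_, fun f hf => ?_⟩
  · rw [ae_map_iff hZm.aemeasurable
      (LevelMeasures.measurableSet_isCountingMeasure h_nonneg h_cover)]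
    refine .of_forall fun ω => ?_
    rw [hZval]
    split_ifs
    · exact isCountingMeasure_pointSuperposition ω
    · exact isCountingMeasure_zero
  · have hme : Measurable fun μ : LevelMeasures h => expNeg (∫⁻ z, f z ∂μ.1) :=
      measurable_expNeg.comp (LevelMeasures.measurable_lintegral h_nonneg h_cover hf)
    rw [integral_map hZm.aemeasurable hme.aestronglyMeasurable, ← hlap f hf]
    refine integral_congr_ae ?_
    filter_upwards [hGae] with ω hω
    rw [hZval, if_pos hω]

lemma lintegral_prod_halfLine_lt_top (ν : LocationMeasures h) [SFinite ν.1] (k : ℕ) (K : ℝ≥0) :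
    ∫⁻ z in {z : S × ℝ≥0 | z.2 ≤ K}, ENNReal.ofReal (h k z.1)
      ∂(ν.1.prod halfLineLebesgue) < ∞ := by
  have hset : {z : S × ℝ≥0 | z.2 ≤ K} = Set.univ ×ˢ Set.Iic K := by ext z; simp
  have hme : Measurable fun z : S × ℝ≥0 => ENNReal.ofReal (h k z.1) :=
    (measurable_weight h k).comp measurable_fst
  rw [hset, ← Measure.prod_restrict, Measure.restrict_univ, lintegral_prod _ hme.aemeasurable]
  simp only [lintegral_const, Measure.restrict_apply MeasurableSet.univ, Set.univ_inter,
    halfLineLebesgue_Iic]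
  rw [lintegral_mul_const _ (measurable_weight h k)]
  exact ENNReal.mul_lt_top (ν.2 k) ENNReal.coe_lt_top

lemma poissonExponent_prod_halfLine (ν : Measure S) [SFinite ν] {f : S × ℝ≥0 → ℝ}
    (hf : Measurable f) (hf0 : ∀ z, 0 ≤ f z) :
    poissonExponent (ν.prod halfLineLebesgue) (fun z => ENNReal.ofReal (f z))
      = ∫⁻ x, levelExponent f x ∂ν := by
  unfold poissonExponent levelExponent
  simp only [expNeg_ofReal (hf0 _)]
  rw [lintegral_prod _ (by fun_prop)]

/-- The kernel of Poisson laws with mean measures `ν × Λ`. -/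
lemma exists_poissonKernel (h_nonneg : ∀ k x, 0 ≤ h k x) (h_cover : ∀ x, ∃ k, 0 < h k x) :
    ∃ κ : Kernel (LocationMeasures h) (LevelMeasures h), IsMarkovKernel κ ∧
      ∀ ν, IsPoissonLaw (κ ν) (ν.1.prod halfLineLebesgue) := by
  have hsf : ∀ ν : LocationMeasures h, SigmaFinite ν.1 := LocationMeasures.sigmaFinite h_cover
  choose ρ hρ hcount hlap using fun ν : LocationMeasures h => exists_poissonLaw h_nonneg h_cover
    (ν.1.prod halfLineLebesgue) (lintegral_prod_halfLine_lt_top ν)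
  have hmeas : Measurable ρ := by
    refine (LevelMeasures.isTestInduced h_nonneg).measurable_kernel
      (levelWeights_nonneg h_nonneg) fun F hF => ?_
    have hFm := (continuous_of_mem_testClass hF).measurable
    have hF0 := nonneg_of_mem_testClass (levelWeights_nonneg h_nonneg) hF
    have heq : (fun ν : LocationMeasures h => ∫ μ, expNeg (∫⁻ z, ENNReal.ofReal (F z) ∂μ.1) ∂(ρ ν))
        = fun ν => expNeg (∫⁻ x, levelExponent F x ∂ν.1) := by
      funext ν
      rw [hlap ν _ hFm.ennreal_ofReal, poissonExponent_prod_halfLine ν.1 hFm hF0]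
    rw [heq]
    exact measurable_expNeg.comp ((Measure.measurable_lintegral (measurable_levelExponent hFm)).comp
      (LocationMeasures.measurable_val h_nonneg h_cover))
  exact ⟨⟨ρ, hmeas⟩, ⟨hρ⟩, fun ν => isPoissonLaw_of_laplace h_nonneg h_cover (hcount ν) (hlap ν)⟩

/-- The Laplace functional of a conditionally Poisson random measure. -/
lemma IsConditionallyPoisson.laplace (h_nonneg : ∀ k x, 0 ≤ h k x)
    (h_cover : ∀ x, ∃ k, 0 < h k x) {Q : Measure (LevelMeasures h)}
    {P : Measure (LocationMeasures h)} [IsProbabilityMeasure P] (hQ : IsConditionallyPoisson Q P)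
    {f : S × ℝ≥0 → ℝ} (hf : Measurable f) (hf0 : ∀ z, 0 ≤ f z) :
    ∫ μ, expNeg (∫⁻ z, ENNReal.ofReal (f z) ∂μ.1) ∂Q
      = ∫ ν, expNeg (∫⁻ x, levelExponent f x ∂ν.1) ∂P := by
  obtain ⟨κ, hκ, hpois, rfl⟩ := hQ
  have hm : Measurable fun μ : LevelMeasures h => expNeg (∫⁻ z, ENNReal.ofReal (f z) ∂μ.1) :=
    measurable_expNeg.comp (LevelMeasures.measurable_lintegral h_nonneg h_cover hf.ennreal_ofReal)
  have hm' : Measurable fun ν : LocationMeasures h => expNeg (∫⁻ x, levelExponent f x ∂ν.1) :=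
    measurable_expNeg.comp ((Measure.measurable_lintegral (measurable_levelExponent hf)).comp
      (LocationMeasures.measurable_val h_nonneg h_cover))
  rw [integral_eq_lintegral_of_nonneg_ae (.of_forall fun _ => expNeg_nonneg _)
      hm.aestronglyMeasurable,
    integral_eq_lintegral_of_nonneg_ae (.of_forall fun _ => expNeg_nonneg _)
      hm'.aestronglyMeasurable,
    Measure.lintegral_bind κ.aemeasurable hm.ennreal_ofReal.aemeasurable]
  congr 1
  refine lintegral_congr_ae ?_
  filter_upwards [hpois] with ν hν
  have := LocationMeasures.sigmaFinite h_cover ν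
  rw [← ofReal_integral_eq_lintegral_ofReal (.of_bound hm.aestronglyMeasurable 1
      (.of_forall fun _ => norm_expNeg_le_one _)) (.of_forall fun _ => expNeg_nonneg _),
    hν.laplace h_nonneg h_cover hf.ennreal_ofReal, poissonExponent_prod_halfLine ν.1 hf hf0]

end PoissonKernel

/-! ### Compactness and tightness in the space of location measures -/

section Compactness

variable {E : Type*} [TopologicalSpace E] [MeasurableSpace E] [BorelSpace E] {w : ℕ → E →ᵇ ℝ}

lemma integral_withDensity_weight (w_nonneg : ∀ k x, 0 ≤ w k x) (ν : Measure E) (f : E →ᵇ ℝ)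
    (k : ℕ) : ∫ x, f x ∂(ν.withDensity fun x => ENNReal.ofReal (w k x))
      = ∫ x, f x * w k x ∂ν := by
  rw [integral_withDensity_eq_integral_toReal_smul (measurable_weight w k)
    (.of_forall fun _ => ENNReal.ofReal_lt_top)]
  simp only [ENNReal.toReal_ofReal (w_nonneg k _), smul_eq_mul, mul_comm]

/-- The finite measures `h_k dν` of a location measure `ν`. -/
noncomputable def LocationMeasures.toFiniteMeasures (ν : LocationMeasures w) (k : ℕ) :
    FiniteMeasure E :=
  ⟨ν.1.withDensity fun x => ENNReal.ofReal (w k x), inferInstance⟩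

lemma LocationMeasures.integral_toFiniteMeasures (w_nonneg : ∀ k x, 0 ≤ w k x)
    (ν : LocationMeasures w) (f : E →ᵇ ℝ) (k : ℕ) :
    ∫ x, f x ∂(ν.toFiniteMeasures k : Measure E) = ∫ x, f x * w k x ∂ν.1 :=
  integral_withDensity_weight w_nonneg ν.1 f k

lemma LocationMeasures.isInducing_toFiniteMeasures (w_nonneg : ∀ k x, 0 ≤ w k x) :
    IsInducing (LocationMeasures.toFiniteMeasures (w := w)) := by
  constructor
  apply le_antisymm
  · rw [← continuous_iff_le_induced]
    refine continuous_pi fun k => continuous_iff_continuousAt.2 fun ν => ?_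
    refine FiniteMeasure.tendsto_iff_forall_integral_tendsto.2 fun f => ?_
    simp only [LocationMeasures.integral_toFiniteMeasures w_nonneg]
    exact (continuous_integral_mul_weight f k).tendsto ν
  · refine le_iInf fun k => le_iInf fun f => ?_
    have hg : Continuous fun μ : ℕ → FiniteMeasure E => ∫ x, f x ∂(μ k : Measure E) :=
      (FiniteMeasure.continuous_integral_boundedContinuousFunction f).comp (continuous_apply k)
    have heq : (fun ν : LocationMeasures w => ∫ x, f x * w k x ∂ν.1)
        = (fun μ : ℕ → FiniteMeasure E => ∫ x, f x ∂(μ k : Measure E)) ∘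
          LocationMeasures.toFiniteMeasures :=
      funext fun ν => (LocationMeasures.integral_toFiniteMeasures w_nonneg ν f k).symm
    rw [heq, ← induced_compose]
    exact induced_mono (continuous_iff_le_induced.1 hg)

lemma LocationMeasures.injective_toFiniteMeasures (w_cover : ∀ x, ∃ k, 0 < w k x) :
    Function.Injective (LocationMeasures.toFiniteMeasures (w := w)) := by
  intro ν ν' hν
  refine Subtype.ext ?_
  rw [← glueMeasure_withDensity w_cover ν.1, ← glueMeasure_withDensity w_cover ν'.1]
  congr 1
  funext k
  exact congrArg (fun μ : ℕ → FiniteMeasure E => (μ k : Measure E)) hν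

variable [TopologicalSpace.MetrizableSpace E]

lemma LocationMeasures.range_toFiniteMeasures (w_nonneg : ∀ k x, 0 ≤ w k x)
    (w_cover : ∀ x, ∃ k, 0 < w k x) :
    Set.range (LocationMeasures.toFiniteMeasures (w := w))
      = ⋂ (j : ℕ) (k : ℕ) (f : E →ᵇ ℝ), {μ : ℕ → FiniteMeasure E |
        ∫ x, (f * w j) x ∂(μ k : Measure E) = ∫ x, (f * w k) x ∂(μ j : Measure E)} := by
  have hfin : ∀ (μ : FiniteMeasure E) (j : ℕ),
      IsFiniteMeasure ((μ : Measure E).withDensity fun x => ENNReal.ofReal (w j x)) := fun μ j =>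
    isFiniteMeasure_withDensity_ofReal ((w j).integrable _).2
  ext μ
  simp only [Set.mem_range, Set.mem_iInter, Set.mem_ofPred_eq]
  constructor
  · rintro ⟨ν, rfl⟩ j k f
    rw [LocationMeasures.integral_toFiniteMeasures w_nonneg,
      LocationMeasures.integral_toFiniteMeasures w_nonneg]
    refine integral_congr_ae (.of_forall fun x => ?_)
    simp only [BoundedContinuousFunction.coe_mul, Pi.mul_apply]
    ring
  · intro hμ
    have hcompat : ∀ j k, (μ k : Measure E).withDensity (fun x => ENNReal.ofReal (w j x))
        = (μ j : Measure E).withDensity (fun x => ENNReal.ofReal (w k x)) := by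
      intro j k
      have := hfin (μ k) j
      have := hfin (μ j) k
      refine ext_of_forall_integral_eq_of_IsFiniteMeasure fun f => ?_
      rw [integral_withDensity_weight w_nonneg, integral_withDensity_weight w_nonneg]
      exact hμ j k f
    have hglue := withDensity_glueMeasure w_cover hcompat
    refine ⟨⟨glueMeasure w fun k => (μ k : Measure E), fun k => ?_⟩, funext fun k =>
      Subtype.ext (hglue k)⟩
    have := congrArg (fun m : Measure E => m Set.univ) (hglue k)
    simp only [withDensity_apply _ MeasurableSet.univ, Measure.restrict_univ] at this
    rw [this]
    exact measure_lt_top _ _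

lemma LocationMeasures.isClosedEmbedding_toFiniteMeasures (w_nonneg : ∀ k x, 0 ≤ w k x)
    (w_cover : ∀ x, ∃ k, 0 < w k x) :
    IsClosedEmbedding (LocationMeasures.toFiniteMeasures (w := w)) := by
  refine ⟨⟨LocationMeasures.isInducing_toFiniteMeasures w_nonneg,
    LocationMeasures.injective_toFiniteMeasures w_cover⟩, ?_⟩
  rw [LocationMeasures.range_toFiniteMeasures w_nonneg w_cover]
  have hc : ∀ (g : E →ᵇ ℝ) (k : ℕ),
      Continuous fun μ : ℕ → FiniteMeasure E => ∫ x, g x ∂(μ k : Measure E) := fun g k =>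
    (FiniteMeasure.continuous_integral_boundedContinuousFunction g).comp (continuous_apply k)
  exact isClosed_iInter fun j => isClosed_iInter fun k => isClosed_iInter fun f =>
    isClosed_eq (hc _ k) (hc _ j)

lemma LocationMeasures.t2Space (w_nonneg : ∀ k x, 0 ≤ w k x) (w_cover : ∀ x, ∃ k, 0 < w k x) :
    T2Space (LocationMeasures w) :=
  (LocationMeasures.isClosedEmbedding_toFiniteMeasures w_nonneg w_cover).isEmbedding.t2Space

/-- Location measures whose densities `h_k dν` are uniformly bounded and uniformly tight form a
compact set. -/
lemma LocationMeasures.isCompact_setOf_le (w_nonneg : ∀ k x, 0 ≤ w k x)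
    (w_cover : ∀ x, ∃ k, 0 < w k x) (c : ℕ → ℝ≥0) {u : ℕ → ℝ≥0} (hu : Tendsto u atTop (𝓝 0))
    {C : ℕ → ℕ → Set E} (hC : ∀ k n, IsCompact (C k n)) :
    IsCompact {ν : LocationMeasures w | ∀ k, ∫⁻ x, ENNReal.ofReal (w k x) ∂ν.1 ≤ c k ∧
      ∀ n, ∫⁻ x in (C k n)ᶜ, ENNReal.ofReal (w k x) ∂ν.1 ≤ u n} := by
  have hK := isCompact_univ_pi fun k =>
    isCompact_setOfPred_finiteMeasure_mass_le_compl_isCompact_le (E := E) (c k) hu (hC k)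
      (Or.inl inferInstance)
  convert (LocationMeasures.isClosedEmbedding_toFiniteMeasures w_nonneg
    w_cover).isCompact_preimage hK using 1
  ext ν
  simp only [Set.mem_preimage, Set.mem_univ_pi, Set.mem_ofPred_eq]
  refine forall_congr' fun k => and_congr ?_ (forall_congr' fun n => ?_)
  · rw [← ENNReal.coe_le_coe, FiniteMeasure.ennreal_mass]
    simp [LocationMeasures.toFiniteMeasures, withDensity_apply]
  · rw [← ENNReal.coe_le_coe, FiniteMeasure.ennreal_coeFn_eq_coeFn_toMeasure]
    simp [LocationMeasures.toFiniteMeasures,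
      withDensity_apply _ (hC k n).isClosed.measurableSet.compl]

end Compactness

section Tightness

/-- `1 - exp (-x)` for `x ∈ [0, ∞]`. -/
noncomputable def oneSubExpNeg (x : ℝ≥0∞) : ℝ≥0∞ := ENNReal.ofReal (1 - expNeg x)

lemma oneSubExpNeg_mono : Monotone oneSubExpNeg := fun _ _ hxy =>
  ENNReal.ofReal_le_ofReal (sub_le_sub_left (expNeg_antitone hxy) 1)

lemma oneSubExpNeg_le_one (x : ℝ≥0∞) : oneSubExpNeg x ≤ 1 := by
  unfold oneSubExpNeg
  rw [← ENNReal.ofReal_one]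
  exact ENNReal.ofReal_le_ofReal (by linarith [expNeg_nonneg x])

lemma oneSubExpNeg_le_self (x : ℝ≥0∞) : oneSubExpNeg x ≤ x := by
  induction x with
  | top => exact le_top
  | coe x =>
    unfold oneSubExpNeg
    rw [expNeg_of_ne_top ENNReal.coe_ne_top, ENNReal.coe_toReal]
    refine ENNReal.ofReal_le_of_le_toReal ?_
    rw [ENNReal.coe_toReal]
    linarith [Real.add_one_le_exp (-(x : ℝ))]

lemma oneSubExpNeg_pos {x : ℝ≥0∞} (hx : 0 < x) : 0 < oneSubExpNeg x := by
  unfold oneSubExpNeg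
  refine ENNReal.ofReal_pos.2 (sub_pos.2 ?_)
  exact lt_of_le_of_ne (expNeg_le_one x) fun h =>
    hx.ne' (expNeg_injective (h.trans expNeg_zero.symm))

lemma continuous_oneSubExpNeg : Continuous oneSubExpNeg :=
  ENNReal.continuous_ofReal.comp (continuous_const.sub continuous_expNeg)

lemma lintegral_oneSubExpNeg {Ω : Type*} [MeasurableSpace Ω] (P : Measure Ω)
    [IsProbabilityMeasure P] {X : Ω → ℝ≥0∞} (hX : Measurable X) :
    ∫⁻ ω, oneSubExpNeg (X ω) ∂P = ENNReal.ofReal (1 - ∫ ω, expNeg (X ω) ∂P) := by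
  have hi : Integrable (fun ω => expNeg (X ω)) P := integrable_expNeg hX.aemeasurable
  unfold oneSubExpNeg
  have hi' : Integrable (fun ω => 1 - expNeg (X ω)) P := (integrable_const _).sub hi
  rw [← ofReal_integral_eq_lintegral_ofReal hi'
    (.of_forall fun ω => sub_nonneg.2 (expNeg_le_one _)), integral_sub (integrable_const _) hi]
  simp

variable {E : Type*} [TopologicalSpace E] [PolishSpace E] [MeasurableSpace E] [BorelSpace E]
  {w : ℕ → E →ᵇ ℝ}

lemma LocationMeasures.measurable_lintegral (w_nonneg : ∀ k x, 0 ≤ w k x)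
    (w_cover : ∀ x, ∃ k, 0 < w k x) {f : E → ℝ≥0∞} (hf : Measurable f) :
    Measurable fun ν : LocationMeasures w => ∫⁻ x, f x ∂ν.1 :=
  (Measure.measurable_lintegral hf).comp (LocationMeasures.measurable_val w_nonneg w_cover)

/-- The law `P₀` dominates the law `P` in the Laplace order, up to a factor two. -/
def LaplaceDominated (P P₀ : Measure (LocationMeasures w)) : Prop :=
  ∀ G ∈ testClass w, (∀ x, G x ≤ 1) →
    ∫ ν, expNeg (∫⁻ x, ENNReal.ofReal (2 * G x) ∂ν.1) ∂P₀
      ≤ ∫ ν, expNeg (∫⁻ x, ENNReal.ofReal (G x) ∂ν.1) ∂P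

variable {P P₀ : Measure (LocationMeasures w)} [IsProbabilityMeasure P] [IsProbabilityMeasure P₀]

lemma LaplaceDominated.lintegral_le (hP : LaplaceDominated P P₀) (w_nonneg : ∀ k x, 0 ≤ w k x)
    (w_cover : ∀ x, ∃ k, 0 < w k x) {G : E → ℝ} (hG : G ∈ testClass w) (hG1 : ∀ x, G x ≤ 1) :
    ∫⁻ ν, oneSubExpNeg (∫⁻ x, ENNReal.ofReal (G x) ∂ν.1) ∂P
      ≤ ∫⁻ ν, oneSubExpNeg (2 * ∫⁻ x, ENNReal.ofReal (G x) ∂ν.1) ∂P₀ := by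
  have hGm := (continuous_of_mem_testClass hG).measurable
  have hm := LocationMeasures.measurable_lintegral w_nonneg w_cover hGm.ennreal_ofReal
  rw [lintegral_oneSubExpNeg _ hm, lintegral_oneSubExpNeg _ (hm.const_mul 2)]
  refine ENNReal.ofReal_le_ofReal (sub_le_sub_left ?_ 1)
  convert hP G hG hG1 using 5 with ν
  rw [← lintegral_const_mul _ hGm.ennreal_ofReal]
  refine lintegral_congr fun x => ?_
  rw [ENNReal.ofReal_mul zero_le_two, ENNReal.ofReal_ofNat]

lemma tendsto_lintegral_oneSubExpNeg {X : ℕ → LocationMeasures w → ℝ≥0∞}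
    {Y : LocationMeasures w → ℝ≥0∞} (hX : ∀ m, Measurable (X m))
    (hXY : ∀ ν, Tendsto (fun m => X m ν) atTop (𝓝 (Y ν))) :
    Tendsto (fun m => ∫⁻ ν, oneSubExpNeg (X m ν) ∂P) atTop (𝓝 (∫⁻ ν, oneSubExpNeg (Y ν) ∂P)) :=
  tendsto_lintegral_of_dominated_convergence (fun _ => 1)
    (fun m => continuous_oneSubExpNeg.measurable.comp (hX m))
    (fun m => .of_forall fun ν => oneSubExpNeg_le_one _) (by simp)
    (.of_forall fun ν => (continuous_oneSubExpNeg.tendsto _).comp (hXY ν))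

lemma LaplaceDominated.lintegral_compl_le (hP : LaplaceDominated P P₀)
    (w_nonneg : ∀ k x, 0 ≤ w k x) (w_le_one : ∀ k x, w k x ≤ 1) (w_cover : ∀ x, ∃ k, 0 < w k x)
    (k : ℕ) {C : Set E} (hC : IsClosed C) :
    ∫⁻ ν, oneSubExpNeg (∫⁻ x in Cᶜ, ENNReal.ofReal (w k x) ∂ν.1) ∂P
      ≤ ∫⁻ ν, oneSubExpNeg (2 * ∫⁻ x in Cᶜ, ENNReal.ofReal (w k x) ∂ν.1) ∂P₀ := by
  have hg : ∀ m, ∃ g : E →ᵇ ℝ, ∀ x, g x = 1 - hC.apprSeq m x := fun m =>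
    ⟨BoundedContinuousFunction.mkOfBound ⟨fun x => 1 - (hC.apprSeq m x : ℝ), by fun_prop⟩ 1
      (fun x y => by
        have hx : (hC.apprSeq m x : ℝ) ≤ 1 := HasOuterApproxClosed.apprSeq_apply_le_one hC m x
        have hy : (hC.apprSeq m y : ℝ) ≤ 1 := HasOuterApproxClosed.apprSeq_apply_le_one hC m y
        have hx0 := (hC.apprSeq m x).coe_nonneg
        have hy0 := (hC.apprSeq m y).coe_nonneg
        simp only [Real.dist_eq, ContinuousMap.coe_mk, abs_le]
        constructor <;> linarith), fun x => rfl⟩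
  choose g hg using hg
  have hg0 : ∀ m x, 0 ≤ g m x := fun m x => by
    have hx : (hC.apprSeq m x : ℝ) ≤ 1 := HasOuterApproxClosed.apprSeq_apply_le_one hC m x
    rw [hg]; linarith
  have hg1 : ∀ m x, g m x ≤ 1 := fun m x => by
    rw [hg]; linarith [(hC.apprSeq m x).coe_nonneg]
  have hmem : ∀ m, (fun x => g m x * w k x) ∈ testClass w := fun m => mul_mem_testClass (hg0 m) k
  have hle : ∀ m x, g m x * w k x ≤ w k x := fun m x =>
    mul_le_of_le_one_left (w_nonneg k x) (hg1 m x)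
  have hlim : ∀ ν : LocationMeasures w, Tendsto
      (fun m => ∫⁻ x, ENNReal.ofReal (g m x * w k x) ∂ν.1) atTop
      (𝓝 (∫⁻ x in Cᶜ, ENNReal.ofReal (w k x) ∂ν.1)) := by
    intro ν
    rw [← lintegral_indicator hC.measurableSet.compl]
    refine tendsto_lintegral_of_dominated_convergence (fun x => ENNReal.ofReal (w k x))
      (fun m => (continuous_of_mem_testClass (hmem m)).measurable.ennreal_ofReal)
      (fun m => .of_forall fun x => ENNReal.ofReal_le_ofReal (hle m x)) (ν.2 k).ne
      (.of_forall fun x => ?_)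
    have h1 := (tendsto_pi_nhds.1 (HasOuterApproxClosed.tendsto_apprSeq hC)) x
    have h2 : Tendsto (fun m => g m x) atTop
        (𝓝 (1 - ((C.indicator (fun _ => (1 : ℝ≥0)) x : ℝ≥0) : ℝ))) := by
      simp only [hg]
      exact tendsto_const_nhds.sub ((NNReal.continuous_coe.tendsto _).comp h1)
    have h3 := ENNReal.tendsto_ofReal (h2.mul_const (w k x))
    convert h3 using 2
    by_cases hx : x ∈ C <;> simp [hx]
  have hm : ∀ m, Measurable fun ν : LocationMeasures w =>
      ∫⁻ x, ENNReal.ofReal (g m x * w k x) ∂ν.1 := fun m =>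
    LocationMeasures.measurable_lintegral w_nonneg w_cover
      (continuous_of_mem_testClass (hmem m)).measurable.ennreal_ofReal
  refine le_of_tendsto_of_tendsto' (tendsto_lintegral_oneSubExpNeg hm hlim)
    (tendsto_lintegral_oneSubExpNeg (fun m => (hm m).const_mul 2) fun ν =>
      ENNReal.Tendsto.const_mul (hlim ν) (.inr (by simp))) fun m => ?_
  exact hP.lintegral_le w_nonneg w_cover (hmem m) fun x => (hle m x).trans (w_le_one k x)

lemma measure_lt_le_of_lintegral_oneSubExpNeg_le {Ω : Type*} [MeasurableSpace Ω] {P : Measure Ω}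
    {X : Ω → ℝ≥0∞} (hX : Measurable X) {δ ε : ℝ≥0∞} (hδ : 0 < δ)
    (h : ∫⁻ ω, oneSubExpNeg (X ω) ∂P ≤ oneSubExpNeg δ * ε) : P {ω | δ < X ω} ≤ ε := by
  have hpos := oneSubExpNeg_pos hδ
  have htop : oneSubExpNeg δ ≠ ∞ := ENNReal.ofReal_ne_top
  have h1 : P {ω | δ < X ω} ≤ P {ω | oneSubExpNeg δ ≤ oneSubExpNeg (X ω)} :=
    measure_mono fun ω hω => oneSubExpNeg_mono (le_of_lt hω)
  have h2 := (mul_meas_ge_le_lintegral (μ := P) (continuous_oneSubExpNeg.measurable.comp hX)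
    (oneSubExpNeg δ)).trans h
  exact h1.trans ((ENNReal.mul_le_mul_iff_right hpos.ne' htop).1 h2)

lemma exists_measure_mass_le (w_nonneg : ∀ k x, 0 ≤ w k x) (w_le_one : ∀ k x, w k x ≤ 1)
    (w_cover : ∀ x, ∃ k, 0 < w k x) (P₀ : Measure (LocationMeasures w)) [IsProbabilityMeasure P₀]
    (k : ℕ) {ε : ℝ≥0∞} (hε : 0 < ε) :
    ∃ c : ℝ≥0, ∀ P : Measure (LocationMeasures w), IsProbabilityMeasure P →
      LaplaceDominated P P₀ → P {ν | c < ∫⁻ x, ENNReal.ofReal (w k x) ∂ν.1} ≤ ε := by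
  have hm := LocationMeasures.measurable_lintegral w_nonneg w_cover (measurable_weight w k)
  have ht0 : Tendsto (fun n : ℕ => ENNReal.ofReal (1 / ((n : ℝ) + 1))) atTop (𝓝 0) := by
    simpa using ENNReal.tendsto_ofReal tendsto_one_div_add_atTop_nhds_zero_nat
  have hlim : Tendsto (fun n : ℕ => ∫⁻ ν : LocationMeasures w, oneSubExpNeg
      (2 * (ENNReal.ofReal (1 / ((n : ℝ) + 1)) * ∫⁻ x, ENNReal.ofReal (w k x) ∂ν.1)) ∂P₀)
      atTop (𝓝 (∫⁻ ν : LocationMeasures w, oneSubExpNeg 0 ∂P₀)) := by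
    refine tendsto_lintegral_oneSubExpNeg (fun n => (hm.const_mul _).const_mul _) fun ν => ?_
    have := ENNReal.Tendsto.const_mul (a := 2) (ENNReal.Tendsto.mul_const 
      (b := ∫⁻ x, ENNReal.ofReal (w k x) ∂ν.1) ht0 (.inr (ν.2 k).ne)) (.inr (by simp))
    simpa using this
  have hz : ∫⁻ ν : LocationMeasures w, oneSubExpNeg 0 ∂P₀ = 0 := by
    simp [oneSubExpNeg, expNeg_zero]
  rw [hz] at hlim
  have hη : 0 < oneSubExpNeg 1 * ε := ENNReal.mul_pos (oneSubExpNeg_pos one_pos).ne' hε.ne'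
  obtain ⟨n, hn⟩ := (hlim.eventually (gt_mem_nhds hη)).exists
  have hn0 : (0 : ℝ) < (n : ℝ) + 1 := by positivity
  have ht : 0 ≤ 1 / ((n : ℝ) + 1) := by positivity
  refine ⟨n + 1, fun P hP hdom => ?_⟩
  have hval : ∀ ν : LocationMeasures w, ∫⁻ x, ENNReal.ofReal (1 / ((n : ℝ) + 1) * w k x) ∂ν.1
      = ENNReal.ofReal (1 / ((n : ℝ) + 1)) * ∫⁻ x, ENNReal.ofReal (w k x) ∂ν.1 := fun ν => by
    rw [← lintegral_const_mul _ (measurable_weight w k)]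
    simp only [ENNReal.ofReal_mul ht]
  have h1 := hdom.lintegral_le w_nonneg w_cover
    (const_mul_mem_testClass (weight_mem_testClass k) ht) fun x =>
      mul_le_one₀ ((div_le_one hn0).2 (by linarith [n.cast_nonneg (α := ℝ)])) (w_nonneg k x)
        (w_le_one k x)
  simp only [hval] at h1
  have h2 := measure_lt_le_of_lintegral_oneSubExpNeg_le (hm.const_mul _) one_pos (h1.trans hn.le)
  refine (measure_mono fun ν hν => ?_).trans h2
  simp only [Set.mem_ofPred_eq] at hν ⊢
  have h3 : (1 : ℝ≥0∞) = ENNReal.ofReal (1 / ((n : ℝ) + 1)) * ((n + 1 : ℝ≥0) : ℝ≥0∞) := by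
    rw [← ENNReal.ofReal_coe_nnreal, ← ENNReal.ofReal_mul ht]
    push_cast
    rw [one_div_mul_cancel hn0.ne', ENNReal.ofReal_one]
  calc (1 : ℝ≥0∞) = _ := h3
    _ < _ := ENNReal.mul_lt_mul_right (ENNReal.ofReal_pos.2 (by positivity)).ne'
      ENNReal.ofReal_ne_top hν

lemma exists_isCompact_measure_compl_le (w_nonneg : ∀ k x, 0 ≤ w k x)
    (w_le_one : ∀ k x, w k x ≤ 1) (w_cover : ∀ x, ∃ k, 0 < w k x)
    (P₀ : Measure (LocationMeasures w)) [IsProbabilityMeasure P₀]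
    (k : ℕ) {δ ε : ℝ≥0∞} (hδ : 0 < δ) (hε : 0 < ε) :
    ∃ C : Set E, IsCompact C ∧ ∀ P : Measure (LocationMeasures w), IsProbabilityMeasure P →
      LaplaceDominated P P₀ → P {ν | δ < ∫⁻ x in Cᶜ, ENNReal.ofReal (w k x) ∂ν.1} ≤ ε := by
  have hm := LocationMeasures.measurable_lintegral w_nonneg w_cover (measurable_weight w k)
  have hη : 0 < oneSubExpNeg δ * ε := ENNReal.mul_pos (oneSubExpNeg_pos hδ).ne' hε.ne'
  obtain ⟨η, hη0, hηlt⟩ := exists_between hη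
  -- the mass `ν(w k)` is bounded by `c` up to small probability under `P₀`
  have htail : Tendsto (fun c : ℕ => P₀ {ν | (c : ℝ≥0∞) < ∫⁻ x, ENNReal.ofReal (w k x) ∂ν.1})
      atTop (𝓝 0) := by
    have hanti : Antitone fun c : ℕ =>
        {ν : LocationMeasures w | (c : ℝ≥0∞) < ∫⁻ x, ENNReal.ofReal (w k x) ∂ν.1} :=
      fun a b hab ν (hν : (b : ℝ≥0∞) < _) =>
        lt_of_le_of_lt (Nat.cast_le.2 hab) hν
    have := tendsto_measure_iInter_atTop (μ := P₀)
      (fun c => (measurableSet_lt measurable_const hm).nullMeasurableSet) hanti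
      ⟨0, measure_ne_top _ _⟩
    have hempty : ⋂ c : ℕ, {ν : LocationMeasures w |
        (c : ℝ≥0∞) < ∫⁻ x, ENNReal.ofReal (w k x) ∂ν.1} = ∅ := by
      refine Set.eq_empty_of_forall_notMem fun ν hν => ?_
      obtain ⟨c, hc⟩ := ENNReal.exists_nat_gt (ν.2 k).ne
      exact lt_asymm hc (Set.mem_iInter.1 hν c)
    rw [hempty, measure_empty] at this
    exact this
  obtain ⟨c, hc⟩ := (htail.eventually (gt_mem_nhds (ENNReal.half_pos hη0.ne'))).exists
  set B : Set (LocationMeasures w) := {ν | (c : ℝ≥0∞) < ∫⁻ x, ENNReal.ofReal (w k x) ∂ν.1}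
  have hB : MeasurableSet B := measurableSet_lt measurable_const hm
  have hdm := LocationMeasures.measurable_withDensity_weight (w := w) w_nonneg k
  let m : Measure E := (P₀.restrict Bᶜ).bind
    fun ν => ν.1.withDensity fun x => ENNReal.ofReal (w k x)
  have hmA : ∀ A, MeasurableSet A → m A
      = ∫⁻ ν in Bᶜ, ∫⁻ x in A, ENNReal.ofReal (w k x) ∂ν.1 ∂P₀ := fun A hA => by
    rw [Measure.bind_apply hA hdm.aemeasurable]
    simp only [withDensity_apply _ hA]
  have hmfin : IsFiniteMeasure m := by
    refine ⟨?_⟩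
    rw [hmA _ MeasurableSet.univ]
    simp only [Measure.restrict_univ]
    refine lt_of_le_of_lt (setLIntegral_mono measurable_const (g := fun _ => (c : ℝ≥0∞))
      fun ν hν => not_lt.1 hν) ?_
    rw [setLIntegral_const]
    exact ENNReal.mul_lt_top (by simp) (measure_lt_top _ _)
  have hη4 : 0 < η / 2 / 2 := ENNReal.half_pos (ENNReal.half_pos hη0.ne').ne'
  obtain ⟨C, hC, hCm⟩ := isTightMeasureSet_iff_exists_isCompact_measure_compl_le.1
    (isTightMeasureSet_singleton (μ := m)) _ hη4
  specialize hCm m rfl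
  have hCc := hC.isClosed.measurableSet.compl
  rw [hmA _ hCc] at hCm
  refine ⟨C, hC, fun P hP hdom => ?_⟩
  have hmC : Measurable fun ν : LocationMeasures w =>
      ∫⁻ x in Cᶜ, ENNReal.ofReal (w k x) ∂ν.1 := by
    simp only [← lintegral_indicator hCc]
    exact LocationMeasures.measurable_lintegral w_nonneg w_cover
      ((measurable_weight w k).indicator hCc)
  refine measure_lt_le_of_lintegral_oneSubExpNeg_le hmC hδ ?_
  refine (hdom.lintegral_compl_le w_nonneg w_le_one w_cover k hC.isClosed).trans ?_
  rw [← lintegral_add_compl _ hB]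
  calc _ ≤ ∫⁻ ν in B, 1 ∂P₀
          + ∫⁻ ν in Bᶜ, 2 * ∫⁻ x in Cᶜ, ENNReal.ofReal (w k x) ∂ν.1 ∂P₀ := by
        gcongr
        · exact oneSubExpNeg_le_one _
        · exact oneSubExpNeg_le_self _
    _ ≤ η / 2 + 2 * (η / 2 / 2) := by
        rw [setLIntegral_one, lintegral_const_mul _ hmC]
        gcongr
    _ = η := by
        rw [mul_comm, ENNReal.div_mul_cancel (by simp) (by simp), ENNReal.add_halves]
    _ ≤ _ := hηlt.le

/-- Laws dominated by a fixed law in the Laplace order are uniformly tight. -/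
lemma isTightMeasureSet_of_laplaceDominated (w_nonneg : ∀ k x, 0 ≤ w k x)
    (w_le_one : ∀ k x, w k x ≤ 1) (w_cover : ∀ x, ∃ k, 0 < w k x)
    (P₀ : Measure (LocationMeasures w)) [IsProbabilityMeasure P₀]
    {Γ : Set (Measure (LocationMeasures w))}
    (h_dom : ∀ P ∈ Γ, IsProbabilityMeasure P ∧ LaplaceDominated P P₀) : IsTightMeasureSet Γ := by
  rw [isTightMeasureSet_iff_exists_isCompact_measure_compl_le]
  intro ε hε
  obtain ⟨e, he0, he⟩ := ENNReal.exists_pos_sum_of_countable' hε.ne' (ℕ ⊕ ℕ × ℕ)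
  choose c hc using fun k => exists_measure_mass_le w_nonneg w_le_one w_cover P₀ k (he0 (.inl k))
  have hu0 : ∀ n : ℕ, 0 < (((n : ℝ≥0) + 1)⁻¹ : ℝ≥0) := fun n => by positivity
  choose C hC hCle using fun k n => exists_isCompact_measure_compl_le w_nonneg w_le_one w_cover P₀ k
    (ENNReal.coe_pos.2 (hu0 n)) (he0 (.inr (k, n)))
  have hu : Tendsto (fun n : ℕ => ((n : ℝ≥0) + 1)⁻¹) atTop (𝓝 0) := by
    have := tendsto_one_div_add_atTop_nhds_zero_nat (𝕜 := ℝ)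
    rw [← NNReal.tendsto_coe]
    simpa using this
  refine ⟨_, LocationMeasures.isCompact_setOf_le w_nonneg w_cover c hu hC, fun P hP => ?_⟩
  obtain ⟨hP1, hP2⟩ := h_dom P hP
  let B : ℕ ⊕ ℕ × ℕ → Set (LocationMeasures w) := Sum.elim
    (fun k => {ν | c k < ∫⁻ x, ENNReal.ofReal (w k x) ∂ν.1})
    (fun p => {ν | (((p.2 : ℝ≥0) + 1)⁻¹ : ℝ≥0)
      < ∫⁻ x in (C p.1 p.2)ᶜ, ENNReal.ofReal (w p.1 x) ∂ν.1})
  calc P _ ≤ P (⋃ i, B i) := by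
        refine measure_mono fun ν hν => ?_
        simp only [Set.mem_compl_iff, Set.mem_ofPred_eq, not_forall, not_and_or, not_le] at hν
        obtain ⟨k, hk | ⟨n, hn⟩⟩ := hν
        · exact Set.mem_iUnion.2 ⟨.inl k, hk⟩
        · exact Set.mem_iUnion.2 ⟨.inr (k, n), hn⟩
    _ ≤ ∑' i, P (B i) := measure_iUnion_le _
    _ ≤ ∑' i, e i := by
        refine ENNReal.tsum_le_tsum fun i => ?_
        rcases i with k | ⟨k, n⟩
        · exact hc k P hP1 hP2
        · exact hCle k n P hP1 hP2
    _ ≤ ε := he.le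

end Tightness

/-! ### Convergence of Laplace functionals -/

section LaplaceConvergence

variable {M : Type*} [TopologicalSpace M] [MeasurableSpace M] [BorelSpace M]

lemma tendsto_integral_expNeg_of_tendsto {α : Type*} {L : Filter α} {P : α → ProbabilityMeasure M}
    {P₀ : ProbabilityMeasure M} (hP : Tendsto P L (𝓝 P₀)) {φ : M → ℝ≥0∞} (hφ : Continuous φ) :
    Tendsto (fun a => ∫ μ, expNeg (φ μ) ∂(P a : Measure M)) L
      (𝓝 (∫ μ, expNeg (φ μ) ∂(P₀ : Measure M))) :=
  ProbabilityMeasure.tendsto_iff_forall_integral_tendsto.1 hP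
    (.ofNormedAddCommGroup (fun μ => expNeg (φ μ)) (continuous_expNeg.comp hφ) 1
      fun _ => norm_expNeg_le_one _)

variable {Ω : ℕ → Type*} [∀ n, MeasurableSpace (Ω n)] {prob : ∀ n, Measure (Ω n)}
  [∀ n, IsProbabilityMeasure (prob n)] {X : ∀ n, Ω n → M} {Q : ProbabilityMeasure M}

lemma MeasureTheory.TendstoInDistribution.integral_expNeg
    (hX : TendstoInDistribution X atTop id prob (Q : Measure M)) {φ : M → ℝ≥0∞}
    (hφ : Continuous φ) :
    Tendsto (fun n => ∫ ω, expNeg (φ (X n ω)) ∂(prob n)) atTop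
      (𝓝 (∫ μ, expNeg (φ μ) ∂(Q : Measure M))) := by
  have h := tendsto_integral_expNeg_of_tendsto hX.tendsto hφ
  have hm : Measurable fun μ => expNeg (φ μ) := measurable_expNeg.comp hφ.measurable
  simp only [ProbabilityMeasure.coe_mk, Measure.map_id] at h
  refine h.congr fun n => ?_
  exact integral_map (hX.forall_aemeasurable n) hm.aestronglyMeasurable

lemma IsTestInduced.tendstoInDistribution {E : Type*} [TopologicalSpace E] [MeasurableSpace E]
    [BorelSpace E] {w : ℕ → E →ᵇ ℝ} {toMeas : M → Measure E} (hM : IsTestInduced w toMeas)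
    (w_nonneg : ∀ k x, 0 ≤ w k x)
    (hcont : ∀ F ∈ testClass w, Continuous fun μ => ∫⁻ x, ENNReal.ofReal (F x) ∂(toMeas μ))
    (hX : ∀ n, Measurable (X n))
    (h : ∀ F ∈ testClass w, Tendsto
      (fun n => ∫ ω, expNeg (∫⁻ x, ENNReal.ofReal (F x) ∂(toMeas (X n ω))) ∂(prob n)) atTop
      (𝓝 (∫ μ, expNeg (∫⁻ x, ENNReal.ofReal (F x) ∂(toMeas μ)) ∂(Q : Measure M)))) :
    TendstoInDistribution X atTop id prob (Q : Measure M) := by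
  refine ⟨fun n => (hX n).aemeasurable, measurable_id.aemeasurable, ?_⟩
  refine hM.tendsto w_nonneg fun F hF => ?_
  have hm : Measurable fun μ => expNeg (∫⁻ x, ENNReal.ofReal (F x) ∂(toMeas μ)) :=
    measurable_expNeg.comp (hcont F hF).measurable
  simp only [ProbabilityMeasure.coe_mk, Measure.map_id]
  refine (h F hF).congr fun n => ?_
  exact (integral_map (hX n).aemeasurable hm.aestronglyMeasurable).symm

end LaplaceConvergence

/-! ### Point processes with uniform levels -/

section UniformLevels

variable {S : Type*} [TopologicalSpace S] [PolishSpace S] [MeasurableSpace S] [BorelSpace S]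
  {h : ℕ → S →ᵇ ℝ}

lemma measurable_levelTransform (r : ℝ≥0) {f : S × ℝ≥0 → ℝ} (hf : Measurable f) :
    Measurable (levelTransform r f) := by
  unfold levelTransform
  have h1 : StronglyMeasurable fun x => ∫ u in Set.Iic r, Real.exp (-f (x, u)) ∂halfLineLebesgue :=
    StronglyMeasurable.integral_prod_right' (f := fun z => Real.exp (-f z))
      (by fun_prop : Measurable fun z => Real.exp (-f z)).stronglyMeasurable
  have := h1.measurable
  fun_prop

lemma LevelMeasures.measurable_normalizedMarginal (h_nonneg : ∀ k x, 0 ≤ h k x)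
    (h_cover : ∀ x, ∃ k, 0 < h k x) (r : ℝ≥0) :
    Measurable (LevelMeasures.normalizedMarginal (h := h) r) := by
  refine (LocationMeasures.isTestInduced h_nonneg).measurable ?_
  refine Measure.measurable_of_measurable_coe _ fun A hA => ?_
  have hset : MeasurableSet {z : S × ℝ≥0 | z.2 ≤ r} :=
    measurableSet_le measurable_snd measurable_const
  have heq : (fun μ : LevelMeasures h => (μ.normalizedMarginal r).1 A)
      = fun μ : LevelMeasures h => (r⁻¹ : ℝ≥0) * μ.1 (Prod.fst ⁻¹' A ∩ {z | z.2 ≤ r}) := by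
    funext μ
    change (r⁻¹ • (μ.1.restrict {z : S × ℝ≥0 | z.2 ≤ r}).map Prod.fst) A = _
    rw [Measure.smul_apply, Measure.map_apply measurable_fst hA,
      Measure.restrict_apply (measurable_fst hA)]
    rfl
  rw [heq]
  exact ((Measure.measurable_coe ((measurable_fst hA).inter hset)).comp
    (LevelMeasures.measurable_val h_nonneg h_cover)).const_mul _

/-- The Laplace functional identity expressing that the levels of the points of `ξ` are
independent, uniform on `[0, r]` and independent of the locations. -/
def HasUniformLevels {Ω : Type*} [MeasurableSpace Ω] (r : ℝ≥0) (P : Measure Ω)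
    (ξ : Ω → LevelMeasures h) : Prop :=
  ∀ f : S × ℝ≥0 → ℝ, Measurable f → (∀ z, 0 ≤ f z) →
    ∫ ω, expNeg (∫⁻ z, ENNReal.ofReal (f z) ∂(ξ ω).1) ∂P =
      ∫ ω, expNeg (∫⁻ x, ENNReal.ofReal (levelTransform r f x) ∂((ξ ω).normalizedMarginal r).1) ∂P

lemma HasUniformLevels.abs_laplace_sub_le (h_nonneg : ∀ k x, 0 ≤ h k x)
    (h_cover : ∀ x, ∃ k, 0 < h k x) {Ω : Type*} [MeasurableSpace Ω] {r : ℝ≥0} {P : Measure Ω}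
    [IsProbabilityMeasure P] {ξ : Ω → LevelMeasures h} (hξ : HasUniformLevels r P ξ)
    (hξm : Measurable ξ) {f : S × ℝ≥0 → ℝ} (hf : Measurable f) (hf0 : ∀ z, 0 ≤ f z) {K : ℝ≥0}
    (hK : ∀ x u, K < u → f (x, u) = 0) (hr : 0 < r) (hKr : 2 * K ≤ r) :
    |∫ ω, expNeg (∫⁻ z, ENNReal.ofReal (f z) ∂(ξ ω).1) ∂P
      - ∫ ω, expNeg (∫⁻ x, levelExponent f x ∂((ξ ω).normalizedMarginal r).1) ∂P| ≤ 2 * K / r := by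
  rw [hξ f hf hf0, abs_sub_comm]
  have hΞ := (LevelMeasures.measurable_normalizedMarginal h_nonneg h_cover r).comp hξm
  have hb := levelTransform_bounds hf hf0 hK hr hKr
  have hmA : Measurable fun ω => ∫⁻ x, levelExponent f x ∂((ξ ω).normalizedMarginal r).1 :=
    (LocationMeasures.measurable_lintegral h_nonneg h_cover (measurable_levelExponent hf)).comp hΞ
  have hmB : Measurable fun ω =>
      ∫⁻ x, ENNReal.ofReal (levelTransform r f x) ∂((ξ ω).normalizedMarginal r).1 :=
    (LocationMeasures.measurable_lintegral h_nonneg h_cover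
      (measurable_levelTransform r hf).ennreal_ofReal).comp hΞ
  refine abs_integral_expNeg_sub_le hmA hmB (by positivity)
    (fun ω => lintegral_mono fun x => (hb x).1) fun ω => ?_
  rw [← lintegral_const_mul _ (measurable_levelExponent hf)]
  exact lintegral_mono fun x => (hb x).2

lemma abs_laplace_sub_levelExponent_le (h_nonneg : ∀ k x, 0 ≤ h k x)
    (h_cover : ∀ x, ∃ k, 0 < h k x) {Ω : Type*} [MeasurableSpace Ω] {P : Measure Ω}
    [IsProbabilityMeasure P] {X : Ω → LocationMeasures h} (hX : Measurable X) {G : S → ℝ}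
    (hG : Measurable G) {C : ℝ} (hC : 0 ≤ C) (hG0 : ∀ x, 0 ≤ G x) (hGC : ∀ x, G x ≤ C) (K : ℕ) :
    |∫ ω, expNeg (∫⁻ x, levelExponent (fun z => G z.1 * triangleDensity K z.2) x ∂(X ω).1) ∂P
      - ∫ ω, expNeg (∫⁻ x, ENNReal.ofReal (G x) ∂(X ω).1) ∂P| ≤ C * (2 / (K + 1)) := by
  have hm : Measurable (levelExponent fun z : S × ℝ≥0 => G z.1 * triangleDensity K z.2) := by
    refine measurable_levelExponent ?_
    have := (continuous_triangleDensity K).measurable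
    fun_prop
  have hmA : Measurable fun ω =>
      ∫⁻ x, levelExponent (fun z => G z.1 * triangleDensity K z.2) x ∂(X ω).1 :=
    (LocationMeasures.measurable_lintegral h_nonneg h_cover hm).comp hX
  have hmB : Measurable fun ω => ∫⁻ x, ENNReal.ofReal (G x) ∂(X ω).1 :=
    (LocationMeasures.measurable_lintegral h_nonneg h_cover hG.ennreal_ofReal).comp hX
  refine abs_integral_expNeg_sub_le hmA hmB (by positivity)
    (fun ω => lintegral_mono fun x => levelExponent_mul_triangleDensity_le hG0 K x) fun ω => ?_
  rw [← lintegral_const_mul _ hm]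
  exact lintegral_mono fun x => le_levelExponent_mul_triangleDensity hG hG0 hGC K x

/-- The measure `∫ φ_K(u) μ(dx × du)` on `S`, where `φ_K` is the triangular density. -/
noncomputable def LevelMeasures.triangleAverage (K : ℕ) (μ : LevelMeasures h) :
    LocationMeasures h :=
  ⟨(μ.1.withDensity fun z => (triangleDensity K z.2 : ℝ≥0∞)).map Prod.fst, fun k => by
    have hφ : Measurable fun z : S × ℝ≥0 => (triangleDensity K z.2 : ℝ≥0∞) :=
      ((continuous_triangleDensity K).measurable.comp measurable_snd).coe_nnreal_ennreal
    have hwt : Measurable fun z : S × ℝ≥0 => ENNReal.ofReal (h k z.1) :=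
      (measurable_weight h k).comp measurable_fst
    have hset : MeasurableSet {z : S × ℝ≥0 | z.2 ≤ (K : ℝ≥0) + 1} :=
      measurableSet_le measurable_snd measurable_const
    rw [lintegral_map (measurable_weight h k) measurable_fst,
      lintegral_withDensity_eq_lintegral_mul _ hφ hwt]
    refine lt_of_le_of_lt (lintegral_mono (g := fun z => ((2 / (K + 1) : ℝ≥0) : ℝ≥0∞) *
      {z : S × ℝ≥0 | z.2 ≤ (K : ℝ≥0) + 1}.indicator (fun z => ENNReal.ofReal (h k z.1)) z)
      fun z => ?_) ?_
    · simp only [Pi.mul_apply]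
      by_cases hz : z.2 ≤ (K : ℝ≥0) + 1
      · rw [Set.indicator_of_mem (by exact hz)]
        gcongr
        exact triangleDensity_le K z.2
      · simp [triangleDensity_of_lt (not_le.1 hz)]
    · rw [lintegral_const_mul _ (hwt.indicator hset), lintegral_indicator hset]
      exact ENNReal.mul_lt_top ENNReal.coe_lt_top (μ.2 k _)⟩

lemma LevelMeasures.lintegral_triangleAverage (K : ℕ) (μ : LevelMeasures h) {G : S → ℝ}
    (hG : Measurable G) (hG0 : ∀ x, 0 ≤ G x) :
    ∫⁻ x, ENNReal.ofReal (G x) ∂(μ.triangleAverage K).1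
      = ∫⁻ z, ENNReal.ofReal (G z.1 * triangleDensity K z.2) ∂μ.1 := by
  have hφ : Measurable fun z : S × ℝ≥0 => (triangleDensity K z.2 : ℝ≥0∞) :=
    ((continuous_triangleDensity K).measurable.comp measurable_snd).coe_nnreal_ennreal
  have hGm : Measurable fun z : S × ℝ≥0 => ENNReal.ofReal (G z.1) :=
    hG.ennreal_ofReal.comp measurable_fst
  unfold LevelMeasures.triangleAverage
  rw [lintegral_map hG.ennreal_ofReal measurable_fst,
    lintegral_withDensity_eq_lintegral_mul _ hφ hGm]
  refine lintegral_congr fun z => ?_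
  rw [Pi.mul_apply, ENNReal.ofReal_mul (hG0 _), ENNReal.ofReal_coe_nnreal, mul_comm]

lemma LevelMeasures.measurable_triangleAverage (h_nonneg : ∀ k x, 0 ≤ h k x)
    (h_cover : ∀ x, ∃ k, 0 < h k x) (K : ℕ) :
    Measurable (LevelMeasures.triangleAverage (h := h) K) := by
  refine (LocationMeasures.isTestInduced h_nonneg).measurable ?_
  exact (Measure.measurable_map _ measurable_fst).comp
    (measurable_withDensity (LevelMeasures.measurable_val h_nonneg h_cover)
      ((continuous_triangleDensity K).measurable.comp measurable_snd).coe_nnreal_ennreal)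

end UniformLevels

/-! ### The limit theorem -/

section Limit

variable {S : Type*} [TopologicalSpace S] [PolishSpace S] [MeasurableSpace S] [BorelSpace S]
  {h : ℕ → S →ᵇ ℝ} {r : ℕ → ℝ≥0} {Ω : ℕ → Type*} [∀ n, MeasurableSpace (Ω n)]
  {prob : ∀ n, Measure (Ω n)} [∀ n, IsProbabilityMeasure (prob n)]
  {ξ : ∀ n, Ω n → LevelMeasures h}
  {Q : ProbabilityMeasure (LevelMeasures h)} {P : ProbabilityMeasure (LocationMeasures h)}

lemma tendsto_laplace_sub_levelExponent (h_nonneg : ∀ k x, 0 ≤ h k x)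
    (h_cover : ∀ x, ∃ k, 0 < h k x) (r_tendsto : Tendsto r atTop atTop)
    (ξ_meas : ∀ n, Measurable (ξ n)) (hξ : ∀ n, HasUniformLevels (r n) (prob n) (ξ n))
    {F : S × ℝ≥0 → ℝ} (hF : F ∈ testClass (levelWeights h)) :
    Tendsto (fun n => ∫ ω, expNeg (∫⁻ z, ENNReal.ofReal (F z) ∂(ξ n ω).1) ∂(prob n)
      - ∫ ω, expNeg (∫⁻ x, levelExponent F x ∂((ξ n ω).normalizedMarginal (r n)).1) ∂(prob n))
      atTop (𝓝 0) := by
  obtain ⟨K, hK⟩ := exists_level_bound_of_mem_testClass hF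
  have hlim : Tendsto (fun n => 2 * (K : ℝ) / r n) atTop (𝓝 0) :=
    tendsto_const_nhds.div_atTop (NNReal.tendsto_coe_atTop.2 r_tendsto)
  refine squeeze_zero_norm' ?_ hlim
  filter_upwards [r_tendsto.eventually_ge_atTop (2 * K), r_tendsto.eventually_gt_atTop 0]
    with n hn hn0
  exact (hξ n).abs_laplace_sub_le h_nonneg h_cover (ξ_meas n)
    (continuous_of_mem_testClass hF).measurable
    (nonneg_of_mem_testClass (levelWeights_nonneg h_nonneg) hF) hK hn0 hn

lemma tendsto_laplace_levelExponent (h_nonneg : ∀ k x, 0 ≤ h k x)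
    (h_cover : ∀ x, ∃ k, 0 < h k x) (r_tendsto : Tendsto r atTop atTop)
    (ξ_meas : ∀ n, Measurable (ξ n)) (hξ : ∀ n, HasUniformLevels (r n) (prob n) (ξ n))
    (hQ : TendstoInDistribution ξ atTop id prob (Q : Measure (LevelMeasures h)))
    {F : S × ℝ≥0 → ℝ} (hF : F ∈ testClass (levelWeights h)) :
    Tendsto (fun n => ∫ ω, expNeg (∫⁻ x, levelExponent F x
      ∂((ξ n ω).normalizedMarginal (r n)).1) ∂(prob n)) atTop
      (𝓝 (∫ μ, expNeg (∫⁻ z, ENNReal.ofReal (F z) ∂μ.1) ∂(Q : Measure (LevelMeasures h)))) := by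
  have h1 := (hQ.integral_expNeg (LevelMeasures.continuous_lintegral h_nonneg hF)).sub
    (tendsto_laplace_sub_levelExponent h_nonneg h_cover r_tendsto ξ_meas hξ hF)
  simpa using h1

/-- Convergence of the normalized marginals implies convergence of the point processes. -/
lemma tendstoInDistribution_of_normalizedMarginal (h_nonneg : ∀ k x, 0 ≤ h k x)
    (h_cover : ∀ x, ∃ k, 0 < h k x) (r_tendsto : Tendsto r atTop atTop)
    (ξ_meas : ∀ n, Measurable (ξ n)) (hξ : ∀ n, HasUniformLevels (r n) (prob n) (ξ n))
    (hQP : IsConditionallyPoisson (Q : Measure (LevelMeasures h)) P)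
    (hP : TendstoInDistribution (fun n ω => (ξ n ω).normalizedMarginal (r n)) atTop id prob
      (P : Measure (LocationMeasures h))) :
    TendstoInDistribution ξ atTop id prob (Q : Measure (LevelMeasures h)) := by
  refine (LevelMeasures.isTestInduced h_nonneg).tendstoInDistribution
    (levelWeights_nonneg h_nonneg) (fun F hF => LevelMeasures.continuous_lintegral h_nonneg hF)
    ξ_meas fun F hF => ?_
  obtain ⟨G, hG, hFG⟩ := exists_testClass_levelExponent h_nonneg hF
  rw [hQP.laplace h_nonneg h_cover (continuous_of_mem_testClass hF).measurable
    (nonneg_of_mem_testClass (levelWeights_nonneg h_nonneg) hF)]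
  have h1 := tendsto_laplace_sub_levelExponent h_nonneg h_cover r_tendsto ξ_meas hξ hF
  simp only [hFG] at h1 ⊢
  simpa using h1.add (hP.integral_expNeg (continuous_lintegral_of_mem_testClass h_nonneg hG))

/-- The normalized marginals converge as soon as the triangular averages of the limit of the point
processes do. -/
lemma tendstoInDistribution_normalizedMarginal (h_nonneg : ∀ k x, 0 ≤ h k x)
    (h_cover : ∀ x, ∃ k, 0 < h k x) (r_tendsto : Tendsto r atTop atTop)
    (ξ_meas : ∀ n, Measurable (ξ n)) (hξ : ∀ n, HasUniformLevels (r n) (prob n) (ξ n))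
    (hQ : TendstoInDistribution ξ atTop id prob (Q : Measure (LevelMeasures h)))
    {L : Filter ℕ} [L.NeBot] (hL : L ≤ atTop)
    (hP : ∀ G ∈ testClass h, Tendsto (fun K : ℕ => ∫ μ : LevelMeasures h,
      expNeg (∫⁻ z, ENNReal.ofReal (G z.1 * triangleDensity K z.2) ∂μ.1)
        ∂(Q : Measure (LevelMeasures h))) L
      (𝓝 (∫ ν, expNeg (∫⁻ x, ENNReal.ofReal (G x) ∂ν.1) ∂(P : Measure (LocationMeasures h))))) :
    TendstoInDistribution (fun n ω => (ξ n ω).normalizedMarginal (r n)) atTop id prob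
      (P : Measure (LocationMeasures h)) := by
  have hΞ := fun n =>
    (LevelMeasures.measurable_normalizedMarginal h_nonneg h_cover (r n)).comp (ξ_meas n)
  refine (LocationMeasures.isTestInduced h_nonneg).tendstoInDistribution h_nonneg
    (fun F hF => continuous_lintegral_of_mem_testClass h_nonneg hF) hΞ fun G hG => ?_
  obtain ⟨C, hC, hGC⟩ := exists_bound_of_mem_testClass h_nonneg hG
  have hGm := (continuous_of_mem_testClass hG).measurable
  have hsmall : Tendsto (fun K : ℕ => C * (2 / ((K : ℝ) + 1))) atTop (𝓝 0) := by
    have := (tendsto_one_div_add_atTop_nhds_zero_nat (𝕜 := ℝ)).const_mul (C * 2)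
    simpa [div_eq_mul_inv, mul_assoc] using this
  refine Metric.tendsto_nhds.2 fun ε hε => ?_
  obtain ⟨K, hK1, hK2⟩ := ((Metric.tendsto_nhds.1 (hP G hG) (ε / 3) (by positivity)).and
    ((hsmall.mono_left hL).eventually (gt_mem_nhds (by positivity : 0 < ε / 3)))).exists
  filter_upwards [Metric.tendsto_nhds.1 (tendsto_laplace_levelExponent h_nonneg h_cover r_tendsto
    ξ_meas hξ hQ (mul_triangleDensity_mem_testClass hG K)) (ε / 3) (by positivity)] with n hn
  have h3 := abs_laplace_sub_levelExponent_le (P := prob n) h_nonneg h_cover (hΞ n) hGm hC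
    (fun x => (hGC x).1) (fun x => (hGC x).2) K
  rw [Real.dist_eq, abs_lt] at hK1 hn ⊢
  rw [abs_le] at h3
  simp only [Function.comp_apply] at h3
  constructor <;> linarith [h3.1, h3.2, hn.1, hn.2, hK1.1, hK1.2]

lemma laplace_le_of_levelExponent_le (h_nonneg : ∀ k x, 0 ≤ h k x)
    (h_cover : ∀ x, ∃ k, 0 < h k x) (r_tendsto : Tendsto r atTop atTop)
    (ξ_meas : ∀ n, Measurable (ξ n)) (hξ : ∀ n, HasUniformLevels (r n) (prob n) (ξ n))
    (hQ : TendstoInDistribution ξ atTop id prob (Q : Measure (LevelMeasures h)))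
    {F F' : S × ℝ≥0 → ℝ} (hF : F ∈ testClass (levelWeights h))
    (hF' : F' ∈ testClass (levelWeights h)) (hle : ∀ x, levelExponent F x ≤ levelExponent F' x) :
    ∫ μ, expNeg (∫⁻ z, ENNReal.ofReal (F' z) ∂μ.1) ∂(Q : Measure (LevelMeasures h))
      ≤ ∫ μ, expNeg (∫⁻ z, ENNReal.ofReal (F z) ∂μ.1) ∂(Q : Measure (LevelMeasures h)) := by
  have hΞ := fun n =>
    (LevelMeasures.measurable_normalizedMarginal h_nonneg h_cover (r n)).comp (ξ_meas n)
  have hint : ∀ {F : S × ℝ≥0 → ℝ}, F ∈ testClass (levelWeights h) → ∀ n, Integrable (fun ω =>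
      expNeg (∫⁻ x, levelExponent F x ∂((ξ n ω).normalizedMarginal (r n)).1)) (prob n) :=
    fun hF n => integrable_expNeg ((LocationMeasures.measurable_lintegral h_nonneg h_cover
      (measurable_levelExponent (continuous_of_mem_testClass hF).measurable)).comp
        (hΞ n)).aemeasurable
  refine le_of_tendsto_of_tendsto'
    (tendsto_laplace_levelExponent h_nonneg h_cover r_tendsto ξ_meas hξ hQ hF')
    (tendsto_laplace_levelExponent h_nonneg h_cover r_tendsto ξ_meas hξ hQ hF) fun n => ?_
  exact integral_mono (hint hF' n) (hint hF n) fun ω => expNeg_antitone (lintegral_mono hle)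

/-- Convergence of the point processes implies convergence of the normalized marginals. -/
lemma exists_tendstoInDistribution_normalizedMarginal (h_nonneg : ∀ k x, 0 ≤ h k x)
    (h_le_one : ∀ k x, h k x ≤ 1)
    (h_cover : ∀ x, ∃ k, 0 < h k x) (r_tendsto : Tendsto r atTop atTop)
    (ξ_meas : ∀ n, Measurable (ξ n)) (hξ : ∀ n, HasUniformLevels (r n) (prob n) (ξ n))
    (hQ : TendstoInDistribution ξ atTop id prob (Q : Measure (LevelMeasures h))) :
    ∃ P : ProbabilityMeasure (LocationMeasures h),
      TendstoInDistribution (fun n ω => (ξ n ω).normalizedMarginal (r n)) atTop id prob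
        (P : Measure (LocationMeasures h)) := by
  have hT2 := LocationMeasures.t2Space h_nonneg h_cover
  have hav := LevelMeasures.measurable_triangleAverage h_nonneg h_cover
  let PK : ℕ → ProbabilityMeasure (LocationMeasures h) := fun K => Q.map (hav K).aemeasurable
  have hPK : ∀ (K : ℕ) {G : S → ℝ}, Measurable G → (∀ x, 0 ≤ G x) →
      ∫ ν, expNeg (∫⁻ x, ENNReal.ofReal (G x) ∂ν.1) ∂(PK K : Measure (LocationMeasures h))
        = ∫ μ : LevelMeasures h, expNeg (∫⁻ z, ENNReal.ofReal (G z.1 * triangleDensity K z.2) ∂μ.1)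
          ∂(Q : Measure (LevelMeasures h)) := by
    intro K G hG hG0
    have hme : Measurable fun ν : LocationMeasures h =>
        expNeg (∫⁻ x, ENNReal.ofReal (G x) ∂ν.1) :=
      measurable_expNeg.comp
        (LocationMeasures.measurable_lintegral h_nonneg h_cover hG.ennreal_ofReal)
    rw [ProbabilityMeasure.toMeasure_map, integral_map (hav K).aemeasurable
      hme.aestronglyMeasurable]
    simp only [LevelMeasures.lintegral_triangleAverage K _ hG hG0]
  have hdom : ∀ K, LaplaceDominated (PK K : Measure (LocationMeasures h)) (PK 3) := by
    intro K G hG hG1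
    have hG0 := nonneg_of_mem_testClass h_nonneg hG
    have hGm := (continuous_of_mem_testClass hG).measurable
    rw [hPK 3 (hGm.const_mul 2) fun x => mul_nonneg zero_le_two (hG0 x), hPK K hGm hG0]
    exact laplace_le_of_levelExponent_le h_nonneg h_cover r_tendsto ξ_meas hξ hQ
      (mul_triangleDensity_mem_testClass hG K)
      (mul_triangleDensity_mem_testClass (const_mul_mem_testClass hG zero_le_two) 3) fun x =>
        (levelExponent_mul_triangleDensity_le hG0 K x).trans (le_levelExponent_two_mul hG0 hG1 x)
  have htight : IsTightMeasureSet
      {((μ : ProbabilityMeasure (LocationMeasures h)) : Measure (LocationMeasures h)) |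
        μ ∈ Set.range PK} := by
    refine isTightMeasureSet_of_laplaceDominated h_nonneg h_le_one h_cover (PK 3) ?_
    rintro _ ⟨_, ⟨K, rfl⟩, rfl⟩
    exact ⟨inferInstance, hdom K⟩
  obtain ⟨P, -, hP⟩ := (isCompact_closure_of_isTightMeasureSet htight).ultrafilter_le_nhds
    ((hyperfilter ℕ).map PK) (le_principal_iff.2 (Filter.mem_of_superset
      (Filter.range_mem_map) subset_closure))
  have hP' : Tendsto PK (hyperfilter ℕ) (𝓝 P) := hP
  refine ⟨P, tendstoInDistribution_normalizedMarginal h_nonneg h_cover r_tendsto ξ_meas hξ hQ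
    (Nat.hyperfilter_le_atTop) fun G hG => ?_⟩
  simp only [← hPK _ (continuous_of_mem_testClass hG).measurable
    (nonneg_of_mem_testClass h_nonneg hG)]
  exact tendsto_integral_expNeg_of_tendsto hP' (continuous_lintegral_of_mem_testClass h_nonneg hG)

lemma tendstoInDistribution_normalizedMarginal_of_isConditionallyPoisson
    (h_nonneg : ∀ k x, 0 ≤ h k x)
    (h_cover : ∀ x, ∃ k, 0 < h k x) (r_tendsto : Tendsto r atTop atTop)
    (ξ_meas : ∀ n, Measurable (ξ n)) (hξ : ∀ n, HasUniformLevels (r n) (prob n) (ξ n))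
    (hQP : IsConditionallyPoisson (Q : Measure (LevelMeasures h)) P)
    (hQ : TendstoInDistribution ξ atTop id prob (Q : Measure (LevelMeasures h))) :
    TendstoInDistribution (fun n ω => (ξ n ω).normalizedMarginal (r n)) atTop id prob
      (P : Measure (LocationMeasures h)) := by
  refine tendstoInDistribution_normalizedMarginal h_nonneg h_cover r_tendsto ξ_meas hξ hQ
    le_rfl fun G hG => ?_
  obtain ⟨C, hC, hGC⟩ := exists_bound_of_mem_testClass h_nonneg hG
  have hGm := (continuous_of_mem_testClass hG).measurable
  have hsmall : Tendsto (fun K : ℕ => C * (2 / ((K : ℝ) + 1))) atTop (𝓝 0) := by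
    have := (tendsto_one_div_add_atTop_nhds_zero_nat (𝕜 := ℝ)).const_mul (C * 2)
    simpa [div_eq_mul_inv, mul_assoc] using this
  refine tendsto_iff_dist_tendsto_zero.2 (squeeze_zero (fun _ => dist_nonneg) (fun K => ?_) hsmall)
  have hmem := mul_triangleDensity_mem_testClass hG K
  rw [hQP.laplace h_nonneg h_cover (continuous_of_mem_testClass hmem).measurable
    (nonneg_of_mem_testClass (levelWeights_nonneg h_nonneg) hmem), Real.dist_eq]
  exact abs_laplace_sub_levelExponent_le h_nonneg h_cover measurable_id hGm hC
    (fun x => (hGC x).1) (fun x => (hGC x).2) K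

/-- Every law of location measures is the mixing law of a conditionally Poisson law. -/
lemma exists_isConditionallyPoisson (h_nonneg : ∀ k x, 0 ≤ h k x)
    (h_cover : ∀ x, ∃ k, 0 < h k x) (P : ProbabilityMeasure (LocationMeasures h)) :
    ∃ Q : ProbabilityMeasure (LevelMeasures h),
      IsConditionallyPoisson (Q : Measure (LevelMeasures h)) P := by
  obtain ⟨κ, hκ, hpois⟩ := exists_poissonKernel h_nonneg h_cover
  exact ⟨⟨(P : Measure (LocationMeasures h)).bind κ, inferInstance⟩, κ, hκ, .of_forall hpois, rfl⟩

lemma eq_of_tendstoInDistribution (h_nonneg : ∀ k x, 0 ≤ h k x)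
    {Q Q' : ProbabilityMeasure (LevelMeasures h)}
    (hQ : TendstoInDistribution ξ atTop id prob (Q : Measure (LevelMeasures h)))
    (hQ' : TendstoInDistribution ξ atTop id prob (Q' : Measure (LevelMeasures h))) :
    (Q : Measure (LevelMeasures h)) = Q' :=
  (LevelMeasures.isTestInduced h_nonneg).measure_ext (levelWeights_nonneg h_nonneg) fun _ hF =>
    tendsto_nhds_unique (hQ.integral_expNeg (LevelMeasures.continuous_lintegral h_nonneg hF))
      (hQ'.integral_expNeg (LevelMeasures.continuous_lintegral h_nonneg hF))

end Limit

theorem mainTheorem6 {S : Type*} [TopologicalSpace S] [PolishSpace S] [MeasurableSpace S]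
    [BorelSpace S]
    (h : ℕ → S →ᵇ ℝ) (h_nonneg : ∀ k x, 0 ≤ h k x) (h_le_one : ∀ k x, h k x ≤ 1)
    (h_cover : ∀ x, ∃ k, 0 < h k x)
    (r : ℕ → ℝ≥0) (r_pos : ∀ n, 0 < r n) (r_tendsto : Tendsto r atTop atTop)
    {Ω : ℕ → Type*} [∀ n, MeasurableSpace (Ω n)] (prob : ∀ n, Measure (Ω n))
    [∀ n, IsProbabilityMeasure (prob n)]
    -- `ξ n` is a point process on `S × [0, r n]`
    (ξ : ∀ n, Ω n → LevelMeasures h) (ξ_meas : ∀ n, Measurable (ξ n))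
    (ξ_counting : ∀ n, ∀ᵐ ω ∂(prob n), IsCountingMeasure (ξ n ω).1)
    (ξ_supp : ∀ n, ∀ᵐ ω ∂(prob n), (ξ n ω).1 {z | r n < z.2} = 0)
    (Ξ : ∀ n, Ω n → LocationMeasures h)
    (Ξ_def : ∀ n ω, Ξ n ω = (ξ n ω).normalizedMarginal (r n))
    (laplace : ∀ n, ∀ f : S × ℝ≥0 → ℝ, Measurable f → (∀ z, 0 ≤ f z) →
      ∫ ω, expNeg (∫⁻ z, ENNReal.ofReal (f z) ∂(ξ n ω).1) ∂(prob n) =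
        ∫ ω, expNeg (∫⁻ x, ENNReal.ofReal (levelTransform (r n) f x) ∂(Ξ n ω).1) ∂(prob n)) :
    -- `ξ n` converges in distribution if and only if `Ξ n` does
    ((∃ Q : ProbabilityMeasure (LevelMeasures h), TendstoInDistribution ξ atTop id prob Q) ↔
      ∃ P : ProbabilityMeasure (LocationMeasures h), TendstoInDistribution Ξ atTop id prob P) ∧
    -- the limits are related by the conditionally Poisson property
    (∀ (Q : ProbabilityMeasure (LevelMeasures h)) (P : ProbabilityMeasure (LocationMeasures h)),
      TendstoInDistribution ξ atTop id prob Q → TendstoInDistribution Ξ atTop id prob P →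
        IsConditionallyPoisson (Q : Measure (LevelMeasures h)) P) ∧
    -- for limits so related, the two convergences are equivalent
    (∀ (Q : ProbabilityMeasure (LevelMeasures h)) (P : ProbabilityMeasure (LocationMeasures h)),
      IsConditionallyPoisson (Q : Measure (LevelMeasures h)) P →
        (TendstoInDistribution ξ atTop id prob Q ↔ TendstoInDistribution Ξ atTop id prob P)) := by
  obtain rfl : Ξ = fun n ω => (ξ n ω).normalizedMarginal (r n) :=
    funext fun n => funext fun ω => Ξ_def n ω
  have hξ : ∀ n, HasUniformLevels (r n) (prob n) (ξ n) := laplace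
  have poisson_limit : ∀ (Q : ProbabilityMeasure (LevelMeasures h))
      (P : ProbabilityMeasure (LocationMeasures h)),
      IsConditionallyPoisson (Q : Measure (LevelMeasures h)) P →
        TendstoInDistribution (fun n ω => (ξ n ω).normalizedMarginal (r n)) atTop id prob
          (P : Measure (LocationMeasures h)) →
        TendstoInDistribution ξ atTop id prob (Q : Measure (LevelMeasures h)) := fun Q P =>
    tendstoInDistribution_of_normalizedMarginal h_nonneg h_cover r_tendsto ξ_meas hξ
  refine ⟨⟨fun ⟨Q, hQ⟩ => exists_tendstoInDistribution_normalizedMarginal h_nonneg h_le_one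
    h_cover r_tendsto ξ_meas hξ hQ, fun ⟨P, hP⟩ => ?_⟩, fun Q P hQ hP => ?_, fun Q P hQP =>
    ⟨tendstoInDistribution_normalizedMarginal_of_isConditionallyPoisson h_nonneg h_cover r_tendsto
      ξ_meas hξ hQP, poisson_limit Q P hQP⟩⟩
  · obtain ⟨Q, hQP⟩ := exists_isConditionallyPoisson h_nonneg h_cover P
    exact ⟨Q, poisson_limit Q P hQP hP⟩
  · obtain ⟨Q', hQP⟩ := exists_isConditionallyPoisson h_nonneg h_cover P
    rw [eq_of_tendstoInDistribution h_nonneg hQ (poisson_limit Q' P hQP hP)]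
    exact hQP
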